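/- Let $n\ge 0$ be an integer and let $a,\kappa$ be real. Partitions have at most $n$ parts, $\lambda=(\lambda_1\ge\cdots\ge\lambda_n\ge 0)$, with $|\lambda|=\sum_i\lambda_i$; $\mu\subseteq\lambda$ means $\mu_i\le\lambda_i$ for all $i$, $\mu\subset\lambda$ means in addition $\mu\ne\lambda$, and $\mu<\lambda$ denotes the strict dominance order ($|\mu|=|\lambda|$, $\mu_1+\cdots+\mu_i\le\lambda_1+\cdots+\lambda_i$ for all $i$, $\mu\neq\lambda$). Put $$d_\lambda=\sum_{i=1}^n\lambda_i\bigl(\lambda_i-1+2\kappa(n-i)\bigr),\qquad e_\lambda=d_\lambda+a|\lambda| .$$ The Jack polynomial $P_\lambda$ is the unique symmetric polynomial in $\mathbb C[x_1,\dots,x_n]$ of the form $m_\lambda+\sum_{\mu<\lambda}u_{\lambda\mu}m_\mu$ (with $m_\mu$ the monomial symmetric polynomials) that is an eigenfunction of $$E_1=\sum_i x_i\frac{\partial}{\partial x_i}\quad\text{and}\quad D_2=\sum_i x_i^2\frac{\partial^2}{\partial x_i^2}+2\kappa\sum_{i\ne j}\frac{x_i^2}{x_i-x_j}\frac{\partial}{\partial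 x_i}.$$ The multivariable Bessel polynomial $Y_\lambda$ is the unique symmetric polynomial of the form $P_\lambda+\sum_{\mu\subset\lambda}u_{\lambda\mu}P_\mu$ that is an eigenfunction of $$D^B=\sum_i x_i^2\frac{\partial^2}{\partial x_i^2}+\sum_i(ax_i+2)\frac{\partial}{\partial x_i}+2\kappa\sum_{i\ne j}\frac{x_i^2}{x_i-x_j}\frac{\partial}{\partial x_i}.$$ The $BC_n$ Jacobi polynomial $P^{BC}_\lambda$ with real parameters $(k_1,k_2,k_3)$ is the unique function of $z=(z_1,\dots,z_n)$ of the form $(-4)^{|\lambda|}P_\lambda(t(z))+\sum_{\mu\subset\lambda}u_{\lambda\mu}P_\mu(t(z))$, where $t_i(z)=-\sinh^2(z_i/2)$ and the Jack polynomials have parameter $\kappa=k_3$, that is an eigenfunction of $$D^{BC}=\sum_{i}\frac{\partial^2}{\partial z_i^2}+\sum_{i}\Bigl(k_1\coth\tfrac{z_i}{2}+2k_2\coth z_i\Bigr)\frac{\partial}{\partial z_i}+k_3\sum_{i<j}\Bigl(\coth\tfrac{z_i-z_j}{2}\Bigl(\frac{\partial}{\partial z_i}-\frac{\partial}{\partial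 z_j}\Bigr)+\coth\tfrac{z_i+z_j}{2}\Bigl(\frac{\partial}{\partial z_i}+\frac{\partial}{\partial z_j}\Bigr)\Bigr).$$ **Proposition (limit transition).** Let $\lambda$ be a partition such that $e_\mu\ne e_\lambda$ for all partitions $\mu\subset\lambda$, and such that $d_\nu\ne d_\mu$ for all partitions $\mu\subseteq\lambda$ and $\nu<\mu$ (this second condition always holds if $\kappa\ge 0$). For $\epsilon\in\mathbb R$ set $$k_1=\tfrac12\bigl(a-1+2e^{\epsilon}\bigr),\qquad k_2=\tfrac14\bigl(a-1-2e^{\epsilon}\bigr),\qquad k_3=\kappa .$$ Then the Jack polynomials $P_\mu$ with $\mu\subseteq\lambda$, the polynomial $Y_\lambda$ and, for every $\epsilon\in\mathbb R$, the function $P^{BC}_\lambda$ with these parameters are well defined (each exists and is unique), and for all $z\in\mathbb C^n$ $$\lim_{\epsilon\to\infty}e^{-\epsilon|\lambda|}\,P^{BC}_\lambda(z_1+\epsilon,\dots,z_n+\epsilon)=Y_\lambda(e^{z_1},\dots,e^{z_n}).$$ -/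

import Mathlib

open Filter Topology

noncomputable section

namespace MultiBessel

variable {n : ℕ}

/-! A partition with at most `n` parts is an antitone map `l : Fin n → ℕ`. Inclusion of diagrams
`μ ⊆ l` is the pointwise order `μ ≤ l`, so that strict inclusion `μ ⊂ l` is `μ < l`. -/

/-- The weight `|l| = l₁ + ⋯ + lₙ`. -/
def weight (l : Fin n → ℕ) : ℕ := ∑ i, l i

/-- The strict dominance order `μ < l` (same weight, smaller partial sums, `μ ≠ l`). -/
def DomLT (μ l : Fin n → ℕ) : Prop :=
  μ ≠ l ∧ weight μ = weight l ∧
    ∀ i, ∑ j ∈ Finset.Iic i, μ j ≤ ∑ j ∈ Finset.Iic i, l j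

/-- The monomial symmetric polynomial: the sum of the monomials with exponent in the orbit of `l`
under permutations (each element of the orbit is counted once). -/
def monSym (l : Fin n → ℕ) : MvPolynomial (Fin n) ℂ :=
  ∑ α ∈ Finset.univ.image (fun σ : Equiv.Perm (Fin n) => l ∘ σ),
    ∏ i, MvPolynomial.X i ^ α i

/-- `E₁ = ∑ xᵢ ∂/∂xᵢ`. -/
def opE1 (P : MvPolynomial (Fin n) ℂ) : MvPolynomial (Fin n) ℂ :=
  ∑ i, MvPolynomial.X i * MvPolynomial.pderiv i P

/-- `D₂ = ∑ xᵢ² ∂²/∂xᵢ² + 2κ ∑_{i ≠ j} xᵢ² / (xᵢ - xⱼ) ∂/∂xᵢ`, applied to a polynomial and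
evaluated at a point `x` (meaningful when the coordinates of `x` are distinct). -/
def opD2 (κ : ℝ) (P : MvPolynomial (Fin n) ℂ) (x : Fin n → ℂ) : ℂ :=
  ∑ i, x i ^ 2 * MvPolynomial.eval x (MvPolynomial.pderiv i (MvPolynomial.pderiv i P)) +
    2 * (κ : ℂ) * ∑ i, ∑ j ∈ Finset.univ.erase i,
      x i ^ 2 / (x i - x j) * MvPolynomial.eval x (MvPolynomial.pderiv i P)

/-- `D^B = ∑ xᵢ² ∂²/∂xᵢ² + ∑ (a xᵢ + 2) ∂/∂xᵢ + 2κ ∑_{i ≠ j} xᵢ² / (xᵢ - xⱼ) ∂/∂xᵢ`, applied to a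
polynomial and evaluated at a point `x` (meaningful when the coordinates of `x` are distinct). -/
def opDB (a κ : ℝ) (P : MvPolynomial (Fin n) ℂ) (x : Fin n → ℂ) : ℂ :=
  ∑ i, x i ^ 2 * MvPolynomial.eval x (MvPolynomial.pderiv i (MvPolynomial.pderiv i P)) +
    ∑ i, ((a : ℂ) * x i + 2) * MvPolynomial.eval x (MvPolynomial.pderiv i P) +
    2 * (κ : ℂ) * ∑ i, ∑ j ∈ Finset.univ.erase i,
      x i ^ 2 / (x i - x j) * MvPolynomial.eval x (MvPolynomial.pderiv i P)

/-- The numbers `d_l = ∑ lᵢ (lᵢ - 1 + 2κ(n - i))`, where `i` runs from `1` to `n`. -/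
def eigD (κ : ℝ) (l : Fin n → ℕ) : ℝ :=
  ∑ i, (l i : ℝ) * ((l i : ℝ) - 1 + 2 * κ * ((n : ℝ) - ((i : ℕ) + 1 : ℝ)))

/-- The numbers `e_l = d_l + a |l|`. -/
def eigB (a κ : ℝ) (l : Fin n → ℕ) : ℝ := eigD κ l + a * (weight l : ℝ)

/-- The defining properties of the monic Jack polynomial `P_l` with parameter `κ`. -/
def IsJack (κ : ℝ) (l : Fin n → ℕ) (P : MvPolynomial (Fin n) ℂ) : Prop :=
  P.IsSymmetric ∧
  P - monSym l ∈ Submodule.span ℂ (monSym '' {μ | Antitone μ ∧ DomLT μ l}) ∧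
  (∃ c : ℂ, opE1 P = c • P) ∧
  ∃ c : ℂ, ∀ x : Fin n → ℂ, Function.Injective x → opD2 κ P x = c * MvPolynomial.eval x P

/-- The monic Jack polynomial `P_l`, i.e. the polynomial with the property `IsJack`. -/
def jack (κ : ℝ) (l : Fin n → ℕ) : MvPolynomial (Fin n) ℂ := Classical.epsilon (IsJack κ l)

/-- The defining properties of the multivariable Bessel polynomial `Y_l`. -/
def IsBessel (a κ : ℝ) (l : Fin n → ℕ) (Y : MvPolynomial (Fin n) ℂ) : Prop :=
  Y.IsSymmetric ∧
  Y - jack κ l ∈ Submodule.span ℂ (jack κ '' {μ | Antitone μ ∧ μ < l}) ∧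
  ∃ c : ℂ, ∀ x : Fin n → ℂ, Function.Injective x → opDB a κ Y x = c * MvPolynomial.eval x Y

/-- The multivariable Bessel polynomial `Y_l`, i.e. the polynomial with the property `IsBessel`. -/
def bessel (a κ : ℝ) (l : Fin n → ℕ) : MvPolynomial (Fin n) ℂ := Classical.epsilon (IsBessel a κ l)

/-- The hyperbolic cotangent. -/
def coth (w : ℂ) : ℂ := Complex.cosh w / Complex.sinh w

/-- The partial derivative `∂F/∂zᵢ` of a function of `n` complex variables. -/
def partialD (i : Fin n) (F : (Fin n → ℂ) → ℂ) (z : Fin n → ℂ) : ℂ :=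
  deriv (fun s : ℂ => F (Function.update z i s)) (z i)

/-- The operator `D^{BC}` in the variables `z`:
`∑ ∂ᵢ² + ∑ (k₁ coth(zᵢ/2) + 2k₂ coth zᵢ) ∂ᵢ
  + k₃ ∑_{i<j} (coth((zᵢ-zⱼ)/2) (∂ᵢ - ∂ⱼ) + coth((zᵢ+zⱼ)/2) (∂ᵢ + ∂ⱼ))`. -/
def opDBC (k₁ k₂ k₃ : ℝ) (F : (Fin n → ℂ) → ℂ) (z : Fin n → ℂ) : ℂ :=
  ∑ i, partialD i (partialD i F) z +
    ∑ i, ((k₁ : ℂ) * coth (z i / 2) + 2 * (k₂ : ℂ) * coth (z i)) * partialD i F z +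
    (k₃ : ℂ) * ∑ i, ∑ j ∈ Finset.Ioi i,
      (coth ((z i - z j) / 2) * (partialD i F z - partialD j F z) +
        coth ((z i + z j) / 2) * (partialD i F z + partialD j F z))

/-- The points at which no coefficient of `D^{BC}` has a pole. -/
def IsRegular (z : Fin n → ℂ) : Prop :=
  (∀ i, Complex.sinh (z i) ≠ 0) ∧
  ∀ i j, i ≠ j → Complex.sinh ((z i - z j) / 2) ≠ 0 ∧ Complex.sinh ((z i + z j) / 2) ≠ 0

/-- `P_l(t(z))` with `tᵢ = -sinh²(zᵢ/2)`, as a function of `z`. -/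
def jackT (κ : ℝ) (l : Fin n → ℕ) (z : Fin n → ℂ) : ℂ :=
  MvPolynomial.eval (fun i => -Complex.sinh (z i / 2) ^ 2) (jack κ l)

/-- The defining properties of the `BC_n` Jacobi polynomial `P^{BC}_l` with parameters
`k₁, k₂, k₃`, as a function of `z`. -/
def IsJacobiBC (k₁ k₂ k₃ : ℝ) (l : Fin n → ℕ) (F : (Fin n → ℂ) → ℂ) : Prop :=
  F - (-4 : ℂ) ^ weight l • jackT k₃ l ∈
    Submodule.span ℂ (jackT k₃ '' {μ | Antitone μ ∧ μ < l}) ∧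
  ∃ c : ℂ, ∀ z : Fin n → ℂ, IsRegular z → opDBC k₁ k₂ k₃ F z = c * F z

/-- The `BC_n` Jacobi polynomial, i.e. the function with the property `IsJacobiBC`. -/
def jacobiBC (k₁ k₂ k₃ : ℝ) (l : Fin n → ℕ) : (Fin n → ℂ) → ℂ :=
  Classical.epsilon (IsJacobiBC k₁ k₂ k₃ l)

end MultiBessel

end

/-!
The idea is to replace the differential operators by one family of operators on polynomials,
`besselOp a k p q = D₂ + a E₁ + p D₁ + q E₀`, with `E₀ = ∑ ∂ᵢ` and
`D₁ = ∑ xᵢ ∂ᵢ² + 2k ∑_{i ≠ j} xᵢ / (xᵢ - xⱼ) ∂ᵢ`. The Bessel operator is the case `(p, q) = (0, 2)`,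
and `D^{BC}` in the coordinates `t = -sinh²(z/2)` is the case `(p, q) = (-1, -(1/2 + k₁ + k₂))` with
`a = 1 + k₁ + 2k₂` (`opDBC_evalT`). Substituting `z + ε` and rescaling `t` by `-4 e^{-ε}`, which
turns `t(z + ε)` into `e^z + O(e^{-ε})`, changes the latter parameters into
`(4 e^{-ε}, 2 + (3a - 1) e^{-ε})`. These tend to `(0, 2)`, so the statement is continuity of an
eigenvector with given leading term.

That eigenvectors exist and are unique needs triangularity with respect to inclusion of diagrams.
As `D₂` and `E₁` are diagonal on Jack polynomials and `2 D₁ = [E₀, D₂]` (`sumDeriv_calogero`), all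
follows from one fact: `E₀ P_μ` is a combination of the `P_ν`, with `ν` obtained from `μ` by removing
one box (`sumDeriv_jack_mem`). The eigenvalue equation is then a linear system that is triangular for
the weight, with diagonal entries `e_μ - e_l` (`sysMatrix_injective`), and its solution depends
continuously on the parameters (`exists_tendsto_of_mulVec_eq`).

For irrational `κ` that fact is proved with Dunkl and Cherednik operators. The product
`cherednikProd k z` of the `z + ξᵢ` over the commuting Cherednik operators `ξᵢ` acts on `P_μ` by a
product over `i` of linear factors in `z`, one for each part of `μ`, so that for irrational `κ` it
separates partitions. Its commutation relation with the Dunkl operators controls which eigenvalues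
occur in `E₀ P_μ`. The general case follows from the irrational one by letting irrational parameters
tend to `κ`: Jack polynomials are continuous in the parameter wherever the eigenvalue `d_μ` is
separated from the lower ones (`tendsto_jack`).
-/

namespace MultiBessel
open MvPolynomial
variable {n : ℕ}

/-! ### Divided differences and Dunkl operators -/

/-- The linear operators on polynomials in `n` variables. -/
abbrev PolyOp (n : ℕ) := Module.End ℂ (MvPolynomial (Fin n) ℂ)

/-- The permutation `σ` of the variables, as a linear operator. -/
noncomputable def permOp (σ : Equiv.Perm (Fin n)) : PolyOp n := (rename σ).toLinearMap

/-- Multiplication by the variable `X i`. -/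
noncomputable def mulX (i : Fin n) : PolyOp n := LinearMap.mulLeft ℂ (X i)

theorem permOp_apply (σ : Equiv.Perm (Fin n)) (p : MvPolynomial (Fin n) ℂ) :
    permOp σ p = rename σ p := rfl

theorem mulX_apply (i : Fin n) (p : MvPolynomial (Fin n) ℂ) : mulX i p = X i * p := rfl

theorem permOp_mul (σ τ : Equiv.Perm (Fin n)) : permOp (σ * τ) = permOp σ * permOp τ := by
  refine LinearMap.ext fun p => ?_
  simp [permOp_apply, Module.End.mul_apply, rename_rename]

theorem permOp_one : permOp (1 : Equiv.Perm (Fin n)) = 1 := by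
  refine LinearMap.ext fun p => ?_
  simp [permOp_apply]

theorem swap_permOp_mul_self (i j : Fin n) :
    permOp (Equiv.swap i j) * permOp (Equiv.swap i j) = 1 := by
  rw [← permOp_mul, Equiv.swap_mul_self, permOp_one]

theorem permOp_mulX (σ : Equiv.Perm (Fin n)) (i : Fin n) :
    permOp σ * mulX i = mulX (σ i) * permOp σ := by
  refine LinearMap.ext fun p => ?_
  simp [permOp_apply, mulX_apply, Module.End.mul_apply]

theorem mulX_comm (i j : Fin n) : mulX i * mulX j = mulX j * mulX i := by
  refine LinearMap.ext fun p => ?_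
  simp only [mulX_apply, Module.End.mul_apply]
  ring

theorem permOp_swap_conj (σ : Equiv.Perm (Fin n)) (i j : Fin n) :
    permOp σ * permOp (Equiv.swap i j) = permOp (Equiv.swap (σ i) (σ j)) * permOp σ := by
  rw [← permOp_mul, ← permOp_mul, Equiv.mul_swap_eq_swap_mul]

theorem exists_divided_difference (i j : Fin n) (p : MvPolynomial (Fin n) ℂ) :
    ∃ q, (X i - X j) * q = p - rename (Equiv.swap i j) p := by
  induction p using MvPolynomial.induction_on with
  | C a => exact ⟨0, by simp⟩
  | add p q hp hq =>
    obtain ⟨a, ha⟩ := hp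
    obtain ⟨b, hb⟩ := hq
    exact ⟨a + b, by rw [mul_add, ha, hb, map_add]; ring⟩
  | mul_X p k hp =>
    obtain ⟨a, ha⟩ := hp
    simp only [map_mul, rename_X]
    rcases eq_or_ne k i with rfl | hi
    · refine ⟨a * X k + rename (Equiv.swap k j) p, ?_⟩
      rw [Equiv.swap_apply_left, mul_add, ← mul_assoc, ha]
      ring
    rcases eq_or_ne k j with rfl | hj
    · refine ⟨a * X k - rename (Equiv.swap i k) p, ?_⟩
      rw [Equiv.swap_apply_right, mul_sub, ← mul_assoc, ha]
      ring
    · refine ⟨a * X k, ?_⟩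
      rw [Equiv.swap_apply_of_ne_of_ne hi hj, ← mul_assoc, ha]
      ring

theorem X_sub_X_ne_zero {i j : Fin n} (h : i ≠ j) :
    (X i - X j : MvPolynomial (Fin n) ℂ) ≠ 0 :=
  sub_ne_zero.2 fun h' => h (X_injective h')

/-- The divided difference `(p - sᵢⱼ p) / (Xᵢ - Xⱼ)`, with the convention that it is `0` if
`i = j`. -/
noncomputable def divDiff (i j : Fin n) : PolyOp n :=
  if h : i = j then 0 else
  { toFun := fun p => (exists_divided_difference i j p).choose
    map_add' := fun p q => by
      apply mul_left_cancel₀ (X_sub_X_ne_zero h)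
      rw [mul_add, (exists_divided_difference i j _).choose_spec,
        (exists_divided_difference i j p).choose_spec,
        (exists_divided_difference i j q).choose_spec, map_add]
      ring
    map_smul' := fun c p => by
      apply mul_left_cancel₀ (X_sub_X_ne_zero h)
      rw [RingHom.id_apply, mul_smul_comm, (exists_divided_difference i j _).choose_spec,
        (exists_divided_difference i j p).choose_spec, map_smul, smul_sub] }

theorem divDiff_self (i : Fin n) : divDiff i i = 0 := by simp [divDiff]

theorem X_sub_X_mul_divDiff (i j : Fin n) (p : MvPolynomial (Fin n) ℂ) :
    (X i - X j) * divDiff i j p = p - rename (Equiv.swap i j) p := by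
  unfold divDiff
  split_ifs with h
  · subst h; simp
  · exact (exists_divided_difference i j p).choose_spec

theorem divDiff_eq_of_mul_eq {i j : Fin n} (h : i ≠ j) {p q : MvPolynomial (Fin n) ℂ}
    (hq : (X i - X j) * q = p - rename (Equiv.swap i j) p) : divDiff i j p = q :=
  mul_left_cancel₀ (X_sub_X_ne_zero h) ((X_sub_X_mul_divDiff i j p).trans hq.symm)

/-- The twisted Leibniz rule. -/
theorem divDiff_mul (i j : Fin n) (p q : MvPolynomial (Fin n) ℂ) :
    divDiff i j (p * q) = divDiff i j p * q + rename (Equiv.swap i j) p * divDiff i j q := by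
  rcases eq_or_ne i j with rfl | h
  · simp [divDiff_self]
  apply divDiff_eq_of_mul_eq h
  rw [mul_add, ← mul_assoc, X_sub_X_mul_divDiff, mul_left_comm, X_sub_X_mul_divDiff, map_mul]
  ring

theorem divDiff_X_left {i j : Fin n} (h : i ≠ j) : divDiff i j (X i) = 1 :=
  divDiff_eq_of_mul_eq h (by simp)

theorem divDiff_X_right {i j : Fin n} (h : i ≠ j) : divDiff i j (X j) = -1 :=
  divDiff_eq_of_mul_eq h (by simp)

theorem divDiff_eq_zero_of_swap {i j : Fin n} {p : MvPolynomial (Fin n) ℂ}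
    (hp : rename (Equiv.swap i j) p = p) : divDiff i j p = 0 := by
  rcases eq_or_ne i j with rfl | h
  · simp [divDiff_self]
  · exact divDiff_eq_of_mul_eq h (by rw [hp]; simp)

theorem divDiff_swap (i j : Fin n) (p : MvPolynomial (Fin n) ℂ) :
    divDiff i j (rename (Equiv.swap i j) p) = - divDiff i j p := by
  rcases eq_or_ne i j with rfl | h
  · simp [divDiff_self]
  apply divDiff_eq_of_mul_eq h
  rw [mul_neg, X_sub_X_mul_divDiff, rename_rename, ← Equiv.coe_trans]
  simp

theorem permOp_divDiff (σ : Equiv.Perm (Fin n)) (i j : Fin n) :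
    permOp σ * divDiff i j = divDiff (σ i) (σ j) * permOp σ := by
  rcases eq_or_ne i j with rfl | h
  · simp [divDiff_self]
  refine LinearMap.ext fun p => ?_
  simp only [Module.End.mul_apply, permOp_apply]
  symm
  apply divDiff_eq_of_mul_eq (σ.injective.ne h)
  have := congrArg (rename σ) (X_sub_X_mul_divDiff i j p)
  simp only [map_mul, map_sub, rename_X] at this
  rw [this, ← permOp_apply, ← permOp_apply, ← permOp_apply, ← permOp_apply,
    ← Module.End.mul_apply, ← Module.End.mul_apply, permOp_swap_conj]

/-- The partial derivative as a linear operator. -/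
noncomputable def derivOp (i : Fin n) : PolyOp n := (pderiv i).toLinearMap

theorem derivOp_apply (i : Fin n) (p : MvPolynomial (Fin n) ℂ) : derivOp i p = pderiv i p := rfl

theorem permOp_derivOp (σ : Equiv.Perm (Fin n)) (i : Fin n) :
    permOp σ * derivOp i = derivOp (σ i) * permOp σ := by
  refine LinearMap.ext fun p => ?_
  simp only [Module.End.mul_apply, permOp_apply, derivOp_apply]
  exact (pderiv_rename σ.injective i p).symm

/-- The Dunkl operators `yᵢ = ∂ᵢ + k ∑ⱼ (1 - sᵢⱼ) / (Xᵢ - Xⱼ)`. -/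
noncomputable def dunkl (k : ℂ) (i : Fin n) : PolyOp n := derivOp i + k • ∑ j, divDiff i j

theorem permOp_dunkl (k : ℂ) (σ : Equiv.Perm (Fin n)) (i : Fin n) :
    permOp σ * dunkl k i = dunkl k (σ i) * permOp σ := by
  simp only [dunkl, mul_add, add_mul, permOp_derivOp, mul_smul_comm, smul_mul_assoc,
    Finset.mul_sum, Finset.sum_mul, permOp_divDiff]
  congr 2
  exact Equiv.sum_comp σ (fun j => divDiff (σ i) j * permOp σ)

theorem dunkl_mulX_of_ne (k : ℂ) {i j : Fin n} (h : i ≠ j) :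
    dunkl k i * mulX j = mulX j * dunkl k i - k • permOp (Equiv.swap i j) := by
  refine LinearMap.ext fun p => ?_
  simp only [dunkl, Module.End.mul_apply, LinearMap.add_apply, LinearMap.sub_apply,
    LinearMap.smul_apply, LinearMap.sum_apply, derivOp_apply, mulX_apply, permOp_apply,
    divDiff_mul, Derivation.leibniz, pderiv_X_of_ne h.symm, smul_eq_mul, mul_zero, add_zero,
    Finset.sum_add_distrib]
  have h1 : ∑ m, divDiff i m (X j) * p = - p := by
    rw [Finset.sum_eq_single j]
    · rw [divDiff_X_right h]; ring
    · intro m _ hm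
      rw [divDiff_eq_zero_of_swap, zero_mul]
      rw [rename_X, Equiv.swap_apply_of_ne_of_ne h.symm hm.symm]
    · simp
  have h2 : ∑ m, rename (Equiv.swap i m) (X j) * divDiff i m p
      = X j * ∑ m, divDiff i m p + (X i - X j) * divDiff i j p := by
    rw [Finset.mul_sum, ← sub_eq_iff_eq_add', ← Finset.sum_sub_distrib, Finset.sum_eq_single j]
    · rw [rename_X, Equiv.swap_apply_right]; ring
    · intro m _ hm
      rw [rename_X, Equiv.swap_apply_of_ne_of_ne h.symm hm.symm, sub_self]
    · simp
  rw [h1, h2, X_sub_X_mul_divDiff, mul_add, mul_smul_comm]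
  simp only [smul_add, smul_sub, smul_neg]
  ring

theorem dunkl_mulX_self (k : ℂ) (i : Fin n) :
    dunkl k i * mulX i = mulX i * dunkl k i + 1 +
      k • ∑ j, if j = i then 0 else permOp (Equiv.swap i j) := by
  refine LinearMap.ext fun p => ?_
  simp only [dunkl, Module.End.mul_apply, LinearMap.add_apply,
    LinearMap.smul_apply, LinearMap.sum_apply, derivOp_apply, mulX_apply,
    divDiff_mul, Derivation.leibniz, pderiv_X_self, smul_eq_mul, Module.End.one_apply,
    Finset.sum_add_distrib]
  have h1 : ∑ m, divDiff i m (X i) * p + ∑ m, rename (Equiv.swap i m) (X i) * divDiff i m p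
      = X i * ∑ m, divDiff i m p
        + ∑ m, (if m = i then (0 : PolyOp n) else permOp (Equiv.swap i m)) p := by
    rw [Finset.mul_sum, ← Finset.sum_add_distrib, ← Finset.sum_add_distrib]
    refine Finset.sum_congr rfl fun m _ => ?_
    split_ifs with hm
    · subst hm; simp [divDiff_self]
    · rw [divDiff_X_left (Ne.symm hm), rename_X, Equiv.swap_apply_left, permOp_apply]
      linear_combination - X_sub_X_mul_divDiff i m p
  rw [h1, mul_add, mul_smul_comm, smul_add]
  ring

theorem dunkl_apply_one (k : ℂ) (i : Fin n) : dunkl k i 1 = 0 := by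
  simp only [dunkl, LinearMap.add_apply, LinearMap.smul_apply, LinearMap.sum_apply, derivOp_apply]
  simp [divDiff_eq_zero_of_swap]

/-- An operator commuting with all multiplications is determined by its value at `1`. -/
theorem eq_zero_of_commute_mulX {A : PolyOp n} (h : ∀ i, Commute A (mulX i)) (h1 : A 1 = 0) :
    A = 0 := by
  refine LinearMap.ext fun p => ?_
  rw [LinearMap.zero_apply]
  induction p using MvPolynomial.induction_on with
  | C a =>
    rw [show (C a : MvPolynomial (Fin n) ℂ) = a • 1 by rw [smul_eq_C_mul, mul_one], map_smul, h1,
      smul_zero]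
  | add p q hp hq => rw [map_add, hp, hq, add_zero]
  | mul_X p k hp =>
    rw [mul_comm, ← mulX_apply, ← Module.End.mul_apply, (h k).eq, Module.End.mul_apply, hp, map_zero]

theorem permOp_swap_dunkl_of_ne (k : ℂ) {i j m : Fin n} (hi : m ≠ i) (hj : m ≠ j) :
    permOp (Equiv.swap i j) * dunkl k m = dunkl k m * permOp (Equiv.swap i j) := by
  rw [permOp_dunkl, Equiv.swap_apply_of_ne_of_ne hi hj]

/-- The Dunkl operators commute: by the Jacobi identity, their commutator commutes with all
multiplications, and it annihilates `1`. -/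
theorem dunkl_commute (k : ℂ) (i j : Fin n) : Commute (dunkl k i) (dunkl k j) := by
  rcases eq_or_ne i j with rfl | hij
  · exact Commute.refl _
  -- `[yᵢ, yⱼ]` commutes with the `i`-th multiplication; used for both orders of `i`, `j`
  have key : ∀ i j : Fin n, i ≠ j →
      Commute (dunkl k i * dunkl k j - dunkl k j * dunkl k i) (mulX i) := by
    intro i j hij
    have e1 := dunkl_mulX_self k i
    have e2 := dunkl_mulX_of_ne k hij.symm
    set T := ∑ m, if m = i then (0 : PolyOp n) else permOp (Equiv.swap i m) with hT
    have e3 : dunkl k j * T - T * dunkl k j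
        = (dunkl k j - dunkl k i) * permOp (Equiv.swap j i) := by
      rw [hT, Finset.mul_sum, Finset.sum_mul, ← Finset.sum_sub_distrib,
        Finset.sum_eq_single j]
      · rw [if_neg hij.symm, permOp_dunkl, Equiv.swap_apply_right, sub_mul, Equiv.swap_comm]
      · intro m _ hm
        split_ifs with h
        · simp
        · rw [permOp_swap_dunkl_of_ne k hij.symm hm.symm, sub_self]
      · simp
    have e4 : permOp (Equiv.swap j i) * dunkl k i = dunkl k j * permOp (Equiv.swap j i) := by
      rw [permOp_dunkl, Equiv.swap_apply_right]
    set s := permOp (Equiv.swap j i)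
    set a := dunkl k i
    set b := dunkl k j
    set x := mulX i
    have f1 : a * b * x = x * (a * b) + b + k • (T * b) - k • (a * s) := by
      rw [mul_assoc, e2, mul_sub, ← mul_assoc, e1, mul_smul_comm, add_mul, add_mul, one_mul,
        smul_mul_assoc, mul_assoc]
    have f2 : b * a * x = x * (b * a) - k • (b * s) + b + k • (b * T) := by
      rw [mul_assoc, e1, mul_add, mul_add, ← mul_assoc b, e2, sub_mul, smul_mul_assoc, e4,
        mul_one, mul_smul_comm, mul_assoc]
    have e5 : b * T = T * b + (b - a) * s := by rw [← e3]; abel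
    rw [commute_iff_eq, sub_mul, mul_sub, f1, f2, e5]
    simp only [sub_mul, smul_add, smul_sub]
    abel
  rw [commute_iff_eq, ← sub_eq_zero]
  apply eq_zero_of_commute_mulX
  · intro m
    rcases eq_or_ne m i with rfl | hmi
    · exact key _ _ hij
    rcases eq_or_ne m j with rfl | hmj
    · have := (key _ _ hij.symm).neg_left
      rwa [neg_sub] at this
    · have e1 := dunkl_mulX_of_ne k hmi.symm
      have e2 := dunkl_mulX_of_ne k hmj.symm
      have e4 := permOp_swap_dunkl_of_ne k (i := j) (j := m) hij hmi.symm
      have f1 : dunkl k i * dunkl k j * mulX m = mulX m * (dunkl k i * dunkl k j)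
          - k • (permOp (Equiv.swap i m) * dunkl k j)
          - k • (dunkl k i * permOp (Equiv.swap j m)) := by
        rw [mul_assoc, e2, mul_sub, ← mul_assoc, e1, mul_smul_comm, sub_mul, smul_mul_assoc,
          mul_assoc]
      have f2 : dunkl k j * dunkl k i * mulX m = mulX m * (dunkl k j * dunkl k i)
          - k • (permOp (Equiv.swap j m) * dunkl k i)
          - k • (dunkl k j * permOp (Equiv.swap i m)) := by
        rw [mul_assoc, e1, mul_sub, ← mul_assoc, e2, mul_smul_comm, sub_mul, smul_mul_assoc,
          mul_assoc]
      rw [commute_iff_eq, sub_mul, mul_sub, f1, f2, permOp_swap_dunkl_of_ne k hij.symm hmj.symm, e4]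
      abel
  · simp [Module.End.mul_apply, dunkl_apply_one]

/-! ### Cherednik operators -/

/-- The Heckman operators `hᵢ = Xᵢ yᵢ`. -/
noncomputable def heckman (k : ℂ) (i : Fin n) : PolyOp n := mulX i * dunkl k i

theorem permOp_heckman (k : ℂ) (σ : Equiv.Perm (Fin n)) (i : Fin n) :
    permOp σ * heckman k i = heckman k (σ i) * permOp σ := by
  rw [heckman, ← mul_assoc, permOp_mulX, mul_assoc, permOp_dunkl, ← mul_assoc, heckman]

theorem heckman_mul_sub (k : ℂ) {i j : Fin n} (h : i ≠ j) :
    heckman k i * heckman k j - heckman k j * heckman k i =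
      k • ((heckman k j - heckman k i) * permOp (Equiv.swap i j)) := by
  have e1 := dunkl_mulX_of_ne k h
  have e2 := dunkl_mulX_of_ne k h.symm
  rw [Equiv.swap_comm] at e2
  have s1 : permOp (Equiv.swap i j) * dunkl k i = dunkl k j * permOp (Equiv.swap i j) := by
    rw [permOp_dunkl, Equiv.swap_apply_left]
  have s2 : permOp (Equiv.swap i j) * dunkl k j = dunkl k i * permOp (Equiv.swap i j) := by
    rw [permOp_dunkl, Equiv.swap_apply_right]
  have f1 : heckman k i * heckman k j = mulX i * mulX j * (dunkl k i * dunkl k j)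
      - k • (mulX i * dunkl k i * permOp (Equiv.swap i j)) := by
    rw [heckman, heckman, mul_assoc, ← mul_assoc (dunkl k i), e1, sub_mul, smul_mul_assoc, s2,
      mul_sub, mul_smul_comm]
    simp only [mul_assoc]
  have f2 : heckman k j * heckman k i = mulX j * mulX i * (dunkl k j * dunkl k i)
      - k • (mulX j * dunkl k j * permOp (Equiv.swap i j)) := by
    rw [heckman, heckman, mul_assoc, ← mul_assoc (dunkl k j), e2, sub_mul, smul_mul_assoc, s1,
      mul_sub, mul_smul_comm]
    simp only [mul_assoc]
  rw [f1, f2, mulX_comm i j, (dunkl_commute k i j).eq, heckman, heckman, sub_mul, smul_sub]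
  abel

/-- The Jucys–Murphy type sums `∑_{m > i} sᵢₘ`. -/
noncomputable def jucysMurphy (i : Fin n) : PolyOp n :=
  ∑ m, if i < m then permOp (Equiv.swap i m) else 0

/-- The Cherednik operators `ξᵢ = Xᵢ yᵢ + k ∑_{m > i} sᵢₘ`. -/
noncomputable def cherednik (k : ℂ) (i : Fin n) : PolyOp n := heckman k i + k • jucysMurphy i

/-- A permutation fixing `i` and preserving `{m | i < m}` commutes with the sum of the
transpositions `sᵢₘ`, `m > i`. -/
theorem permOp_jucysMurphy {σ : Equiv.Perm (Fin n)} {i : Fin n} (hi : σ i = i)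
    (h : ∀ m, i < σ m ↔ i < m) : permOp σ * jucysMurphy i = jucysMurphy i * permOp σ := by
  rw [jucysMurphy, Finset.mul_sum, Finset.sum_mul]
  rw [← Equiv.sum_comp σ (fun m => (if i < m then permOp (Equiv.swap i m) else 0) * permOp σ)]
  refine Finset.sum_congr rfl fun m _ => ?_
  simp only [h]
  split_ifs
  · rw [permOp_swap_conj, hi]
  · simp

theorem swap_lt_iff {i a b : Fin n} (ha : i < a) (hb : i < b) (m : Fin n) :
    i < Equiv.swap a b m ↔ i < m := by
  rw [Equiv.swap_apply_def]
  split_ifs with h1 h2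
  · simp [h1, ha, hb]
  · simp [h2, ha, hb]
  · rfl

theorem jucysMurphy_commute (i j : Fin n) : Commute (jucysMurphy i) (jucysMurphy j) := by
  wlog hij : i < j generalizing i j
  · rcases eq_or_lt_of_le (not_lt.1 hij) with rfl | h
    · exact Commute.refl _
    · exact (this j i h).symm
  rw [commute_iff_eq]
  conv_lhs => rw [jucysMurphy.eq_1 j]
  conv_rhs => rw [jucysMurphy.eq_1 j]
  rw [Finset.mul_sum, Finset.sum_mul]
  refine Finset.sum_congr rfl fun m _ => ?_
  split_ifs with h
  · rw [permOp_jucysMurphy]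
    · exact Equiv.swap_apply_of_ne_of_ne hij.ne (hij.trans h).ne
    · exact swap_lt_iff hij (hij.trans h)
  · simp

theorem cherednik_commute (k : ℂ) (i j : Fin n) : Commute (cherednik k i) (cherednik k j) := by
  wlog hij : i < j generalizing i j
  · rcases eq_or_lt_of_le (not_lt.1 hij) with rfl | h
    · exact Commute.refl _
    · exact (this j i h).symm
  have e1 := heckman_mul_sub k hij.ne
  have e2 : heckman k i * jucysMurphy j = jucysMurphy j * heckman k i := by
    rw [jucysMurphy, Finset.mul_sum, Finset.sum_mul]
    refine Finset.sum_congr rfl fun m _ => ?_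
    split_ifs with h
    · rw [permOp_heckman, Equiv.swap_apply_of_ne_of_ne hij.ne (hij.trans h).ne]
    · simp
  have e3 : jucysMurphy i * heckman k j - heckman k j * jucysMurphy i
      = (heckman k i - heckman k j) * permOp (Equiv.swap i j) := by
    rw [jucysMurphy, Finset.mul_sum, Finset.sum_mul, ← Finset.sum_sub_distrib,
      Finset.sum_eq_single j]
    · rw [if_pos hij, permOp_heckman, Equiv.swap_apply_right, sub_mul]
    · intro m _ hm
      split_ifs with h
      · rw [permOp_heckman, Equiv.swap_apply_of_ne_of_ne hij.ne' hm.symm, sub_self]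
      · simp
    · simp
  have e4 := (jucysMurphy_commute i j).eq
  have e1' := sub_eq_iff_eq_add.1 e1
  have e3' := sub_eq_iff_eq_add.1 e3
  rw [commute_iff_eq, cherednik, cherednik]
  simp only [add_mul, mul_add, smul_mul_assoc, mul_smul_comm, e1', e2, e3', e4, sub_mul, smul_add,
    smul_sub]
  abel

/-- The relation `s ξᵢ = ξᵢ₊₁ s + k` of the degenerate affine Hecke algebra, for the transposition
`s` of two consecutive indices. -/
theorem permOp_swap_cherednik {i i' : Fin n} (k : ℂ) (h : (i : ℕ) + 1 = i') :
    permOp (Equiv.swap i i') * cherednik k i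
      = cherednik k i' * permOp (Equiv.swap i i') + k • 1 := by
  have hlt : i < i' := by rw [Fin.lt_def]; omega
  have e : permOp (Equiv.swap i i') * jucysMurphy i
      = jucysMurphy i' * permOp (Equiv.swap i i') + 1 := by
    rw [jucysMurphy, jucysMurphy, Finset.mul_sum, Finset.sum_mul,
      ← Finset.add_sum_erase _ _ (Finset.mem_univ i'), if_pos hlt, swap_permOp_mul_self, add_comm]
    congr 1
    rw [← Finset.add_sum_erase (a := i') _ (fun m => (if i' < m then permOp (Equiv.swap i' m) else 0)
      * permOp (Equiv.swap i i')) (Finset.mem_univ _), if_neg (lt_irrefl _), zero_mul, zero_add]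
    refine Finset.sum_congr rfl fun m hm => ?_
    have hm' : m ≠ i' := Finset.ne_of_mem_erase hm
    have hiff : i < m ↔ i' < m := by
      rw [Fin.lt_def, Fin.lt_def]
      have : (m : ℕ) ≠ i' := fun h => hm' (Fin.ext h)
      omega
    simp only [hiff]
    split_ifs with h2
    · rw [permOp_swap_conj, Equiv.swap_apply_left, Equiv.swap_apply_of_ne_of_ne _ hm']
      exact (hlt.trans h2).ne'
    · simp
  rw [cherednik, cherednik, mul_add, permOp_heckman, Equiv.swap_apply_left, mul_smul_comm, e,
    smul_add, add_mul, smul_mul_assoc, add_assoc]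

theorem permOp_swap_cherednik_right {i i' : Fin n} (k : ℂ) (h : (i : ℕ) + 1 = i') :
    permOp (Equiv.swap i i') * cherednik k i'
      = cherednik k i * permOp (Equiv.swap i i') - k • 1 := by
  have e := permOp_swap_cherednik k h
  have hs := swap_permOp_mul_self i i'
  have := congrArg (fun A => permOp (Equiv.swap i i') * A * permOp (Equiv.swap i i')) e
  simp only [mul_add, add_mul, mul_smul_comm, smul_mul_assoc, mul_one, hs, ← mul_assoc,
    one_mul] at this
  rw [mul_assoc (permOp _ * cherednik k i'), hs, mul_one] at this
  rw [this, add_sub_cancel_right]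

theorem permOp_swap_cherednik_of_ne {i i' j : Fin n} (k : ℂ) (h : (i : ℕ) + 1 = i')
    (hi : j ≠ i) (hi' : j ≠ i') :
    permOp (Equiv.swap i i') * cherednik k j = cherednik k j * permOp (Equiv.swap i i') := by
  have e : permOp (Equiv.swap i i') * jucysMurphy j
      = jucysMurphy j * permOp (Equiv.swap i i') := by
    apply permOp_jucysMurphy (Equiv.swap_apply_of_ne_of_ne hi hi')
    intro m
    rw [Equiv.swap_apply_def]
    have h1 : (j : ℕ) ≠ i := fun h => hi (Fin.ext h)
    have h2 : (j : ℕ) ≠ i' := fun h => hi' (Fin.ext h)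
    split_ifs with h3 h4
    · subst h3; rw [Fin.lt_def, Fin.lt_def]; omega
    · subst h4; rw [Fin.lt_def, Fin.lt_def]; omega
    · rfl
  rw [cherednik, mul_add, permOp_heckman, Equiv.swap_apply_of_ne_of_ne hi hi', mul_smul_comm, e,
    add_mul, smul_mul_assoc]

/-! ### The generating function of the Cherednik operators -/

theorem prod_ofFn_mul_eq {A : Type*} [Monoid A] {m : ℕ} {f g : Fin m → A} {a : A}
    (h : ∀ i, g i * a = a * f i) : (List.ofFn g).prod * a = a * (List.ofFn f).prod := by
  induction m with
  | zero => simp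
  | succ m ih =>
    rw [List.ofFn_succ, List.ofFn_succ, List.prod_cons, List.prod_cons, mul_assoc,
      ih fun i => h i.succ, ← mul_assoc, h 0, mul_assoc]

/-- If `a` commutes with all factors of an ordered product except for two consecutive ones, and
with the product of these two, then it commutes with the product. -/
theorem commute_prod_ofFn {A : Type*} [Monoid A] {m : ℕ} {f : Fin m → A} {a : A} {i i' : Fin m}
    (hii : (i : ℕ) + 1 = i') (h : ∀ j, j ≠ i → j ≠ i' → Commute a (f j))
    (h2 : Commute a (f i * f i')) : Commute a (List.ofFn f).prod := by
  induction m with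
  | zero => exact i.elim0
  | succ m ih =>
    rw [List.ofFn_succ, List.prod_cons]
    have hi' : i' ≠ 0 := fun h => by rw [h] at hii; simp at hii
    obtain ⟨b, rfl⟩ := Fin.exists_succ_eq.2 hi'
    rcases eq_or_ne i 0 with rfl | hi
    · cases m with
      | zero => exact b.elim0
      | succ m =>
        have hb : b = 0 := by
          apply Fin.ext
          simpa using hii.symm
        subst hb
        rw [List.ofFn_succ, List.prod_cons, ← mul_assoc]
        refine h2.mul_right ?_
        have : ∀ j : Fin m, f j.succ.succ * a = a * f j.succ.succ := fun j =>
          (h _ (Fin.succ_ne_zero _) (fun hh => by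
            simp [Fin.ext_iff] at hh)).eq.symm
        exact (prod_ofFn_mul_eq this).symm
    · obtain ⟨c, rfl⟩ := Fin.exists_succ_eq.2 hi
      refine (h 0 (Fin.succ_ne_zero _).symm (Fin.succ_ne_zero _).symm).mul_right ?_
      refine ih (i := c) (i' := b) (by simpa using hii) (fun j h1 h2 => h _ ?_ ?_) h2
      · exact fun hh => h1 (Fin.succ_injective _ hh)
      · exact fun hh => h2 (Fin.succ_injective _ hh)

/-- The ordered product `∏ᵢ (z + ξᵢ)`; its coefficients as a polynomial in `z` are the elementary
symmetric functions of the Cherednik operators. -/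
noncomputable def cherednikProd (k z : ℂ) : PolyOp n :=
  (List.ofFn fun i : Fin n => z • (1 : PolyOp n) + cherednik k i).prod

theorem commute_smul_one_add {A : PolyOp n} {B : PolyOp n} (z : ℂ) (h : Commute A B) :
    Commute A (z • 1 + B) :=
  ((Commute.one_right A).smul_right z).add_right h

theorem commute_prod_ofFn_of_forall {A : Type*} [Monoid A] {m : ℕ} {f : Fin m → A} {a : A}
    (h : ∀ i, Commute a (f i)) : Commute a (List.ofFn f).prod :=
  (prod_ofFn_mul_eq fun i => (h i).eq.symm).symm

theorem cherednik_commute_prod (k z : ℂ) (i : Fin n) :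
    Commute (cherednik k i) (cherednikProd k z) :=
  commute_prod_ofFn_of_forall fun j => commute_smul_one_add z (cherednik_commute k i j)

theorem permOp_commute_prod (k z : ℂ) (σ : Equiv.Perm (Fin n)) :
    Commute (permOp σ) (cherednikProd k z) := by
  cases n with
  | zero =>
    rw [show σ = 1 from Subsingleton.elim _ _, permOp_one]
    exact Commute.one_left _
  | succ m =>
    have hσ : σ ∈ Submonoid.closure
        (Set.range fun i : Fin m => Equiv.swap i.castSucc i.succ) := by
      rw [Equiv.Perm.mclosure_swap_castSucc_succ]
      trivial
    induction hσ using Submonoid.closure_induction with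
    | one => rw [permOp_one]; exact Commute.one_left _
    | mul σ τ _ _ h1 h2 => rw [permOp_mul]; exact h1.mul_left h2
    | mem σ h =>
      obtain ⟨i, rfl⟩ := h
      have hii : (i.castSucc : ℕ) + 1 = i.succ := by simp
      refine commute_prod_ofFn hii (fun j h1 h2 => ?_) ?_
      · exact commute_smul_one_add z (permOp_swap_cherednik_of_ne k hii h1 h2)
      · have e1 := permOp_swap_cherednik k hii
        have e2 := permOp_swap_cherednik_right k hii
        have e3 := (cherednik_commute k i.castSucc i.succ).eq
        set s := permOp (Equiv.swap i.castSucc i.succ)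
        set a := cherednik k i.castSucc
        set b := cherednik k i.succ
        have f1 : s * (z • 1 + a) = (z • 1 + b) * s + k • 1 := by
          simp only [mul_add, add_mul, e1, mul_smul_comm, smul_mul_assoc, one_mul, mul_one,
            add_assoc]
        have f2 : s * (z • 1 + b) = (z • 1 + a) * s - k • 1 := by
          simp only [mul_add, add_mul, e2, mul_smul_comm, smul_mul_assoc, one_mul, mul_one,
            add_sub_assoc]
        have f3 : (z • 1 + b) * (z • 1 + a) = (z • 1 + a) * (z • 1 + b) := by
          simp only [mul_add, add_mul, e3, mul_smul_comm, smul_mul_assoc, one_mul, mul_one,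
            smul_add]
          abel
        rw [commute_iff_eq, ← mul_assoc, f1, add_mul, mul_assoc, f2, mul_sub, ← mul_assoc, f3]
        simp

/-- The Cherednik operators for the order `last < 0 < 1 < ⋯` of the variables, listed in that
order; they are conjugate to the operators `ξᵢ` by a cyclic permutation. -/
noncomputable def cherednikRot {m : ℕ} (k : ℂ) (i : Fin (m + 1)) : PolyOp (m + 1) :=
  Fin.cases (heckman k (Fin.last m) + k • ∑ j : Fin m, permOp (Equiv.swap (Fin.last m) j.castSucc))
    (fun i => heckman k i.castSucc
      + k • ∑ j : Fin m, if i < j then permOp (Equiv.swap i.castSucc j.castSucc) else 0) i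

theorem cherednikRot_mul_permOp {m : ℕ} (k : ℂ) (i : Fin (m + 1)) :
    cherednikRot k i * permOp (finRotate (m + 1)).symm
      = permOp (finRotate (m + 1)).symm * cherednik k i := by
  have c0 : (finRotate (m + 1)).symm 0 = Fin.last m := by
    rw [Equiv.symm_apply_eq, finRotate_last]
  have cs : ∀ i : Fin m, (finRotate (m + 1)).symm i.succ = i.castSucc := by
    intro i
    rw [Equiv.symm_apply_eq, finRotate_apply]
    simp
  rw [cherednik, mul_add, permOp_heckman, mul_smul_comm, jucysMurphy, Finset.mul_sum,
    Fin.sum_univ_succ]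
  refine Fin.cases ?_ (fun i => ?_) i
  · simp only [cherednikRot, Fin.cases_zero, lt_irrefl, if_false, mul_zero, zero_add,
      Fin.succ_pos, if_true, permOp_swap_conj, c0, cs, add_mul, smul_mul_assoc, Finset.sum_mul]
  · simp only [cherednikRot, Fin.cases_succ, Fin.not_lt_zero, if_false, mul_zero, zero_add,
      Fin.succ_lt_succ_iff, cs, add_mul, smul_mul_assoc, Finset.sum_mul]
    congr 2
    refine Finset.sum_congr rfl fun j _ => ?_
    split_ifs
    · rw [permOp_swap_conj, cs, cs]
    · simp

theorem cherednikRot_zero_mul_dunkl {m : ℕ} (k : ℂ) :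
    cherednikRot k 0 * dunkl k (Fin.last m)
      = dunkl k (Fin.last m) * (cherednik k (Fin.last m) - 1) := by
  have h1 : cherednik k (Fin.last m) = heckman k (Fin.last m) := by
    rw [cherednik, jucysMurphy, Finset.sum_eq_zero, smul_zero, add_zero]
    intro j _
    rw [if_neg (not_lt.2 (Fin.le_last j))]
  have h2 : cherednikRot k 0 = dunkl k (Fin.last m) * mulX (Fin.last m) - 1 := by
    rw [dunkl_mulX_self, Fin.sum_univ_castSucc]
    simp only [cherednikRot, Fin.cases_zero, heckman, if_true, add_zero,
      (Fin.castSucc_lt_last _).ne, if_false]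
    abel
  rw [h1, h2, sub_mul, mul_sub, mul_assoc, heckman, one_mul, mul_one]

theorem cherednikRot_succ_mul_dunkl {m : ℕ} (k : ℂ) (i : Fin m) :
    cherednikRot k i.succ * dunkl k (Fin.last m)
      = dunkl k (Fin.last m) * cherednik k i.castSucc := by
  have hne : i.castSucc ≠ Fin.last m := (Fin.castSucc_lt_last _).ne
  have e1 : heckman k i.castSucc * dunkl k (Fin.last m)
      = dunkl k (Fin.last m) * heckman k i.castSucc
        + k • (dunkl k (Fin.last m) * permOp (Equiv.swap i.castSucc (Fin.last m))) := by
    rw [heckman, mul_assoc, (dunkl_commute k _ _).eq, ← mul_assoc, ← mul_assoc,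
      dunkl_mulX_of_ne k hne.symm, sub_mul, smul_mul_assoc, permOp_dunkl, Equiv.swap_apply_right,
      Equiv.swap_comm]
    abel
  rw [cherednik, jucysMurphy, Fin.sum_univ_castSucc, if_pos (Fin.castSucc_lt_last _)]
  simp only [cherednikRot, Fin.cases_succ, add_mul, mul_add, smul_add, mul_smul_comm,
    smul_mul_assoc, e1, Finset.sum_mul, Finset.mul_sum, Fin.castSucc_lt_castSucc_iff]
  have e2 : ∑ j : Fin m, (if i < j then permOp (Equiv.swap i.castSucc j.castSucc) else 0)
        * dunkl k (Fin.last m)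
      = ∑ j : Fin m, dunkl k (Fin.last m)
        * (if i < j then permOp (Equiv.swap i.castSucc j.castSucc) else 0) := by
    refine Finset.sum_congr rfl fun j _ => ?_
    split_ifs
    · rw [permOp_dunkl, Equiv.swap_apply_of_ne_of_ne hne.symm (Fin.castSucc_lt_last _).ne']
    · simp
  rw [e2]
  abel

/-- The lowering relation: the last Dunkl operator shifts the last spectral parameter by `-1`. -/
theorem cherednikProd_mul_dunkl {m : ℕ} (k z : ℂ) :
    cherednikProd k z * dunkl k (Fin.last m) * (z • 1 + cherednik k (Fin.last m))
      = dunkl k (Fin.last m) * ((z - 1) • 1 + cherednik k (Fin.last m)) * cherednikProd k z := by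
  set c := permOp (finRotate (m + 1)).symm with hc
  have h1 : (List.ofFn fun i => z • (1 : PolyOp (m + 1)) + cherednikRot k i).prod * c
      = c * cherednikProd k z := by
    refine prod_ofFn_mul_eq fun i => ?_
    rw [add_mul, mul_add, cherednikRot_mul_permOp, smul_mul_assoc, mul_smul_comm, one_mul, mul_one]
  have hcc : c * permOp (finRotate (m + 1)) = 1 := by
    rw [hc, ← permOp_mul, show (finRotate (m + 1)).symm * finRotate (m + 1) = 1 from
      inv_mul_cancel _, permOp_one]
  have h2 : (List.ofFn fun i => z • (1 : PolyOp (m + 1)) + cherednikRot k i).prod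
      = cherednikProd k z := by
    have := congrArg (· * permOp (finRotate (m + 1))) (h1.trans
      (show c * cherednikProd k z = cherednikProd k z * c from (permOp_commute_prod k z _).eq))
    simpa only [mul_assoc, hcc, mul_one] using this
  have h3 : (List.ofFn fun i : Fin m => z • (1 : PolyOp (m + 1)) + cherednikRot k i.succ).prod
      * dunkl k (Fin.last m) = dunkl k (Fin.last m)
        * (List.ofFn fun i : Fin m => z • (1 : PolyOp (m + 1)) + cherednik k i.castSucc).prod := by
    refine prod_ofFn_mul_eq fun i => ?_
    rw [add_mul, mul_add, cherednikRot_succ_mul_dunkl, smul_mul_assoc, mul_smul_comm, one_mul,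
      mul_one]
  have h4 : (List.ofFn fun i : Fin m => z • (1 : PolyOp (m + 1)) + cherednik k i.castSucc).prod
      * (z • 1 + cherednik k (Fin.last m)) = cherednikProd k z := by
    rw [cherednikProd, List.ofFn_succ', List.concat_eq_append, List.prod_append,
      List.prod_singleton]
  nth_rewrite 1 [← h2]
  rw [List.ofFn_succ, List.prod_cons, mul_assoc _ _ (dunkl k _), h3, ← mul_assoc,
    mul_assoc _ _ (z • 1 + _), h4, add_mul, cherednikRot_zero_mul_dunkl]
  congr 1
  simp only [mul_sub, mul_add, smul_mul_assoc, mul_smul_comm, one_mul, mul_one]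
  module

/-! ### Monomials and coefficients -/

/-- The monomial with exponents `α`. -/
noncomputable def mon (α : Fin n → ℕ) : MvPolynomial (Fin n) ℂ := ∏ i, X i ^ α i

/-- The coefficient of the monomial with exponents `α`, as a linear form. -/
noncomputable def cf (α : Fin n → ℕ) : MvPolynomial (Fin n) ℂ →ₗ[ℂ] ℂ :=
  lcoeff ℂ (Finsupp.equivFunOnFinite.symm α)

theorem cf_apply (α : Fin n → ℕ) (p : MvPolynomial (Fin n) ℂ) :
    cf α p = coeff (Finsupp.equivFunOnFinite.symm α) p := rfl

theorem mon_eq_monomial (α : Fin n → ℕ) :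
    mon α = monomial (Finsupp.equivFunOnFinite.symm α) 1 := by
  rw [monomial_eq, C_1, one_mul, Finsupp.prod_fintype _ _ (fun i => pow_zero _)]
  rfl

theorem cf_mon (β α : Fin n → ℕ) : cf β (mon α) = if α = β then 1 else 0 := by
  rw [cf_apply, mon_eq_monomial, coeff_monomial]
  simp only [EmbeddingLike.apply_eq_iff_eq]

theorem poly_ext {p q : MvPolynomial (Fin n) ℂ} (h : ∀ α, cf α p = cf α q) : p = q := by
  ext m
  have := h (Finsupp.equivFunOnFinite m)
  rwa [cf_apply, cf_apply, Equiv.symm_apply_apply] at this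

theorem eq_sum_cf (p : MvPolynomial (Fin n) ℂ) :
    p = ∑ s ∈ p.support, cf s p • mon s := by
  conv_lhs => rw [p.as_sum]
  refine Finset.sum_congr rfl fun s _ => ?_
  rw [mon_eq_monomial, smul_monomial, smul_eq_mul, mul_one, cf_apply,
    Finsupp.equivFunOnFinite_symm_coe]

/-- The polynomials all of whose monomials have exponents in `U`. -/
noncomputable def monSpan (U : Set (Fin n → ℕ)) : Submodule ℂ (MvPolynomial (Fin n) ℂ) :=
  Submodule.span ℂ (mon '' U)

theorem mon_mem_monSpan {U : Set (Fin n → ℕ)} {α : Fin n → ℕ} (h : α ∈ U) : mon α ∈ monSpan U :=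
  Submodule.subset_span ⟨α, h, rfl⟩

theorem mem_monSpan {U : Set (Fin n → ℕ)} {p : MvPolynomial (Fin n) ℂ} :
    p ∈ monSpan U ↔ ∀ α, cf α p ≠ 0 → α ∈ U := by
  constructor
  · intro hp α
    contrapose!
    intro hα
    induction hp using Submodule.span_induction with
    | mem x hx =>
      obtain ⟨β, hβ, rfl⟩ := hx
      rw [cf_mon, if_neg]
      rintro rfl
      exact hα hβ
    | zero => exact map_zero _
    | add x y _ _ hx hy => rw [map_add, hx, hy, add_zero]
    | smul c x _ hx => rw [map_smul, hx, smul_zero]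
  · intro h
    rw [eq_sum_cf p]
    refine Submodule.sum_mem _ fun s hs => Submodule.smul_mem _ _ (mon_mem_monSpan (h _ ?_))
    rw [cf_apply, Finsupp.equivFunOnFinite_symm_coe]
    exact mem_support_iff.1 hs

theorem map_mem_monSpan {U V : Set (Fin n → ℕ)} {A : PolyOp n}
    (h : ∀ α ∈ U, A (mon α) ∈ monSpan V) {p : MvPolynomial (Fin n) ℂ} (hp : p ∈ monSpan U) :
    A p ∈ monSpan V := by
  induction hp using Submodule.span_induction with
  | mem x hx =>
    obtain ⟨β, hβ, rfl⟩ := hx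
    exact h β hβ
  | zero => rw [map_zero]; exact zero_mem _
  | add x y _ _ hx hy => rw [map_add]; exact add_mem hx hy
  | smul c x _ hx => rw [map_smul]; exact Submodule.smul_mem _ _ hx

theorem rename_mon (σ : Equiv.Perm (Fin n)) (α : Fin n → ℕ) :
    rename σ (mon α) = mon (α ∘ σ.symm) := by
  simp only [mon, map_prod, map_pow, rename_X, Function.comp]
  rw [← Equiv.prod_comp σ (fun i => X i ^ α (σ.symm i))]
  simp

theorem X_mul_mon (i : Fin n) (α : Fin n → ℕ) :
    X i * mon α = mon (Function.update α i (α i + 1)) := by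
  rw [mon, mon, ← Finset.mul_prod_erase _ _ (Finset.mem_univ i),
    ← Finset.mul_prod_erase _ (fun j => X j ^ (Function.update α i (α i + 1)) j)
      (Finset.mem_univ i), Function.update_self, pow_succ', mul_assoc]
  congr 2
  refine Finset.prod_congr rfl fun j hj => ?_
  rw [Function.update_of_ne (Finset.ne_of_mem_erase hj)]

/-- The exponents `α` with the entries at `i` and `j` replaced by `p` and `q`. -/
def update₂ (α : Fin n → ℕ) (i j : Fin n) (p q : ℕ) : Fin n → ℕ :=
  Function.update (Function.update α i p) j q

theorem update₂_left {α : Fin n → ℕ} {i j : Fin n} (h : i ≠ j) (p q : ℕ) :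
    update₂ α i j p q i = p := by
  rw [update₂, Function.update_of_ne h, Function.update_self]

theorem update₂_right (α : Fin n → ℕ) (i j : Fin n) (p q : ℕ) : update₂ α i j p q j = q := by
  rw [update₂, Function.update_self]

theorem update₂_of_ne {α : Fin n → ℕ} {i j m : Fin n} (hi : m ≠ i) (hj : m ≠ j) (p q : ℕ) :
    update₂ α i j p q m = α m := by
  rw [update₂, Function.update_of_ne hj, Function.update_of_ne hi]

theorem update₂_self (α : Fin n → ℕ) (i j : Fin n) : update₂ α i j (α i) (α j) = α := by
  rw [update₂, Function.update_eq_self, Function.update_eq_self]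

theorem X_left_mul_mon_update₂ {i j : Fin n} (h : i ≠ j) (α : Fin n → ℕ) (p q : ℕ) :
    X i * mon (update₂ α i j p q) = mon (update₂ α i j (p + 1) q) := by
  rw [X_mul_mon, update₂_left h, update₂, Function.update_comm (β := fun _ => ℕ) h.symm q (p + 1),
    Function.update_idem, update₂]

theorem X_right_mul_mon_update₂ (i j : Fin n) (α : Fin n → ℕ) (p q : ℕ) :
    X j * mon (update₂ α i j p q) = mon (update₂ α i j p (q + 1)) := by
  rw [X_mul_mon, update₂_right, update₂, Function.update_idem, update₂]

theorem comp_swap_eq_update₂ {i j : Fin n} (h : i ≠ j) (α : Fin n → ℕ) :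
    α ∘ Equiv.swap i j = update₂ α i j (α j) (α i) := by
  funext m
  rcases eq_or_ne m i with rfl | hi
  · rw [update₂_left h]; simp
  rcases eq_or_ne m j with rfl | hj
  · rw [update₂_right]; simp
  · rw [update₂_of_ne hi hj, Function.comp, Equiv.swap_apply_of_ne_of_ne hi hj]

theorem rename_swap_mon {i j : Fin n} (h : i ≠ j) (α : Fin n → ℕ) :
    rename (Equiv.swap i j) (mon α) = mon (update₂ α i j (α j) (α i)) := by
  rw [rename_mon, Equiv.symm_swap, comp_swap_eq_update₂ h]

/-- The divided difference of a monomial is a geometric sum. -/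
theorem X_mul_divDiff_mon {i j : Fin n} (h : i ≠ j) {α : Fin n → ℕ} (hα : α j ≤ α i) :
    X i * divDiff i j (mon α)
      = ∑ t ∈ Finset.range (α i - α j), mon (update₂ α i j (α i - t) (α j + t)) := by
  apply mul_left_cancel₀ (X_sub_X_ne_zero h)
  rw [mul_left_comm, X_sub_X_mul_divDiff, rename_swap_mon h, mul_sub, X_left_mul_mon_update₂ h,
    Finset.mul_sum]
  nth_rewrite 1 [← update₂_self α i j]
  rw [X_left_mul_mon_update₂ h]
  have key : ∀ t ∈ Finset.range (α i - α j),
      (X i - X j) * mon (update₂ α i j (α i - t) (α j + t))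
        = mon (update₂ α i j (α i + 1 - t) (α j + t))
          - mon (update₂ α i j (α i + 1 - (t + 1)) (α j + (t + 1))) := by
    intro t ht
    rw [Finset.mem_range] at ht
    rw [sub_mul, X_left_mul_mon_update₂ h, X_right_mul_mon_update₂]
    rw [show α i + 1 - t = α i - t + 1 by omega, Nat.add_sub_add_right, add_assoc]
  rw [Finset.sum_congr rfl key,
    Finset.sum_range_sub' (fun t => mon (update₂ α i j (α i + 1 - t) (α j + t)))]
  rw [Nat.sub_zero, add_zero, show α i + 1 - (α i - α j) = α j + 1 by omega,
    Nat.add_sub_cancel' hα]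

theorem sum_update₂ {i j : Fin n} (h : i ≠ j) (g : ℕ → ℕ) (α : Fin n → ℕ) (p q : ℕ) :
    ∑ m, g (update₂ α i j p q m) + (g (α i) + g (α j)) = ∑ m, g (α m) + (g p + g q) := by
  have hj : j ∈ Finset.univ.erase i := Finset.mem_erase.2 ⟨h.symm, Finset.mem_univ j⟩
  rw [← Finset.add_sum_erase _ _ (Finset.mem_univ i), ← Finset.add_sum_erase _ _ hj,
    ← Finset.add_sum_erase (a := i) _ (fun m => g (α m)) (Finset.mem_univ i),
    ← Finset.add_sum_erase _ (fun m => g (α m)) hj, update₂_left h, update₂_right]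
  rw [Finset.sum_congr (g := fun m => g (α m)) rfl fun m hm => by
    rw [update₂_of_ne]
    · exact Finset.ne_of_mem_erase (Finset.mem_of_mem_erase hm)
    · exact Finset.ne_of_mem_erase hm]
  ring

/-! ### Triangularity of the Cherednik operators -/

/-- A set of exponents is saturated if it is stable under replacing two entries by two numbers
with the same sum and no larger maximum. In particular it is stable under permutations. -/
def Saturated (U : Set (Fin n → ℕ)) : Prop :=
  ∀ α ∈ U, ∀ i j, i ≠ j → ∀ p q, p + q = α i + α j → p ≤ max (α i) (α j) →
    q ≤ max (α i) (α j) → update₂ α i j p q ∈ U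

theorem X_mul_pderiv_mon (i : Fin n) (α : Fin n → ℕ) :
    X i * pderiv i (mon α) = (α i : ℂ) • mon α := by
  rw [mon_eq_monomial, X_mul_pderiv_monomial]
  rw [Finsupp.equivFunOnFinite_symm_apply_apply, ← Nat.cast_smul_eq_nsmul ℂ]

theorem divDiff_mon_eq_neg {i j : Fin n} (h : i ≠ j) {α : Fin n → ℕ} :
    divDiff i j (mon α) = - divDiff i j (mon (update₂ α i j (α j) (α i))) := by
  rw [← rename_swap_mon h, divDiff_swap, neg_neg]

theorem Saturated.X_mul_divDiff_mem {U : Set (Fin n → ℕ)} (hU : Saturated U) {i j : Fin n}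
    {p : MvPolynomial (Fin n) ℂ} (hp : p ∈ monSpan U) : X i * divDiff i j p ∈ monSpan U := by
  rcases eq_or_ne i j with rfl | h
  · simp [divDiff_self]
  have key : ∀ α ∈ U, α j ≤ α i → X i * divDiff i j (mon α) ∈ monSpan U := by
    intro α hα hle
    rw [X_mul_divDiff_mon h hle]
    refine Submodule.sum_mem _ fun t ht => mon_mem_monSpan (hU α hα i j h _ _ ?_ ?_ ?_) <;>
    · rw [Finset.mem_range] at ht
      omega
  refine map_mem_monSpan (A := mulX i * divDiff i j) (fun α hα => ?_) hp
  rw [Module.End.mul_apply, mulX_apply]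
  rcases le_total (α j) (α i) with hle | hle
  · exact key α hα hle
  · rw [divDiff_mon_eq_neg h, mul_neg]
    refine neg_mem (key _ (hU α hα i j h _ _ (add_comm _ _) (le_max_right _ _)
      (le_max_left _ _)) ?_)
    rwa [update₂_left h, update₂_right]

theorem Saturated.permOp_swap_mem {U : Set (Fin n → ℕ)} (hU : Saturated U) {i j : Fin n}
    (h : i ≠ j) {p : MvPolynomial (Fin n) ℂ} (hp : p ∈ monSpan U) :
    permOp (Equiv.swap i j) p ∈ monSpan U := by
  refine map_mem_monSpan (fun α hα => ?_) hp
  rw [permOp_apply, rename_swap_mon h]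
  exact mon_mem_monSpan (hU α hα i j h _ _ (add_comm _ _) (le_max_right _ _) (le_max_left _ _))

theorem cherednik_apply (k : ℂ) (i : Fin n) (p : MvPolynomial (Fin n) ℂ) :
    cherednik k i p = X i * pderiv i p + k • ∑ j, (X i * divDiff i j p
      + if i < j then permOp (Equiv.swap i j) p else 0) := by
  rw [cherednik, heckman, jucysMurphy, dunkl, LinearMap.add_apply, Module.End.mul_apply,
    mulX_apply, LinearMap.add_apply, LinearMap.smul_apply, LinearMap.smul_apply,
    LinearMap.sum_apply, LinearMap.sum_apply, Finset.sum_add_distrib, derivOp_apply, mul_add,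
    mul_smul_comm, Finset.mul_sum, smul_add, add_assoc]
  congr 3
  refine Finset.sum_congr rfl fun j _ => ?_
  split_ifs <;> rfl

theorem Saturated.cherednik_mem {U : Set (Fin n → ℕ)} (hU : Saturated U) (k : ℂ) (i : Fin n)
    {p : MvPolynomial (Fin n) ℂ} (hp : p ∈ monSpan U) : cherednik k i p ∈ monSpan U := by
  rw [cherednik_apply]
  refine add_mem ?_ (Submodule.smul_mem _ _ (Submodule.sum_mem _ fun j _ =>
    add_mem (hU.X_mul_divDiff_mem hp) ?_))
  · refine map_mem_monSpan (A := mulX i * derivOp i) (fun α hα => ?_) hp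
    rw [Module.End.mul_apply, mulX_apply, derivOp_apply, X_mul_pderiv_mon]
    exact Submodule.smul_mem _ _ (mon_mem_monSpan hα)
  · split_ifs with h
    · exact hU.permOp_swap_mem h.ne hp
    · exact zero_mem _

/-- The sum of squares of the exponents. It strictly decreases when two entries are replaced by
two numbers with the same sum and a smaller maximum. -/
def sqSum (α : Fin n → ℕ) : ℕ := ∑ i, α i ^ 2

theorem sqSum_update₂ {i j : Fin n} (h : i ≠ j) (α : Fin n → ℕ) (p q : ℕ) :
    sqSum (update₂ α i j p q) + (α i ^ 2 + α j ^ 2) = sqSum α + (p ^ 2 + q ^ 2) :=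
  sum_update₂ h (fun t => t ^ 2) α p q

theorem sq_add_sq_le {a b p q : ℕ} (h : p + q = a + b) (hp : p ≤ max a b) (hq : q ≤ max a b) :
    p ^ 2 + q ^ 2 ≤ a ^ 2 + b ^ 2 := by
  wlog hab : b ≤ a generalizing a b
  · rw [add_comm (a ^ 2)]
    exact this (by omega) (by omega) (by omega) (by omega)
  rw [max_eq_left hab] at hp hq
  obtain ⟨s, rfl⟩ := Nat.exists_eq_add_of_le hp
  obtain rfl : q = s + b := by omega
  obtain ⟨r, rfl⟩ := Nat.exists_eq_add_of_le (show b ≤ p by omega)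
  nlinarith [Nat.zero_le (s * r)]

theorem saturated_sqSum_le (N : ℕ) : Saturated {α : Fin n → ℕ | sqSum α ≤ N} := by
  intro α hα i j h p q hpq hp hq
  have h1 := sqSum_update₂ h α p q
  have h2 := sq_add_sq_le hpq hp hq
  rw [Set.mem_ofPred_eq] at hα ⊢
  omega

theorem sqSum_comp_perm (α : Fin n → ℕ) (σ : Equiv.Perm (Fin n)) :
    sqSum (α ∘ σ) = sqSum α :=
  Equiv.sum_comp σ fun i => α i ^ 2

theorem cf_X_mul_divDiff_mon {i j : Fin n} (h : i ≠ j) {α ν : Fin n → ℕ} (hα : α j ≤ α i)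
    (hQ : sqSum α ≤ sqSum ν) :
    cf ν (X i * divDiff i j (mon α)) = if α j < α i ∧ α = ν then 1 else 0 := by
  rw [X_mul_divDiff_mon h hα, map_sum]
  rcases hα.eq_or_lt with he | hlt
  · simp [he]
  -- only the monomial with `t = 0` can be extremal
  rw [Finset.sum_eq_single 0]
  · rw [Nat.sub_zero, Nat.add_zero, update₂_self, cf_mon]
    simp [hlt]
  · intro t ht ht0
    rw [cf_mon, if_neg]
    intro he
    rw [Finset.mem_range] at ht
    have h1 := sqSum_update₂ h α (α i - t) (α j + t)
    rw [he] at h1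
    obtain ⟨r, hr⟩ : ∃ r, α i = α j + t + r + 1 := ⟨α i - α j - t - 1, by omega⟩
    rw [hr, show α j + t + r + 1 - t = α j + r + 1 by omega] at h1
    nlinarith [Nat.pos_of_ne_zero ht0, Nat.zero_le (t * r), Nat.zero_le r]
  · intro h0
    simp at h0
    omega

/-- At an antitone exponent of maximal sum of squares, the two terms of `ξᵢ` that belong to `j`
together contribute a diagonal coefficient, which is `1` if `i < j` and `0` otherwise. -/
theorem cf_pair {i j : Fin n} (h : i ≠ j) {α ν : Fin n → ℕ} (hν : Antitone ν)
    (hQ : sqSum α ≤ sqSum ν) :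
    cf ν (X i * divDiff i j (mon α)) + cf ν (if i < j then permOp (Equiv.swap i j) (mon α) else 0)
      = if i < j then (if α = ν then 1 else 0) else 0 := by
  have hsw : cf ν (if i < j then permOp (Equiv.swap i j) (mon α) else 0)
      = if i < j then (if update₂ α i j (α j) (α i) = ν then 1 else 0) else 0 := by
    split_ifs with h1 <;> simp_all [permOp_apply, rename_swap_mon, cf_mon]
  have hν1 : i < j → ν j ≤ ν i := fun h => hν h.le
  have hν2 : ¬ i < j → ν i ≤ ν j := fun h => hν (not_lt.1 h)
  have b1 : α = ν → α i = ν i ∧ α j = ν j := fun h => by simp [h]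
  have b2 : update₂ α i j (α j) (α i) = ν → α j = ν i ∧ α i = ν j := by
    rintro rfl
    exact ⟨(update₂_left h _ _).symm, (update₂_right _ _ _ _ _).symm⟩
  rw [hsw]
  rcases lt_trichotomy (α j) (α i) with hlt | heq | hlt
  · rw [cf_X_mul_divDiff_mon h hlt.le hQ]
    by_cases hij : i < j
    · have : update₂ α i j (α j) (α i) ≠ ν := fun hh => by
        have := b2 hh; have := hν1 hij; omega
      simp [hij, this, hlt]
    · have : α ≠ ν := fun hh => by
        have := b1 hh; have := hν2 hij; omega
      simp [hij, this]
  · rw [cf_X_mul_divDiff_mon h heq.le hQ]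
    have : update₂ α i j (α j) (α i) = α := by
      conv_rhs => rw [← update₂_self α i j]
      rw [heq]
    rw [this]
    simp [heq]
  · have hQ' : sqSum (update₂ α i j (α j) (α i)) ≤ sqSum ν := by
      rwa [← comp_swap_eq_update₂ h, sqSum_comp_perm]
    rw [divDiff_mon_eq_neg h, mul_neg, map_neg, cf_X_mul_divDiff_mon h _ hQ']
    · rw [update₂_left h, update₂_right]
      by_cases hij : i < j
      · have : α ≠ ν := fun hh => by
          have := b1 hh; have := hν1 hij; omega
        simp [hij, this, hlt]
      · have : update₂ α i j (α j) (α i) ≠ ν := fun hh => by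
          have := b2 hh; have := hν2 hij; omega
        simp [hij, this]
    · rw [update₂_left h, update₂_right]
      exact hlt.le

/-- The numbers `k (n - i)`, where `i` runs from `1` to `n`. -/
noncomputable def rhoShift (k : ℂ) (i : Fin n) : ℂ := k * ((n : ℂ) - ((i : ℕ) + 1 : ℂ))

theorem sum_ite_lt {V : Type*} [AddCommGroup V] [Module ℂ V] (i : Fin n) (v : V) :
    ∑ j, (if i < j then v else 0) = ((n : ℂ) - ((i : ℕ) + 1 : ℂ)) • v := by
  rw [← Finset.sum_filter, Finset.sum_const, ← Nat.cast_smul_eq_nsmul ℂ]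
  congr 1
  have : (Finset.univ.filter fun j => i < j) = Finset.Ioi i := by ext; simp
  rw [this, Fin.card_Ioi, Nat.sub_sub, Nat.cast_sub (by omega)]
  push_cast
  ring

/-- The coefficient at an extremal antitone exponent is an eigenfunctional of the Cherednik
operators. -/
theorem cf_cherednik (k : ℂ) (i : Fin n) {ν : Fin n → ℕ} (hν : Antitone ν)
    {p : MvPolynomial (Fin n) ℂ} (hp : p ∈ monSpan {α | sqSum α ≤ sqSum ν}) :
    cf ν (cherednik k i p) = (ν i + rhoShift k i) * cf ν p := by
  induction hp using Submodule.span_induction with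
  | mem x hx =>
    obtain ⟨α, hα, rfl⟩ := hx
    rw [cherednik_apply, map_add, X_mul_pderiv_mon, map_smul, map_smul, map_sum]
    have : ∀ j ∈ Finset.univ, cf ν (X i * divDiff i j (mon α)
        + if i < j then permOp (Equiv.swap i j) (mon α) else 0)
        = if i < j then (if α = ν then 1 else 0) else 0 := by
      intro j _
      rcases eq_or_ne i j with rfl | h
      · simp [divDiff_self]
      · rw [map_add]; exact cf_pair h hν hα
    rw [Finset.sum_congr rfl this, sum_ite_lt, cf_mon, rhoShift, smul_eq_mul]
    split_ifs with h
    · subst h; simp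
    · simp
  | zero => simp
  | add x y _ _ hx hy => rw [map_add, map_add, hx, hy, map_add]; ring
  | smul c x _ hx => rw [map_smul, map_smul, hx, map_smul, smul_eq_mul, smul_eq_mul]; ring

theorem Saturated.prod_ofFn_mem {U : Set (Fin n → ℕ)} (hU : Saturated U) (k z : ℂ) {m : ℕ}
    (f : Fin m → Fin n) {p : MvPolynomial (Fin n) ℂ} (hp : p ∈ monSpan U) :
    (List.ofFn fun i => z • (1 : PolyOp n) + cherednik k (f i)).prod p ∈ monSpan U := by
  induction m with
  | zero => simpa
  | succ m ih =>
    rw [List.ofFn_succ, List.prod_cons, Module.End.mul_apply]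
    have := ih fun i => f i.succ
    exact add_mem (Submodule.smul_mem _ _ this) (hU.cherednik_mem k _ this)

theorem Saturated.cherednikProd_mem {U : Set (Fin n → ℕ)} (hU : Saturated U) (k z : ℂ)
    {p : MvPolynomial (Fin n) ℂ} (hp : p ∈ monSpan U) : cherednikProd k z p ∈ monSpan U :=
  hU.prod_ofFn_mem k z id hp

theorem cf_prod_ofFn (k z : ℂ) {ν : Fin n → ℕ} (hν : Antitone ν) {m : ℕ} (f : Fin m → Fin n)
    {p : MvPolynomial (Fin n) ℂ} (hp : p ∈ monSpan {α | sqSum α ≤ sqSum ν}) :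
    cf ν ((List.ofFn fun i => z • (1 : PolyOp n) + cherednik k (f i)).prod p)
      = (∏ i, (z + (ν (f i) + rhoShift k (f i)))) * cf ν p := by
  induction m with
  | zero => simp
  | succ m ih =>
    rw [List.ofFn_succ, List.prod_cons, Module.End.mul_apply, LinearMap.add_apply, map_add,
      cf_cherednik k _ hν ((saturated_sqSum_le _).prod_ofFn_mem k z _ hp), LinearMap.smul_apply,
      Module.End.one_apply, map_smul, ih fun i => f i.succ, Fin.prod_univ_succ, smul_eq_mul]
    ring

theorem cf_cherednikProd (k z : ℂ) {ν : Fin n → ℕ} (hν : Antitone ν)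
    {p : MvPolynomial (Fin n) ℂ} (hp : p ∈ monSpan {α | sqSum α ≤ sqSum ν}) :
    cf ν (cherednikProd k z p) = (∏ i, (z + (ν i + rhoShift k i))) * cf ν p :=
  cf_prod_ofFn k z hν id hp

/-! ### Symmetric polynomials -/

theorem cf_rename (α : Fin n → ℕ) (σ : Equiv.Perm (Fin n)) (p : MvPolynomial (Fin n) ℂ) :
    cf α (rename σ p) = cf (α ∘ σ) p := by
  rw [eq_sum_cf p]
  simp only [map_sum, map_smul, rename_mon, cf_mon]
  refine Finset.sum_congr rfl fun s _ => ?_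
  have : (s : Fin n → ℕ) ∘ σ.symm = α ↔ (s : Fin n → ℕ) = α ∘ σ := by
    rw [Equiv.comp_symm_eq]
  simp only [this]

theorem cf_comp_perm {p : MvPolynomial (Fin n) ℂ} (hp : p.IsSymmetric) (α : Fin n → ℕ)
    (σ : Equiv.Perm (Fin n)) : cf (α ∘ σ) p = cf α p := by
  rw [← cf_rename, hp σ]

theorem exists_perm_antitone (α : Fin n → ℕ) : ∃ σ : Equiv.Perm (Fin n), Antitone (α ∘ σ) := by
  refine ⟨Tuple.sort (OrderDual.toDual ∘ α), fun i j hij => ?_⟩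
  exact Tuple.monotone_sort (OrderDual.toDual ∘ α) hij

/-- A nonzero symmetric polynomial has an antitone exponent maximizing the sum of squares. -/
theorem exists_extremal {p : MvPolynomial (Fin n) ℂ} (hp : p.IsSymmetric) (h0 : p ≠ 0) :
    ∃ ν : Fin n → ℕ, Antitone ν ∧ cf ν p ≠ 0 ∧ p ∈ monSpan {α | sqSum α ≤ sqSum ν} := by
  obtain ⟨s, hs, hmax⟩ := Finset.exists_max_image p.support (fun s => sqSum (s : Fin n → ℕ))
    (support_nonempty.2 h0)
  obtain ⟨σ, hσ⟩ := exists_perm_antitone (s : Fin n → ℕ)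
  refine ⟨s ∘ σ, hσ, ?_, mem_monSpan.2 fun α hα => ?_⟩
  · rw [cf_comp_perm hp, cf_apply, Finsupp.equivFunOnFinite_symm_coe]
    exact mem_support_iff.1 hs
  · have := hmax (Finsupp.equivFunOnFinite.symm α) (mem_support_iff.2 hα)
    rw [Set.mem_ofPred_eq, sqSum_comp_perm]
    simpa using this

theorem monSym_eq (l : Fin n → ℕ) :
    monSym l = ∑ α ∈ Finset.univ.image (fun σ : Equiv.Perm (Fin n) => l ∘ σ), mon α := rfl

theorem cf_monSym (β l : Fin n → ℕ) :
    cf β (monSym l) = if ∃ σ : Equiv.Perm (Fin n), l ∘ σ = β then 1 else 0 := by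
  rw [monSym_eq, map_sum]
  simp only [cf_mon, Finset.sum_ite_eq', Finset.mem_image, Finset.mem_univ, true_and]

theorem antitone_comp_perm_eq {l : Fin n → ℕ} (hl : Antitone l) {σ : Equiv.Perm (Fin n)}
    (h : Antitone (l ∘ σ)) : l ∘ σ = l :=
  Tuple.unique_antitone (τ := 1) h hl

theorem cf_monSym_of_antitone {β l : Fin n → ℕ} (hβ : Antitone β) (hl : Antitone l) :
    cf β (monSym l) = if β = l then 1 else 0 := by
  rw [cf_monSym]
  congr 1
  refine propext ⟨?_, fun h => ⟨1, h.symm⟩⟩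
  rintro ⟨σ, rfl⟩
  exact antitone_comp_perm_eq hl hβ

theorem monSym_isSymmetric (l : Fin n → ℕ) : (monSym l).IsSymmetric := by
  intro σ
  refine poly_ext fun α => ?_
  rw [cf_rename, cf_monSym, cf_monSym]
  congr 1
  refine propext ⟨?_, ?_⟩
  · rintro ⟨τ, h⟩
    refine ⟨τ * σ⁻¹, ?_⟩
    rw [Equiv.Perm.coe_mul, ← Function.comp_assoc, h, Function.comp_assoc, ← Equiv.Perm.coe_mul,
      mul_inv_cancel]
    rfl
  · rintro ⟨τ, rfl⟩
    exact ⟨τ * σ, rfl⟩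

theorem isSymmetric_iff_permOp {p : MvPolynomial (Fin n) ℂ} :
    p.IsSymmetric ↔ ∀ σ, permOp σ p = p := Iff.rfl

theorem isSymmetric_of_commute {A : PolyOp n} (hA : ∀ σ, Commute (permOp σ) A)
    {p : MvPolynomial (Fin n) ℂ} (hp : p.IsSymmetric) : (A p).IsSymmetric := by
  intro σ
  rw [← permOp_apply, ← Module.End.mul_apply, (hA σ).eq, Module.End.mul_apply, permOp_apply, hp σ]

/-- The expansion of a symmetric polynomial in monomial symmetric polynomials. -/
theorem mem_span_monSym {p : MvPolynomial (Fin n) ℂ} (hp : p.IsSymmetric)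
    {S : Set (Fin n → ℕ)} (hS : ∀ ν, Antitone ν → cf ν p ≠ 0 → ν ∈ S) :
    p ∈ Submodule.span ℂ (monSym '' S) := by
  classical
  set F : Finset (Fin n → ℕ) :=
    (p.support.image (fun s : Fin n →₀ ℕ => (s : Fin n → ℕ))).filter (fun ν => Antitone ν) with hF
  have hmem : ∀ ν, ν ∈ F ↔ Antitone ν ∧ cf ν p ≠ 0 := by
    intro ν
    rw [hF, Finset.mem_filter, Finset.mem_image, and_comm]
    refine and_congr_right fun _ => ⟨?_, fun h => ⟨Finsupp.equivFunOnFinite.symm ν,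
      mem_support_iff.2 h, by simp⟩⟩
    rintro ⟨s, hs, rfl⟩
    rw [cf_apply, Finsupp.equivFunOnFinite_symm_coe]
    exact mem_support_iff.1 hs
  have : p = ∑ ν ∈ F, cf ν p • monSym ν := by
    refine poly_ext fun β => ?_
    obtain ⟨σ, hσ⟩ := exists_perm_antitone β
    have hsym : (∑ ν ∈ F, cf ν p • monSym ν).IsSymmetric := fun τ => by
      rw [map_sum]
      refine Finset.sum_congr rfl fun ν _ => ?_
      rw [map_smul, monSym_isSymmetric ν τ]
    rw [← cf_comp_perm hp β σ, ← cf_comp_perm hsym β σ]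
    set ν := β ∘ σ
    rw [map_sum]
    have h1 : ∀ ρ ∈ F, cf ν (cf ρ p • monSym ρ) = if ν = ρ then cf ρ p else 0 := by
      intro ρ hρ
      rw [map_smul, cf_monSym_of_antitone hσ ((hmem ρ).1 hρ).1]
      split_ifs <;> simp
    rw [Finset.sum_congr rfl h1, Finset.sum_ite_eq]
    split_ifs with h
    · rfl
    · by_contra h2
      exact h ((hmem ν).2 ⟨hσ, h2⟩)
  rw [this]
  exact Submodule.sum_mem _ fun ν hν => Submodule.smul_mem _ _ (Submodule.subset_span
    ⟨ν, hS ν ((hmem ν).1 hν).1 ((hmem ν).1 hν).2, rfl⟩)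

/-! ### The differential operators on symmetric polynomials -/

/-- The operator `∑ᵢ Xᵢᵐ ∂ᵢ² + k ∑ᵢⱼ (1 - sᵢⱼ)/(Xᵢ - Xⱼ) Xᵢᵐ ∂ᵢ`, which on symmetric polynomials
is `∑ᵢ xᵢᵐ ∂ᵢ² + 2 k ∑_{i ≠ j} xᵢᵐ / (xᵢ - xⱼ) ∂ᵢ`. -/
noncomputable def calogero (k : ℂ) (m : ℕ) : PolyOp n :=
  ∑ i, mulX i ^ m * derivOp i * derivOp i + k • ∑ i, ∑ j, divDiff i j * (mulX i ^ m * derivOp i)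

theorem mulX_pow_apply (i : Fin n) (m : ℕ) (p : MvPolynomial (Fin n) ℂ) :
    (mulX i ^ m) p = X i ^ m * p := by
  induction m generalizing p with
  | zero => simp
  | succ m ih => rw [pow_succ, Module.End.mul_apply, ih, mulX_apply, pow_succ, mul_assoc]

theorem calogero_apply (k : ℂ) (m : ℕ) (p : MvPolynomial (Fin n) ℂ) :
    calogero k m p = ∑ i, X i ^ m * pderiv i (pderiv i p)
      + k • ∑ i, ∑ j, divDiff i j (X i ^ m * pderiv i p) := by
  simp only [calogero, LinearMap.add_apply, LinearMap.smul_apply, LinearMap.sum_apply,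
    Module.End.mul_apply, mulX_pow_apply, derivOp_apply]

theorem permOp_mulX_pow (σ : Equiv.Perm (Fin n)) (i : Fin n) (m : ℕ) :
    permOp σ * mulX i ^ m = mulX (σ i) ^ m * permOp σ :=
  (show SemiconjBy (permOp σ) (mulX i) (mulX (σ i)) from permOp_mulX σ i).pow_right m

theorem permOp_commute_calogero (k : ℂ) (m : ℕ) (σ : Equiv.Perm (Fin n)) :
    Commute (permOp σ) (calogero k m) := by
  rw [commute_iff_eq, calogero, mul_add, add_mul, mul_smul_comm, smul_mul_assoc]
  simp only [Finset.mul_sum, Finset.sum_mul]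
  congr 1
  · rw [← Equiv.sum_comp σ (fun i => mulX i ^ m * derivOp i * derivOp i * permOp σ)]
    refine Finset.sum_congr rfl fun i _ => ?_
    rw [← mul_assoc, ← mul_assoc, permOp_mulX_pow, mul_assoc (mulX _ ^ m), permOp_derivOp,
      ← mul_assoc, mul_assoc _ (permOp σ), permOp_derivOp, ← mul_assoc]
  · rw [← Equiv.sum_comp σ (fun i => ∑ j, divDiff i j * (mulX i ^ m * derivOp i) * permOp σ)]
    congr 1
    refine Finset.sum_congr rfl fun i _ => ?_
    rw [← Equiv.sum_comp σ (fun j => divDiff (σ i) j * (mulX (σ i) ^ m * derivOp (σ i)) * permOp σ)]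
    refine Finset.sum_congr rfl fun j _ => ?_
    rw [← mul_assoc, permOp_divDiff, mul_assoc, ← mul_assoc (permOp σ), permOp_mulX_pow,
      mul_assoc (mulX _ ^ m), permOp_derivOp]
    simp only [mul_assoc]

theorem calogero_isSymmetric (k : ℂ) (m : ℕ) {p : MvPolynomial (Fin n) ℂ} (hp : p.IsSymmetric) :
    (calogero k m p).IsSymmetric :=
  isSymmetric_of_commute (permOp_commute_calogero k m) hp

theorem rename_X_pow_mul_pderiv {p : MvPolynomial (Fin n) ℂ} (hp : p.IsSymmetric)
    (σ : Equiv.Perm (Fin n)) (m : ℕ) (i : Fin n) :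
    rename σ (X i ^ m * pderiv i p) = X (σ i) ^ m * pderiv (σ i) p := by
  rw [map_mul, map_pow, rename_X, ← pderiv_rename σ.injective, hp σ]

theorem cherednik_apply_symm (k : ℂ) (i : Fin n) {p : MvPolynomial (Fin n) ℂ}
    (hp : p.IsSymmetric) : cherednik k i p = X i * pderiv i p + rhoShift k i • p := by
  rw [cherednik_apply]
  have : ∀ j ∈ Finset.univ, (X i * divDiff i j p + if i < j then permOp (Equiv.swap i j) p else 0)
      = if i < j then p else 0 := by
    intro j _
    rw [divDiff_eq_zero_of_swap (hp _), permOp_apply, hp, mul_zero, zero_add]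
  rw [Finset.sum_congr rfl this, sum_ite_lt, smul_smul, rhoShift]

theorem X_mul_divDiff {i j : Fin n} (h : i ≠ j) (p : MvPolynomial (Fin n) ℂ) :
    X i * divDiff i j p = divDiff i j (X i * p) - rename (Equiv.swap i j) p := by
  rw [divDiff_mul, divDiff_X_left h, rename_X, Equiv.swap_apply_left]
  linear_combination X_sub_X_mul_divDiff i j p

/-- On symmetric polynomials, `D₂` is a symmetric function of the Cherednik operators. -/
theorem calogero_two_eq (k : ℂ) {p : MvPolynomial (Fin n) ℂ} (hp : p.IsSymmetric) :
    calogero k 2 p = ∑ i, (cherednik k i (cherednik k i p) - cherednik k i p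
      - (rhoShift k i ^ 2 - rhoShift k i) • p) := by
  have h1 : ∀ i : Fin n, cherednik k i (cherednik k i p) - cherednik k i p
      - (rhoShift k i ^ 2 - rhoShift k i) • p
      = X i ^ 2 * pderiv i (pderiv i p) + k • ∑ j, divDiff i j (X i ^ 2 * pderiv i p)
        + rhoShift k i • (X i * pderiv i p)
        - k • ∑ j, (if j < i then X j * pderiv j p else 0) := by
    intro i
    have e1 : cherednik k i (X i * pderiv i p) = X i * pderiv i p
        + X i ^ 2 * pderiv i (pderiv i p) + k • ∑ j, divDiff i j (X i ^ 2 * pderiv i p)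
        - k • ∑ j, (if j < i then X j * pderiv j p else 0) := by
      rw [cherednik_apply, add_sub_assoc, ← smul_sub, ← Finset.sum_sub_distrib]
      congr 1
      · rw [Derivation.leibniz, pderiv_X_self, smul_eq_mul, smul_eq_mul]; ring
      · congr 1
        refine Finset.sum_congr rfl fun j _ => ?_
        rcases eq_or_ne i j with rfl | h
        · simp [divDiff_self]
        have e2 := rename_X_pow_mul_pderiv hp (Equiv.swap i j) 1 i
        rw [pow_one, pow_one, Equiv.swap_apply_left] at e2
        rw [X_mul_divDiff h, permOp_apply, e2, ← mul_assoc, ← pow_two]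
        rcases lt_or_gt_of_ne h with h | h
        · rw [if_pos h, if_neg h.not_gt]; ring
        · rw [if_neg h.not_gt, if_pos h]; ring
    rw [cherednik_apply_symm k i hp, map_add, map_smul, cherednik_apply_symm k i hp, e1]
    module
  rw [Finset.sum_congr rfl fun i _ => h1 i, calogero_apply, Finset.sum_sub_distrib,
    Finset.sum_add_distrib, Finset.sum_add_distrib, ← Finset.smul_sum, ← Finset.smul_sum,
    Finset.sum_comm (f := fun i j => if j < i then X j * pderiv j p else 0)]
  simp only [sum_ite_lt, Finset.smul_sum, smul_smul, rhoShift]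
  rw [add_sub_cancel_right]

/-- The eigenvalue `∑ νᵢ (νᵢ - 1 + 2 k (n - i))`. -/
noncomputable def eigC (k : ℂ) (ν : Fin n → ℕ) : ℂ :=
  ∑ i, (ν i : ℂ) * ((ν i : ℂ) - 1 + 2 * rhoShift k i)

theorem eigC_ofReal (κ : ℝ) (ν : Fin n → ℕ) : eigC (κ : ℂ) ν = (eigD κ ν : ℂ) := by
  rw [eigC, eigD]
  push_cast
  refine Finset.sum_congr rfl fun i _ => ?_
  rw [rhoShift]
  ring

theorem cf_calogero_two (k : ℂ) {ν : Fin n → ℕ} (hν : Antitone ν) {p : MvPolynomial (Fin n) ℂ}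
    (hs : p.IsSymmetric) (hp : p ∈ monSpan {α | sqSum α ≤ sqSum ν}) :
    cf ν (calogero k 2 p) = eigC k ν * cf ν p := by
  rw [calogero_two_eq k hs, map_sum, eigC, Finset.sum_mul]
  refine Finset.sum_congr rfl fun i _ => ?_
  rw [map_sub, map_sub, cf_cherednik k i hν ((saturated_sqSum_le _).cherednik_mem k i hp),
    cf_cherednik k i hν hp, map_smul, smul_eq_mul]
  ring

theorem Saturated.calogero_two_mem {U : Set (Fin n → ℕ)} (hU : Saturated U) (k : ℂ)
    {p : MvPolynomial (Fin n) ℂ} (hs : p.IsSymmetric) (hp : p ∈ monSpan U) :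
    calogero k 2 p ∈ monSpan U := by
  rw [calogero_two_eq k hs]
  refine Submodule.sum_mem _ fun i _ => ?_
  have := hU.cherednik_mem k i hp
  exact sub_mem (sub_mem (hU.cherednik_mem k i this) this) (Submodule.smul_mem _ _ hp)

theorem eval_divDiff {x : Fin n → ℂ} (hx : Function.Injective x) (i j : Fin n)
    (p : MvPolynomial (Fin n) ℂ) : eval x (divDiff i j p)
      = (eval x p - eval x (rename (Equiv.swap i j) p)) / (x i - x j) := by
  rcases eq_or_ne i j with rfl | h
  · simp [divDiff_self]
  · rw [eq_div_iff (sub_ne_zero.2 (hx.ne h)), ← map_sub, ← X_sub_X_mul_divDiff, map_mul, map_sub,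
      eval_X, eval_X, mul_comm]

theorem eval_calogero (k : ℂ) (m : ℕ) {p : MvPolynomial (Fin n) ℂ} (hp : p.IsSymmetric)
    {x : Fin n → ℂ} (hx : Function.Injective x) :
    eval x (calogero k m p) = ∑ i, x i ^ m * eval x (pderiv i (pderiv i p))
      + 2 * k * ∑ i, ∑ j ∈ Finset.univ.erase i, x i ^ m / (x i - x j) * eval x (pderiv i p) := by
  have h1 : ∀ i j : Fin n, eval x (divDiff i j (X i ^ m * pderiv i p))
      = x i ^ m / (x i - x j) * eval x (pderiv i p)
        + x j ^ m / (x j - x i) * eval x (pderiv j p) := by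
    intro i j
    rw [eval_divDiff hx, rename_X_pow_mul_pderiv hp, Equiv.swap_apply_left, map_mul, map_mul,
      map_pow, map_pow, eval_X, eval_X, ← neg_sub (x i) (x j), div_neg]
    ring
  -- the diagonal terms vanish, because division by zero gives zero
  have h2 : ∀ i : Fin n, ∑ j ∈ Finset.univ.erase i, x i ^ m / (x i - x j) * eval x (pderiv i p)
      = ∑ j, x i ^ m / (x i - x j) * eval x (pderiv i p) := by
    intro i
    rw [← Finset.add_sum_erase _ (fun j => x i ^ m / (x i - x j) * eval x (pderiv i p))
      (Finset.mem_univ i)]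
    simp
  rw [calogero_apply]
  simp only [map_add, map_sum, map_mul, map_pow, eval_X, smul_eval, h1, h2,
    Finset.sum_add_distrib]
  rw [Finset.sum_comm (f := fun i j => x j ^ m / (x j - x i) * eval x (pderiv j p))]
  ring

theorem opD2_eq_eval (κ : ℝ) {p : MvPolynomial (Fin n) ℂ} (hp : p.IsSymmetric)
    {x : Fin n → ℂ} (hx : Function.Injective x) : opD2 κ p x = eval x (calogero κ 2 p) := by
  rw [eval_calogero _ _ hp hx, opD2]

/-- Polynomials are determined by their values at the points with distinct coordinates which
moreover are different from `0` and `1`. -/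
theorem eq_of_eval_eq {p q : MvPolynomial (Fin n) ℂ}
    (h : ∀ x : Fin n → ℂ, Function.Injective x → (∀ i, x i ≠ 0 ∧ x i ≠ 1) →
      eval x p = eval x q) : p = q := by
  set D : MvPolynomial (Fin n) ℂ :=
    (∏ i, ∏ j ∈ Finset.univ.erase i, (X i - X j)) * ∏ i, (X i * (X i - 1)) with hD
  have hD0 : D ≠ 0 := by
    refine mul_ne_zero ?_ ?_
    · exact Finset.prod_ne_zero_iff.2 fun i _ => Finset.prod_ne_zero_iff.2 fun j hj =>
        X_sub_X_ne_zero (Finset.ne_of_mem_erase hj).symm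
    · refine Finset.prod_ne_zero_iff.2 fun i _ => mul_ne_zero (X_ne_zero i) fun h => ?_
      have := congrArg (eval fun _ => (2 : ℂ)) h
      norm_num at this
  have : D * p = D * q := by
    refine MvPolynomial.funext fun x => ?_
    rw [map_mul (eval x) D p, map_mul (eval x) D q]
    by_cases hx : eval x D = 0
    · rw [hx, zero_mul, zero_mul]
    · congr 1
      rw [hD, map_mul] at hx
      simp only [map_prod, map_sub, map_mul, eval_X, map_one] at hx
      have h1 := left_ne_zero_of_mul hx
      have h2 := right_ne_zero_of_mul hx
      rw [Finset.prod_ne_zero_iff] at h1 h2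
      refine h x (fun i j hij => ?_) fun i => ?_
      · by_contra hne
        have := h1 i (Finset.mem_univ i)
        rw [Finset.prod_ne_zero_iff] at this
        exact this j (Finset.mem_erase.2 ⟨Ne.symm hne, Finset.mem_univ j⟩) (sub_eq_zero.2 hij)
      · have := h2 i (Finset.mem_univ i)
        exact ⟨left_ne_zero_of_mul this, fun hh => right_ne_zero_of_mul this (sub_eq_zero.2 hh)⟩
  exact mul_left_cancel₀ hD0 this

/-! ### The dominance order -/

/-- The exponents whose decreasing rearrangement is dominated by that of `μ`. Dominance is
expressed through the sums of the truncated differences `max (αᵢ - c) 0`, which are visibly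
invariant under permutations. -/
def domSet (μ : Fin n → ℕ) : Set (Fin n → ℕ) :=
  {α | ∑ i, α i = ∑ i, μ i ∧ ∀ c, ∑ i, (α i - c) ≤ ∑ i, (μ i - c)}

theorem self_mem_domSet (μ : Fin n → ℕ) : μ ∈ domSet μ := ⟨rfl, fun _ => le_rfl⟩

theorem domSet_trans {α ν μ : Fin n → ℕ} (h1 : α ∈ domSet ν) (h2 : ν ∈ domSet μ) : α ∈ domSet μ :=
  ⟨h1.1.trans h2.1, fun c => (h1.2 c).trans (h2.2 c)⟩

theorem comp_perm_mem_domSet {α μ : Fin n → ℕ} (h : α ∈ domSet μ) (σ : Equiv.Perm (Fin n)) :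
    α ∘ σ ∈ domSet μ :=
  ⟨(Equiv.sum_comp σ α).trans h.1, fun c => (Equiv.sum_comp σ fun i => α i - c).trans_le (h.2 c)⟩

theorem saturated_domSet (μ : Fin n → ℕ) : Saturated (domSet μ) := by
  intro α hα i j h p q hpq hp hq
  refine ⟨?_, fun c => ?_⟩
  · have h1 := sum_update₂ h (fun t => t) α p q
    have h2 := hα.1
    omega
  · have h1 := sum_update₂ h (fun t => t - c) α p q
    have h2 := hα.2 c
    have h3 : (p - c) + (q - c) ≤ (α i - c) + (α j - c) := by omega
    omega

theorem sum_Iic_le (α : Fin n → ℕ) (c : ℕ) (m : Fin n) :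
    ∑ i ∈ Finset.Iic m, α i ≤ ∑ i, (α i - c) + (m + 1) * c :=
  calc ∑ i ∈ Finset.Iic m, α i ≤ ∑ i ∈ Finset.Iic m, ((α i - c) + c) :=
        Finset.sum_le_sum fun i _ => by omega
    _ = ∑ i ∈ Finset.Iic m, (α i - c) + (m + 1) * c := by
        rw [Finset.sum_add_distrib, Finset.sum_const, Fin.card_Iic, smul_eq_mul]
    _ ≤ ∑ i, (α i - c) + (m + 1) * c :=
        Nat.add_le_add_right (Finset.sum_le_sum_of_subset (Finset.subset_univ _)) _

theorem mem_domSet_of_domLT {ν μ : Fin n → ℕ} (hν : Antitone ν) (h : DomLT ν μ) :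
    ν ∈ domSet μ := by
  refine ⟨h.2.1, fun c => ?_⟩
  rcases (Finset.univ.filter fun i => c < ν i).eq_empty_or_nonempty with he | hne
  · rw [Finset.sum_eq_zero]
    · exact Nat.zero_le _
    intro i hi
    have : i ∉ Finset.univ.filter fun i => c < ν i := by rw [he]; simp
    rw [Finset.mem_filter] at this
    have : ¬ c < ν i := fun hh => this ⟨hi, hh⟩
    omega
  · -- the entries of `ν` exceeding `c` are those up to some index `m`
    set m := (Finset.univ.filter fun i => c < ν i).max' hne with hm
    have hcm : c < ν m := (Finset.mem_filter.1 (Finset.max'_mem _ hne)).2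
    have h1 : ∑ i, (ν i - c) = ∑ i ∈ Finset.Iic m, (ν i - c) := by
      symm
      refine Finset.sum_subset (Finset.subset_univ _) fun i _ hi => ?_
      by_contra h0
      have := Finset.le_max' (Finset.univ.filter fun i => c < ν i) i
        (Finset.mem_filter.2 ⟨Finset.mem_univ i, by omega⟩)
      exact hi (Finset.mem_Iic.2 this)
    have h2 : ∑ i ∈ Finset.Iic m, (ν i - c) + (m + 1) * c = ∑ i ∈ Finset.Iic m, ν i := by
      rw [← Fin.card_Iic, ← smul_eq_mul, ← Finset.sum_const, ← Finset.sum_add_distrib]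
      refine Finset.sum_congr rfl fun i hi => ?_
      have := hν (Finset.mem_Iic.1 hi)
      omega
    have h3 := sum_Iic_le μ c m
    have h4 := h.2.2 m
    omega

theorem eq_or_domLT_of_mem_domSet {ν μ : Fin n → ℕ} (hμ : Antitone μ) (h : ν ∈ domSet μ) :
    ν = μ ∨ DomLT ν μ := by
  refine or_iff_not_imp_left.2 fun hne => ⟨hne, h.1, fun m => ?_⟩
  have h1 := sum_Iic_le ν (μ m) m
  have h2 := h.2 (μ m)
  have h3 : ∑ i, (μ i - μ m) = ∑ i ∈ Finset.Iic m, (μ i - μ m) := by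
    symm
    refine Finset.sum_subset (Finset.subset_univ _) fun i _ hi => ?_
    have := hμ (not_le.1 fun hh => hi (Finset.mem_Iic.2 hh)).le
    omega
  have h4 : ∑ i ∈ Finset.Iic m, (μ i - μ m) + (m + 1) * μ m = ∑ i ∈ Finset.Iic m, μ i := by
    rw [← Fin.card_Iic, ← smul_eq_mul, ← Finset.sum_const, ← Finset.sum_add_distrib]
    refine Finset.sum_congr rfl fun i hi => ?_
    have := hμ (Finset.mem_Iic.1 hi)
    omega
  omega

/-- The sum of all partial sums, a strictly monotone function for the dominance order. -/
def partialSum (α : Fin n → ℕ) : ℕ := ∑ i, ∑ j ∈ Finset.Iic i, α j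

theorem DomLT.partialSum_lt {ν μ : Fin n → ℕ} (h : DomLT ν μ) : partialSum ν < partialSum μ := by
  refine lt_of_le_of_ne (Finset.sum_le_sum fun i _ => h.2.2 i) fun he => h.1 ?_
  have h1 : ∀ i, ∑ j ∈ Finset.Iic i, ν j = ∑ j ∈ Finset.Iic i, μ j := fun i =>
    (Finset.sum_eq_sum_iff_of_le fun i _ => h.2.2 i).1 he i (Finset.mem_univ i)
  funext i
  induction i using WellFoundedLT.induction with
  | ind i ih =>
    have h2 := h1 i
    have h3 : ∑ j ∈ Finset.Iio i, ν j = ∑ j ∈ Finset.Iio i, μ j :=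
      Finset.sum_congr rfl fun j hj => ih j (Finset.mem_Iio.1 hj)
    rw [← Finset.Iio_insert i, Finset.sum_insert (by simp), Finset.sum_insert (by simp)] at h2
    omega

theorem DomLT.notMem_domSet {ν μ : Fin n → ℕ} (hν : Antitone ν) (h : DomLT ν μ) :
    μ ∉ domSet ν := by
  intro h'
  rcases eq_or_domLT_of_mem_domSet hν h' with rfl | h2
  · exact h.1 rfl
  · exact lt_asymm h.partialSum_lt h2.partialSum_lt

theorem finite_domLT (μ : Fin n → ℕ) : {ν : Fin n → ℕ | Antitone ν ∧ DomLT ν μ}.Finite := by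
  refine (Set.finite_Iic (fun _ : Fin n => weight μ)).subset fun ν hν i => ?_
  rw [← hν.2.2.1, weight]
  exact Finset.single_le_sum (fun _ _ => Nat.zero_le _) (Finset.mem_univ i)

/-! ### Jack polynomials -/

/-- The span of the monomial symmetric polynomials strictly below `μ` in the dominance order. -/
noncomputable def lowerSpan (μ : Fin n → ℕ) : Submodule ℂ (MvPolynomial (Fin n) ℂ) :=
  Submodule.span ℂ (monSym '' {ν | Antitone ν ∧ DomLT ν μ})

theorem finiteDimensional_lowerSpan (μ : Fin n → ℕ) : FiniteDimensional ℂ (lowerSpan μ) :=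
  FiniteDimensional.span_of_finite ℂ ((finite_domLT μ).image _)

theorem monSym_mem_monSpan {U : Set (Fin n → ℕ)} {l : Fin n → ℕ}
    (h : ∀ σ : Equiv.Perm (Fin n), l ∘ σ ∈ U) : monSym l ∈ monSpan U := by
  rw [monSym_eq]
  refine Submodule.sum_mem _ fun α hα => mon_mem_monSpan ?_
  obtain ⟨σ, -, rfl⟩ := Finset.mem_image.1 hα
  exact h σ

theorem monSym_mem_domSet (μ : Fin n → ℕ) : monSym μ ∈ monSpan (domSet μ) :=
  monSym_mem_monSpan fun σ => comp_perm_mem_domSet (self_mem_domSet μ) σ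

theorem monSpan_mono {U V : Set (Fin n → ℕ)} (h : U ⊆ V) : monSpan U ≤ monSpan V :=
  Submodule.span_mono (Set.image_mono h)

theorem isSymmetric_add {p q : MvPolynomial (Fin n) ℂ} (hp : p.IsSymmetric) (hq : q.IsSymmetric) :
    (p + q).IsSymmetric := fun σ => by rw [map_add, hp σ, hq σ]

theorem isSymmetric_smul {p : MvPolynomial (Fin n) ℂ} (c : ℂ) (hp : p.IsSymmetric) :
    (c • p).IsSymmetric := fun σ => by rw [map_smul, hp σ]

theorem isSymmetric_sub {p q : MvPolynomial (Fin n) ℂ} (hp : p.IsSymmetric) (hq : q.IsSymmetric) :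
    (p - q).IsSymmetric := fun σ => by rw [map_sub, hp σ, hq σ]

theorem mem_lowerSpan_iff {μ : Fin n → ℕ} (hμ : Antitone μ) {p : MvPolynomial (Fin n) ℂ} :
    p ∈ lowerSpan μ ↔ p.IsSymmetric ∧ p ∈ monSpan (domSet μ) ∧ cf μ p = 0 := by
  constructor
  · intro hp
    induction hp using Submodule.span_induction with
    | mem x hx =>
      obtain ⟨ν, ⟨hν, hd⟩, rfl⟩ := hx
      refine ⟨monSym_isSymmetric ν, ?_, ?_⟩
      · exact monSpan_mono (fun α hα => domSet_trans hα (mem_domSet_of_domLT hν hd))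
          (monSym_mem_domSet ν)
      · rw [cf_monSym_of_antitone hμ hν, if_neg (Ne.symm hd.1)]
    | zero => exact ⟨fun σ => map_zero _, zero_mem _, map_zero _⟩
    | add x y _ _ hx hy =>
      exact ⟨isSymmetric_add hx.1 hy.1, add_mem hx.2.1 hy.2.1, by
        rw [map_add, hx.2.2, hy.2.2, add_zero]⟩
    | smul c x _ hx =>
      exact ⟨isSymmetric_smul c hx.1, Submodule.smul_mem _ _ hx.2.1, by
        rw [map_smul, hx.2.2, smul_zero]⟩
  · rintro ⟨h1, h2, h3⟩
    refine mem_span_monSym h1 fun ν hν hc => ⟨hν, ?_⟩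
    rcases eq_or_domLT_of_mem_domSet hμ (mem_monSpan.1 h2 ν hc) with rfl | h
    · exact absurd h3 hc
    · exact h

/-- An operator is triangular if it preserves symmetry and, on symmetric polynomials, the spaces
of polynomials with exponents dominated by a given one. -/
def IsTriangular (A : PolyOp n) : Prop :=
  ∀ p : MvPolynomial (Fin n) ℂ, p.IsSymmetric →
    (A p).IsSymmetric ∧ ∀ μ, p ∈ monSpan (domSet μ) → A p ∈ monSpan (domSet μ)

theorem isTriangular_calogero (k : ℂ) : IsTriangular (calogero k 2 : PolyOp n) := fun _ hp =>
  ⟨calogero_isSymmetric k 2 hp, fun μ h => (saturated_domSet μ).calogero_two_mem k hp h⟩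

theorem isTriangular_cherednikProd (k z : ℂ) : IsTriangular (cherednikProd k z : PolyOp n) :=
  fun _ hp => ⟨isSymmetric_of_commute (permOp_commute_prod k z) hp,
    fun μ h => (saturated_domSet μ).cherednikProd_mem k z h⟩

theorem IsTriangular.map_lowerSpan {A : PolyOp n} (hA : IsTriangular A) {μ : Fin n → ℕ}
    (hμ : Antitone μ) {p : MvPolynomial (Fin n) ℂ} (hp : p ∈ lowerSpan μ) :
    A p ∈ lowerSpan μ := by
  induction hp using Submodule.span_induction with
  | mem x hx =>
    obtain ⟨ν, ⟨hν, hd⟩, rfl⟩ := hx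
    have h1 := hA _ (monSym_isSymmetric ν)
    have h2 := h1.2 ν (monSym_mem_domSet ν)
    refine (mem_lowerSpan_iff hμ).2 ⟨h1.1, ?_, ?_⟩
    · exact monSpan_mono (fun α hα => domSet_trans hα (mem_domSet_of_domLT hν hd)) h2
    · by_contra hc
      exact hd.notMem_domSet hν (mem_monSpan.1 h2 μ hc)
  | zero => rw [map_zero]; exact zero_mem _
  | add x y _ _ hx hy => rw [map_add]; exact add_mem hx hy
  | smul c x _ hx => rw [map_smul]; exact Submodule.smul_mem _ _ hx

theorem monSym_mem_sqSum (μ : Fin n → ℕ) : monSym μ ∈ monSpan {α | sqSum α ≤ sqSum μ} :=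
  monSym_mem_monSpan fun σ => (sqSum_comp_perm μ σ).le

theorem cf_monSym_self (μ : Fin n → ℕ) : cf μ (monSym μ) = 1 := by
  rw [cf_monSym, if_pos ⟨1, rfl⟩]

/-- The defining property of the monic Jack polynomial, with the eigenvalue made explicit and
with `D₂` as an operator on polynomials. -/
structure JackPoly (k : ℂ) (μ : Fin n → ℕ) (P : MvPolynomial (Fin n) ℂ) : Prop where
  symm : P.IsSymmetric
  sub_mem : P - monSym μ ∈ lowerSpan μ
  eig : calogero k 2 P = eigC k μ • P

theorem cf_map_of_sub_mem {A : PolyOp n} (hA : IsTriangular A) {μ : Fin n → ℕ} (hμ : Antitone μ)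
    {P : MvPolynomial (Fin n) ℂ} (h : P - monSym μ ∈ lowerSpan μ) :
    cf μ (A P) = cf μ (A (monSym μ)) := by
  have := ((mem_lowerSpan_iff hμ).1 (hA.map_lowerSpan hμ h)).2.2
  rwa [map_sub, map_sub, sub_eq_zero] at this

theorem cf_of_sub_mem {μ : Fin n → ℕ} (hμ : Antitone μ)
    {P : MvPolynomial (Fin n) ℂ} (h : P - monSym μ ∈ lowerSpan μ) : cf μ P = 1 := by
  have := ((mem_lowerSpan_iff hμ).1 h).2.2
  rwa [map_sub, cf_monSym_self, sub_eq_zero] at this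

theorem mem_domSet_of_sub_mem {μ : Fin n → ℕ} (hμ : Antitone μ)
    {P : MvPolynomial (Fin n) ℂ} (h : P - monSym μ ∈ lowerSpan μ) : P ∈ monSpan (domSet μ) := by
  have := add_mem ((mem_lowerSpan_iff hμ).1 h).2.1 (monSym_mem_domSet μ)
  rwa [sub_add_cancel] at this

theorem cf_calogero_monSym (k : ℂ) {μ : Fin n → ℕ} (hμ : Antitone μ) :
    cf μ (calogero k 2 (monSym μ)) = eigC k μ := by
  rw [cf_calogero_two k hμ (monSym_isSymmetric μ) (monSym_mem_sqSum μ), cf_monSym_self, mul_one]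

/-- A symmetric eigenvector of `D₂` without component along `m_μ` and dominated by `μ` vanishes
if the eigenvalue is none of those strictly below `μ`. -/
theorem eq_zero_of_mem_lowerSpan {k : ℂ} {μ : Fin n → ℕ} {c : ℂ} (hμ : Antitone μ)
    (hsep : ∀ ν, Antitone ν → DomLT ν μ → eigC k ν ≠ c)
    {p : MvPolynomial (Fin n) ℂ} (hp : p ∈ lowerSpan μ) (he : calogero k 2 p = c • p) :
    p = 0 := by
  by_contra h0
  obtain ⟨h1, h2, h3⟩ := (mem_lowerSpan_iff hμ).1 hp
  obtain ⟨ν, hν, hc, hQ⟩ := exists_extremal h1 h0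
  have h4 := cf_calogero_two k hν h1 hQ
  rw [he, map_smul, smul_eq_mul] at h4
  rcases eq_or_domLT_of_mem_domSet hμ (mem_monSpan.1 h2 ν hc) with rfl | h
  · exact hc h3
  · exact hsep ν hν h (mul_right_cancel₀ hc h4).symm

theorem JackPoly.unique {k : ℂ} {μ : Fin n → ℕ} (hμ : Antitone μ)
    (hsep : ∀ ν, Antitone ν → DomLT ν μ → eigC k ν ≠ eigC k μ)
    {P P' : MvPolynomial (Fin n) ℂ} (h : JackPoly k μ P) (h' : JackPoly k μ P') : P = P' := by
  rw [← sub_eq_zero]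
  refine eq_zero_of_mem_lowerSpan hμ hsep ?_ (by rw [map_sub, h.eig, h'.eig, smul_sub])
  have := _root_.sub_mem h.sub_mem h'.sub_mem
  rwa [sub_sub_sub_cancel_right] at this

theorem calogero_monSym_sub_mem (k : ℂ) {μ : Fin n → ℕ} (hμ : Antitone μ) :
    calogero k 2 (monSym μ) - eigC k μ • monSym μ ∈ lowerSpan μ := by
  have h1 := isTriangular_calogero k _ (monSym_isSymmetric μ)
  refine (mem_lowerSpan_iff hμ).2 ⟨isSymmetric_sub h1.1 (isSymmetric_smul _ (monSym_isSymmetric μ)),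
    _root_.sub_mem (h1.2 μ (monSym_mem_domSet μ)) (Submodule.smul_mem _ _ (monSym_mem_domSet μ)),
    ?_⟩
  rw [map_sub, cf_calogero_monSym k hμ, map_smul, cf_monSym_self, smul_eq_mul, mul_one, sub_self]

theorem exists_jackPoly {k : ℂ} {μ : Fin n → ℕ} (hμ : Antitone μ)
    (hsep : ∀ ν, Antitone ν → DomLT ν μ → eigC k ν ≠ eigC k μ) : ∃ P, JackPoly k μ P := by
  have := finiteDimensional_lowerSpan μ
  have hst : ∀ p ∈ lowerSpan μ, (calogero k 2 - eigC k μ • 1 : PolyOp n) p ∈ lowerSpan μ :=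
    fun p hp => _root_.sub_mem ((isTriangular_calogero k).map_lowerSpan hμ hp)
      (Submodule.smul_mem _ _ hp)
  set T : lowerSpan μ →ₗ[ℂ] lowerSpan μ := (calogero k 2 - eigC k μ • 1 : PolyOp n).restrict hst
  have hinj : Function.Injective T := by
    rw [← LinearMap.ker_eq_bot, LinearMap.ker_eq_bot']
    intro p hp
    have h1 : calogero k 2 (p : MvPolynomial (Fin n) ℂ) - eigC k μ • (p : MvPolynomial (Fin n) ℂ)
        = 0 := congrArg Subtype.val hp
    exact Subtype.ext (eq_zero_of_mem_lowerSpan hμ hsep p.2 (sub_eq_zero.1 h1))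
  obtain ⟨w, hw⟩ := LinearMap.injective_iff_surjective.1 hinj
    ⟨_, calogero_monSym_sub_mem k hμ⟩
  have hw' : calogero k 2 (w : MvPolynomial (Fin n) ℂ) - eigC k μ • (w : MvPolynomial (Fin n) ℂ)
      = calogero k 2 (monSym μ) - eigC k μ • monSym μ := congrArg Subtype.val hw
  refine ⟨monSym μ - w, isSymmetric_sub (monSym_isSymmetric μ) ((mem_lowerSpan_iff hμ).1 w.2).1,
    ?_, ?_⟩
  · rw [sub_sub_cancel_left]
    exact neg_mem w.2
  · rw [map_sub, smul_sub, ← sub_eq_zero, sub_sub_sub_comm, hw', sub_self]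

theorem opE1_of_mem_monSpan {p : MvPolynomial (Fin n) ℂ} {N : ℕ}
    (hp : p ∈ monSpan {α | ∑ i, α i = N}) : opE1 p = (N : ℂ) • p := by
  unfold opE1
  induction hp using Submodule.span_induction with
  | mem x hx =>
    obtain ⟨α, hα, rfl⟩ := hx
    simp only [X_mul_pderiv_mon]
    rw [← Finset.sum_smul, ← Nat.cast_sum, show ∑ i, α i = N from hα]
  | zero => simp
  | add x y _ _ hx hy => simp only [map_add, mul_add, Finset.sum_add_distrib, hx, hy, smul_add]
  | smul c x _ hx =>
    rw [smul_comm, ← hx, Finset.smul_sum]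
    exact Finset.sum_congr rfl fun i _ => by rw [Derivation.map_smul, mul_smul_comm]

theorem JackPoly.opE1 {k : ℂ} {μ : Fin n → ℕ} (hμ : Antitone μ) {P : MvPolynomial (Fin n) ℂ}
    (h : JackPoly k μ P) : opE1 P = (weight μ : ℂ) • P :=
  opE1_of_mem_monSpan (monSpan_mono (fun _ hα => hα.1) (mem_domSet_of_sub_mem hμ h.sub_mem))

theorem isJack_iff {κ : ℝ} {μ : Fin n → ℕ} (hμ : Antitone μ) {P : MvPolynomial (Fin n) ℂ} :
    IsJack κ μ P ↔ JackPoly κ μ P := by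
  constructor
  · rintro ⟨h1, h2, -, c, hc⟩
    have h3 : calogero κ 2 P = c • P := by
      refine eq_of_eval_eq fun x hx _ => ?_
      rw [← opD2_eq_eval κ h1 hx, hc x hx, smul_eval]
    have h4 := cf_map_of_sub_mem (isTriangular_calogero (κ : ℂ)) hμ h2
    rw [cf_calogero_monSym _ hμ, h3, map_smul, cf_of_sub_mem hμ h2, smul_eq_mul, mul_one] at h4
    exact ⟨h1, h2, by rw [h3, h4]⟩
  · intro h
    refine ⟨h.symm, h.sub_mem, ⟨_, h.opE1 hμ⟩, eigC κ μ, fun x hx => ?_⟩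
    rw [opD2_eq_eval κ h.symm hx, h.eig, smul_eval]

theorem existsUnique_isJack {κ : ℝ} {μ : Fin n → ℕ} (hμ : Antitone μ)
    (hsep : ∀ ν, Antitone ν → DomLT ν μ → eigD κ ν ≠ eigD κ μ) : ∃! P, IsJack κ μ P := by
  have hsep' : ∀ ν, Antitone ν → DomLT ν μ → eigC (κ : ℂ) ν ≠ eigC κ μ := fun ν hν hd => by
    rw [eigC_ofReal, eigC_ofReal, Ne, Complex.ofReal_inj]
    exact hsep ν hν hd
  obtain ⟨P, hP⟩ := exists_jackPoly hμ hsep'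
  exact ⟨P, (isJack_iff hμ).2 hP, fun P' hP' => ((isJack_iff hμ).1 hP').unique hμ hsep' hP⟩

theorem jackPoly_jack {κ : ℝ} {μ : Fin n → ℕ} (hμ : Antitone μ)
    (hsep : ∀ ν, Antitone ν → DomLT ν μ → eigD κ ν ≠ eigD κ μ) : JackPoly κ μ (jack κ μ) :=
  (isJack_iff hμ).1 (Classical.epsilon_spec (existsUnique_isJack hμ hsep).exists)

/-! ### Lowering Jack polynomials: irrational parameter -/

theorem partialSum_eq (α : Fin n → ℕ) :
    (partialSum α : ℝ) = ∑ i : Fin n, ((n : ℝ) - (i : ℕ)) * α i := by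
  have h : partialSum α = ∑ j, ∑ i ∈ Finset.Ici j, α j := by
    rw [partialSum]
    exact Finset.sum_comm' fun i j => by simp
  rw [h]
  push_cast
  refine Finset.sum_congr rfl fun i _ => ?_
  rw [Finset.sum_const, Fin.card_Ici, nsmul_eq_mul, Nat.cast_sub i.2.le]

theorem eigD_eq (κ : ℝ) (μ : Fin n → ℕ) :
    eigD κ μ = sqSum μ - weight μ + 2 * κ * (partialSum μ - weight μ) := by
  rw [partialSum_eq, eigD, sqSum, weight]
  push_cast
  rw [← Finset.sum_sub_distrib, ← Finset.sum_sub_distrib, Finset.mul_sum, ← Finset.sum_add_distrib]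
  refine Finset.sum_congr rfl fun i _ => ?_
  ring

theorem eigD_ne_of_irrational {κ : ℝ} (hκ : Irrational κ) {ν μ : Fin n → ℕ} (h : DomLT ν μ) :
    eigD κ ν ≠ eigD κ μ := by
  intro he
  rw [eigD_eq, eigD_eq, h.2.1] at he
  have h1 : ((partialSum μ : ℝ) - partialSum ν) ≠ 0 :=
    sub_ne_zero.2 (Nat.cast_injective.ne h.partialSum_lt.ne')
  refine hκ ⟨((sqSum ν : ℚ) - sqSum μ) / (2 * (partialSum μ - partialSum ν)), ?_⟩
  push_cast
  rw [div_eq_iff (mul_ne_zero two_ne_zero h1)]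
  linarith

/-- Jack polynomials are eigenvectors of all symmetric functions of the Cherednik operators. -/
theorem JackPoly.cherednikProd_eq {k : ℂ} {μ : Fin n → ℕ} (hμ : Antitone μ)
    (hsep : ∀ ν, Antitone ν → DomLT ν μ → eigC k ν ≠ eigC k μ) {P : MvPolynomial (Fin n) ℂ}
    (h : JackPoly k μ P) (z : ℂ) :
    cherednikProd k z P = (∏ i, (z + (μ i + rhoShift k i))) • P := by
  have hT := isTriangular_cherednikProd (n := n) k z
  have h1 := hT P h.symm
  have hP := mem_domSet_of_sub_mem hμ h.sub_mem
  rw [← sub_eq_zero]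
  refine eq_zero_of_mem_lowerSpan hμ hsep ((mem_lowerSpan_iff hμ).2
    ⟨isSymmetric_sub h1.1 (isSymmetric_smul _ h.symm),
      _root_.sub_mem (h1.2 μ hP) (Submodule.smul_mem _ _ hP), ?_⟩) ?_
  · rw [map_sub, cf_map_of_sub_mem hT hμ h.sub_mem, cf_cherednikProd k z hμ (monSym_mem_sqSum μ),
      cf_monSym_self, map_smul, cf_of_sub_mem hμ h.sub_mem, smul_eq_mul, sub_self]
  · have hc : ∀ (i : Fin n) q, cherednik k i (cherednikProd k z q)
        = cherednikProd k z (cherednik k i q) := fun i q => by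
      rw [← Module.End.mul_apply, (cherednik_commute_prod k z i).eq, Module.End.mul_apply]
    have h2 : calogero k 2 (cherednikProd k z P) = cherednikProd k z (calogero k 2 P) := by
      rw [calogero_two_eq k h1.1, calogero_two_eq k h.symm, map_sum]
      simp only [hc, map_sub, map_smul]
    rw [map_sub, h2, map_smul, h.eig, map_smul, smul_sub, smul_comm]

theorem rhoShift_injective {κ : ℝ} (hκ : Irrational κ) {a b : ℤ} {i j : Fin n}
    (h : (a : ℂ) + rhoShift κ i = b + rhoShift κ j) : i = j ∧ a = b := by
  have h1 : (a : ℝ) + κ * ((n : ℝ) - ((i : ℕ) + 1)) = b + κ * ((n : ℝ) - ((j : ℕ) + 1)) := by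
    simp only [rhoShift] at h
    exact_mod_cast h
  by_cases hij : i = j
  · subst hij
    exact ⟨rfl, by exact_mod_cast add_right_cancel h1⟩
  · exfalso
    have h2 : ((j : ℕ) : ℝ) - (i : ℕ) ≠ 0 :=
      sub_ne_zero.2 (Nat.cast_injective.ne fun hh => hij (Fin.ext hh.symm))
    refine hκ ⟨((b : ℚ) - a) / ((j : ℕ) - (i : ℕ)), ?_⟩
    push_cast
    rw [div_eq_iff h2]
    linarith

/-- For irrational `κ` a partition can be recovered from its spectral parameters. -/
theorem add_single_eq_of_spectral {κ : ℝ} (hκ : Irrational κ) {ν μ : Fin n → ℕ} {j : Fin n}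
    (h : ∀ z : ℂ, (z + (μ j + rhoShift κ j)) * ∏ i, (z + (ν i + rhoShift κ i))
      = (z - 1 + (μ j + rhoShift κ j)) * ∏ i, (z + (μ i + rhoShift κ i))) :
    ν + Pi.single j 1 = μ := by
  have key : ∀ i, (i = j ∧ ν i + 1 = μ i) ∨ ν i = μ i := by
    intro i
    have h1 := h (-(ν i + rhoShift κ i))
    rw [Finset.prod_eq_zero (Finset.mem_univ i) (neg_add_cancel _), mul_zero, eq_comm,
      mul_eq_zero, Finset.prod_eq_zero_iff] at h1
    rcases h1 with h1 | ⟨m, -, h1⟩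
    · have h2 : (((ν i : ℤ) + 1 : ℤ) : ℂ) + rhoShift κ i = ((μ j : ℤ) : ℂ) + rhoShift κ j := by
        push_cast
        linear_combination -h1
      obtain ⟨rfl, h3⟩ := rhoShift_injective hκ h2
      exact Or.inl ⟨rfl, by omega⟩
    · have h2 : ((ν i : ℤ) : ℂ) + rhoShift κ i = ((μ m : ℤ) : ℂ) + rhoShift κ m := by
        push_cast
        linear_combination -h1
      obtain ⟨rfl, h3⟩ := rhoShift_injective hκ h2
      exact Or.inr (by omega)
  have hj : ν j + 1 = μ j := by
    rcases key j with ⟨-, h1⟩ | h1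
    · exact h1
    · exfalso
      have hν : ν = μ := by
        funext i
        rcases key i with ⟨rfl, -⟩ | h2
        · exact h1
        · exact h2
      -- the spectral parameters are real, so the product does not vanish at `z = I`
      have h2 := h Complex.I
      rw [hν] at h2
      have h3 : ∏ i, (Complex.I + (μ i + rhoShift κ i)) ≠ 0 := by
        refine Finset.prod_ne_zero_iff.2 fun i _ hi => ?_
        have := congrArg Complex.im hi
        have e : rhoShift (κ : ℂ) i = ((κ * ((n : ℝ) - ((i : ℕ) + 1)) : ℝ) : ℂ) := by
          rw [rhoShift]; push_cast; ring
        rw [e] at this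
        simp at this
      have h4 := mul_right_cancel₀ h3 h2
      have h5 : (1 : ℂ) = 0 := by linear_combination h4
      exact one_ne_zero h5
  funext i
  rw [Pi.add_apply]
  rcases eq_or_ne i j with rfl | hij
  · rw [Pi.single_eq_same, hj]
  · rw [Pi.single_eq_of_ne hij, add_zero]
    exact (key i).resolve_left fun hh => hij hh.1

/-- The ordered product of the `z + fᵢ`, applied to a vector `P`, is a polynomial in `z` with leading
coefficient `P`. -/
theorem exists_coeff_prod_ofFn {V : Type*} [AddCommGroup V] [Module ℂ V] {m : ℕ}
    (f : Fin m → Module.End ℂ V) (P : V) :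
    ∃ v : ℕ → V, v m = P ∧ (∀ i, m < i → v i = 0) ∧
      ∀ z : ℂ, (List.ofFn fun i => z • (1 : Module.End ℂ V) + f i).prod P
        = ∑ i ∈ Finset.range (m + 1), z ^ i • v i := by
  induction m with
  | zero =>
    refine ⟨fun i => if i = 0 then P else 0, by simp, fun i hi => if_neg hi.ne', by simp⟩
  | succ m ih =>
    obtain ⟨v, h1, h2, h3⟩ := ih fun i => f i.succ
    refine ⟨fun i => (if i = 0 then 0 else v (i - 1)) + f 0 (v i), ?_, fun i hi => ?_, fun z => ?_⟩
    · simp [h1, h2 (m + 1) (Nat.lt_succ_self m)]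
    · beta_reduce
      rw [if_neg (by omega), h2 (i - 1) (by omega), h2 i (by omega), map_zero, add_zero]
    · rw [List.ofFn_succ, List.prod_cons, Module.End.mul_apply, h3, LinearMap.add_apply,
        LinearMap.smul_apply, Module.End.one_apply]
      simp only [smul_add, Finset.sum_add_distrib]
      congr 1
      · rw [Finset.sum_range_succ' _ (m + 1), Finset.smul_sum]
        simp [smul_smul, pow_succ']
      · rw [Finset.sum_range_succ _ (m + 1), h2 (m + 1) (Nat.lt_succ_self m), map_zero, smul_zero,
          add_zero, map_sum]
        simp only [map_smul]

/-- Lagrange interpolation: the leading coefficient of a polynomial of degree `m` is a linear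
combination of its values at `m + 1` points. -/
theorem exists_eq_sum_prod_ofFn {V : Type*} [AddCommGroup V] [Module ℂ V] {m : ℕ}
    (f : Fin m → Module.End ℂ V) (P : V) {y : Fin (m + 1) → ℂ} (hy : Function.Injective y) :
    ∃ c : Fin (m + 1) → ℂ,
      P = ∑ j, c j • (List.ofFn fun i => y j • (1 : Module.End ℂ V) + f i).prod P := by
  obtain ⟨v, h1, -, h3⟩ := exists_coeff_prod_ofFn f P
  have hdet : IsUnit (Matrix.vandermonde y).det :=
    isUnit_iff_ne_zero.2 (Matrix.det_vandermonde_ne_zero_iff.2 hy)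
  refine ⟨Matrix.vecMul (Pi.single (Fin.last m) 1) (Matrix.vandermonde y)⁻¹, ?_⟩
  set c := Matrix.vecMul (Pi.single (Fin.last m) 1) (Matrix.vandermonde y)⁻¹ with hc
  have h4 : ∀ i : Fin (m + 1), ∑ j, c j * y j ^ (i : ℕ) = if i = Fin.last m then 1 else 0 := by
    intro i
    have : Matrix.vecMul c (Matrix.vandermonde y) = Pi.single (Fin.last m) 1 := by
      rw [hc, Matrix.vecMul_vecMul, Matrix.nonsing_inv_mul _ hdet, Matrix.vecMul_one]
    have h5 := congrFun this i
    rw [Pi.single_apply] at h5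
    rw [← h5]
    rfl
  simp only [h3, Finset.smul_sum, smul_smul]
  rw [Finset.sum_comm, Finset.sum_range]
  simp only [← Finset.sum_smul, h4]
  rw [Finset.sum_eq_single (Fin.last m)]
  · simp [h1]
  · intro i _ hi
    rw [if_neg hi, zero_smul]
  · simp

/-- The partitions obtained from `μ` by removing one box. -/
def lowerBoxes (μ : Fin n → ℕ) : Set (Fin n → ℕ) :=
  {ν | Antitone ν ∧ ∃ j, ν + Pi.single j 1 = μ}

/-- The operator `E₀ = ∑ ∂ᵢ`. -/
noncomputable def sumDeriv : PolyOp n := ∑ i, derivOp i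

theorem sumDeriv_apply (p : MvPolynomial (Fin n) ℂ) : sumDeriv p = ∑ i, pderiv i p := by
  rw [sumDeriv, LinearMap.sum_apply]
  rfl

theorem permOp_commute_sumDeriv (σ : Equiv.Perm (Fin n)) : Commute (permOp σ) sumDeriv := by
  rw [commute_iff_eq, sumDeriv, Finset.mul_sum, Finset.sum_mul,
    ← Equiv.sum_comp σ (fun i => derivOp i * permOp σ)]
  exact Finset.sum_congr rfl fun i _ => permOp_derivOp σ i

theorem dunkl_apply_symm (k : ℂ) (i : Fin n) {p : MvPolynomial (Fin n) ℂ} (hp : p.IsSymmetric) :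
    dunkl k i p = pderiv i p := by
  rw [dunkl, LinearMap.add_apply, LinearMap.smul_apply, LinearMap.sum_apply,
    Finset.sum_eq_zero fun j _ => divDiff_eq_zero_of_swap (hp _), smul_zero, add_zero,
    derivOp_apply]

theorem sum_permOp_isSymmetric (p : MvPolynomial (Fin n) ℂ) :
    (∑ σ : Equiv.Perm (Fin n), permOp σ p).IsSymmetric := by
  intro τ
  rw [← permOp_apply, map_sum, ← Equiv.sum_comp (Equiv.mulLeft τ) (fun σ => permOp σ p)]
  refine Finset.sum_congr rfl fun σ _ => ?_
  rw [Equiv.coe_mulLeft, permOp_mul, Module.End.mul_apply]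

/-- Up to a factor, `E₀` on symmetric polynomials is the symmetrization of one Dunkl operator. -/
theorem sumDeriv_mem_of_sum_permOp {m : ℕ} (k : ℂ) {p : MvPolynomial (Fin (m + 1)) ℂ}
    (hp : p.IsSymmetric) {S : Submodule ℂ (MvPolynomial (Fin (m + 1)) ℂ)}
    (h : ∑ σ : Equiv.Perm (Fin (m + 1)), permOp σ (dunkl k (Fin.last m) p) ∈ S) :
    sumDeriv p ∈ S := by
  have hE := isSymmetric_of_commute permOp_commute_sumDeriv hp
  have h1 : ∑ σ : Equiv.Perm (Fin (m + 1)), permOp σ (sumDeriv p)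
      = (Fintype.card (Equiv.Perm (Fin (m + 1))) : ℂ) • sumDeriv p := by
    rw [Finset.sum_congr rfl fun σ _ => isSymmetric_iff_permOp.1 hE σ, Finset.sum_const,
      Finset.card_univ, ← Nat.cast_smul_eq_nsmul ℂ]
  have h2 : ∀ i, ∑ σ : Equiv.Perm (Fin (m + 1)), permOp σ (pderiv i p)
      = ∑ σ : Equiv.Perm (Fin (m + 1)), permOp σ (dunkl k (Fin.last m) p) := by
    intro i
    have h3 : pderiv i p = permOp (Equiv.swap (Fin.last m) i) (dunkl k (Fin.last m) p) := by
      rw [← Module.End.mul_apply, permOp_dunkl, Equiv.swap_apply_left, Module.End.mul_apply,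
        permOp_apply, hp, dunkl_apply_symm k i hp]
    rw [h3, ← Equiv.sum_comp (Equiv.mulRight (Equiv.swap (Fin.last m) i))
      (fun σ => permOp σ (dunkl k (Fin.last m) p))]
    refine Finset.sum_congr rfl fun σ _ => ?_
    rw [Equiv.coe_mulRight, permOp_mul, Module.End.mul_apply]
  have h4 : ∑ σ : Equiv.Perm (Fin (m + 1)), permOp σ (sumDeriv p) ∈ S := by
    simp only [sumDeriv_apply, map_sum]
    rw [Finset.sum_comm]
    exact Submodule.sum_mem _ fun i _ => by rw [h2]; exact h
  rw [h1] at h4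
  exact (Submodule.smul_mem_iff _ (Nat.cast_ne_zero.2 Fintype.card_ne_zero)).1 h4

/-- A symmetric joint eigenvector of the symmetric functions of the Cherednik operators, for the
spectral parameters of `μ` lowered by one in the `j`-th place, is proportional to a Jack
polynomial. -/
theorem mem_span_jack_of_shifted {κ : ℝ} (hκ : Irrational κ) {μ : Fin n → ℕ} {j : Fin n}
    {u : MvPolynomial (Fin n) ℂ} (hu : u.IsSymmetric)
    (h : ∀ z : ℂ, (z + (μ j + rhoShift κ j)) • cherednikProd κ z u
      = ((z - 1 + (μ j + rhoShift κ j)) * ∏ i, (z + (μ i + rhoShift κ i))) • u) :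
    u ∈ Submodule.span ℂ (jack κ '' lowerBoxes μ) := by
  have key : ∀ u : MvPolynomial (Fin n) ℂ, u.IsSymmetric →
      (∀ z : ℂ, (z + (μ j + rhoShift κ j)) • cherednikProd κ z u
        = ((z - 1 + (μ j + rhoShift κ j)) * ∏ i, (z + (μ i + rhoShift κ i))) • u) → u ≠ 0 →
      ∃ ν, Antitone ν ∧ cf ν u ≠ 0 ∧ ν + Pi.single j 1 = μ ∧
        ∀ z : ℂ, (z + (μ j + rhoShift κ j)) * ∏ i, (z + (ν i + rhoShift κ i))
          = (z - 1 + (μ j + rhoShift κ j)) * ∏ i, (z + (μ i + rhoShift κ i)) := by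
    intro u hu h h0
    obtain ⟨ν, hν, hc, hQ⟩ := exists_extremal hu h0
    have h2 : ∀ z : ℂ, (z + (μ j + rhoShift κ j)) * ∏ i, (z + (ν i + rhoShift κ i))
          = (z - 1 + (μ j + rhoShift κ j)) * ∏ i, (z + (μ i + rhoShift κ i)) := fun z => by
      have h1 := congrArg (cf ν) (h z)
      rw [map_smul, map_smul, cf_cherednikProd _ z hν hQ, smul_eq_mul, smul_eq_mul,
        ← mul_assoc] at h1
      exact mul_right_cancel₀ hc h1
    exact ⟨ν, hν, hc, add_single_eq_of_spectral hκ h2, h2⟩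
  by_cases h0 : u = 0
  · rw [h0]; exact zero_mem _
  obtain ⟨ν, hν, hc, hνμ, hS2⟩ := key u hu h h0
  have hJ := jackPoly_jack hν fun ρ _ hd => eigD_ne_of_irrational hκ hd
  have hS := hJ.cherednikProd_eq hν fun ρ _ hd => by
    rw [eigC_ofReal, eigC_ofReal, Ne, Complex.ofReal_inj]
    exact eigD_ne_of_irrational hκ hd
  have hz : u - cf ν u • jack κ ν = 0 := by
    by_contra hne
    obtain ⟨ν', hν', hc', hνμ', -⟩ := key _ (isSymmetric_sub hu (isSymmetric_smul _ hJ.symm))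
      (fun z => by
        rw [map_sub, map_smul, hS, smul_sub, h, smul_sub, smul_comm _ (cf ν u),
          smul_smul _ _ (jack κ ν), hS2, smul_comm (cf ν u)]) hne
    obtain rfl := add_right_cancel (hνμ'.trans hνμ.symm)
    rw [map_sub, map_smul, cf_of_sub_mem hν hJ.sub_mem, smul_eq_mul, mul_one, sub_self] at hc'
    exact hc' rfl
  rw [sub_eq_zero.1 hz]
  exact Submodule.smul_mem _ _ (Submodule.subset_span ⟨ν, ⟨hν, j, hνμ⟩, rfl⟩)

/-- For irrational `κ`, the operator `E₀` maps `P_μ` to a combination of the `P_ν` with `ν` obtained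
from `μ` by removing one box. -/
theorem sumDeriv_jack_mem_of_irrational {κ : ℝ} (hκ : Irrational κ) {μ : Fin n → ℕ}
    (hμ : Antitone μ) : sumDeriv (jack κ μ) ∈ Submodule.span ℂ (jack κ '' lowerBoxes μ) := by
  cases n with
  | zero =>
    rw [sumDeriv_apply, Finset.univ_eq_empty, Finset.sum_empty]
    exact zero_mem _
  | succ m =>
    have hJ := jackPoly_jack hμ fun ρ _ hd => eigD_ne_of_irrational hκ hd
    have hS := hJ.cherednikProd_eq hμ fun ρ _ hd => by
      rw [eigC_ofReal, eigC_ofReal, Ne, Complex.ofReal_inj]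
      exact eigD_ne_of_irrational hκ hd
    set P := jack κ μ
    set k : ℂ := (κ : ℂ)
    set x : Fin (m + 1) → ℂ := fun i => μ i + rhoShift k i with hx
    have hxinj : Function.Injective fun j => -x j := by
      intro i j hij
      have h1 : ((μ i : ℤ) : ℂ) + rhoShift k i = ((μ j : ℤ) : ℂ) + rhoShift k j := by
        push_cast
        exact neg_injective hij
      exact (rhoShift_injective hκ h1).1
    obtain ⟨c, hc⟩ := exists_eq_sum_prod_ofFn (fun i : Fin m => cherednik k i.castSucc) P hxinj
    -- the product of all factors but the last one
    set R : ℂ → PolyOp (m + 1) := fun z =>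
      (List.ofFn fun i : Fin m => z • (1 : PolyOp (m + 1)) + cherednik k i.castSucc).prod with hR
    have hRS : ∀ z, cherednikProd k z = R z * (z • 1 + cherednik k (Fin.last m)) := by
      intro z
      rw [cherednikProd, List.ofFn_succ', List.concat_eq_append, List.prod_append,
        List.prod_singleton]
    have hcomm : ∀ z, Commute (cherednik k (Fin.last m)) (R z) := fun z =>
      commute_prod_ofFn_of_forall fun j => commute_smul_one_add z (cherednik_commute k _ _)
    have hcommS : ∀ z w, Commute (cherednikProd k w) (R z) := fun z w =>
      commute_prod_ofFn_of_forall fun j =>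
        commute_smul_one_add z (cherednik_commute_prod k w _).symm
    have hlast : ∀ j, cherednik k (Fin.last m) (R (-x j) P) = x j • R (-x j) P := by
      intro j
      have h1 := hS (-x j)
      rw [Finset.prod_eq_zero (Finset.mem_univ j) (neg_add_cancel _), zero_smul, hRS, mul_add,
        ← (hcomm _).eq, LinearMap.add_apply, mul_smul_comm, mul_one, LinearMap.smul_apply,
        neg_smul, neg_add_eq_zero] at h1
      exact h1.symm
    have hprod : ∀ z j, cherednikProd k z (R (-x j) P)
        = (∏ i, (z + (μ i + rhoShift k i))) • R (-x j) P := by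
      intro z j
      rw [← Module.End.mul_apply, (hcommS _ _).eq, Module.End.mul_apply, hS, map_smul]
    apply sumDeriv_mem_of_sum_permOp k hJ.symm
    rw [hc]
    simp only [map_sum, map_smul]
    rw [Finset.sum_comm]
    refine Submodule.sum_mem _ fun j _ => ?_
    rw [← Finset.smul_sum]
    refine Submodule.smul_mem _ _ (mem_span_jack_of_shifted hκ (j := j)
      (sum_permOp_isSymmetric _) fun z => ?_)
    have h1 := congrArg (fun A : PolyOp (m + 1) => A (R (-x j) P)) (cherednikProd_mul_dunkl k z)
    simp only [Module.End.mul_apply, LinearMap.add_apply, LinearMap.smul_apply,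
      Module.End.one_apply, hlast, hprod, map_smul, ← add_smul, smul_smul] at h1
    rw [map_sum, Finset.smul_sum, Finset.smul_sum]
    refine Finset.sum_congr rfl fun σ _ => ?_
    have h2 : (z + (μ j + rhoShift κ j)) • cherednikProd k z (dunkl k (Fin.last m) (R (-x j) P))
        = ((z - 1 + (μ j + rhoShift κ j)) * ∏ i, (z + (μ i + rhoShift κ i)))
          • dunkl k (Fin.last m) (R (-x j) P) := by
      rw [mul_comm]
      exact h1
    rw [← Module.End.mul_apply (cherednikProd k z), ← (permOp_commute_prod k z σ).eq,
      Module.End.mul_apply, ← map_smul]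
    exact (congrArg (permOp σ) h2).trans (map_smul _ _ _)

/-! ### Continuity in the parameter, and lowering Jack polynomials in general -/

/-- Solutions of linear systems depend continuously on the system where it is nonsingular. -/
theorem exists_tendsto_of_mulVec_eq {ι α : Type*} [Fintype ι] {l : Filter α}
    {M : α → Matrix ι ι ℂ} {M₀ : Matrix ι ι ℂ} {w b : α → ι → ℂ} {b₀ : ι → ℂ}
    (hM : ∀ i j, Tendsto (fun t => M t i j) l (𝓝 (M₀ i j)))
    (hb : ∀ i, Tendsto (fun t => b t i) l (𝓝 (b₀ i)))
    (h : ∀ᶠ t in l, (M t).mulVec (w t) = b t) (hinj : ∀ v, M₀.mulVec v = 0 → v = 0) :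
    ∃ w₀, M₀.mulVec w₀ = b₀ ∧ ∀ i, Tendsto (fun t => w t i) l (𝓝 (w₀ i)) := by
  classical
  have hu : IsUnit M₀ := Matrix.mulVec_injective_iff_isUnit.1
    ((injective_iff_map_eq_zero M₀.mulVecLin).2 hinj)
  have hdet : M₀.det ≠ 0 := ((Matrix.isUnit_iff_isUnit_det _).1 hu).ne_zero
  have hM' : Tendsto M l (𝓝 M₀) := tendsto_pi_nhds.2 fun i => tendsto_pi_nhds.2 fun j => hM i j
  have hd : Tendsto (fun t => (M t).det) l (𝓝 M₀.det) :=
    Tendsto.comp (f := M) (g := Matrix.det) (Continuous.tendsto (by fun_prop) M₀) hM'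
  have ha : Tendsto (fun t => (M t).adjugate) l (𝓝 M₀.adjugate) :=
    Tendsto.comp (f := M) (g := Matrix.adjugate) (Continuous.tendsto (by fun_prop) M₀) hM'
  have hab : ∀ i, Tendsto (fun t => ((M t).adjugate.mulVec (b t)) i) l
      (𝓝 ((M₀.adjugate.mulVec b₀) i)) := fun i =>
    tendsto_finsetSum _ fun j _ =>
      (tendsto_pi_nhds.1 (tendsto_pi_nhds.1 ha i) j).mul (hb j)
  refine ⟨M₀.det⁻¹ • M₀.adjugate.mulVec b₀, ?_, fun i => ?_⟩
  · rw [Matrix.mulVec_smul, Matrix.mulVec_mulVec, Matrix.mul_adjugate, Matrix.smul_mulVec,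
      Matrix.one_mulVec, smul_smul, inv_mul_cancel₀ hdet, one_smul]
  · refine ((hd.inv₀ hdet).mul (hab i)).congr' ?_
    filter_upwards [h, hd.eventually_ne hdet] with t ht hdt
    rw [← ht, Matrix.mulVec_mulVec, Matrix.adjugate_mul, Matrix.smul_mulVec,
      Matrix.one_mulVec, Pi.smul_apply, smul_eq_mul, inv_mul_cancel_left₀ hdt]

noncomputable instance fintypeDomLT (μ : Fin n → ℕ) :
    Fintype {ν : Fin n → ℕ // Antitone ν ∧ DomLT ν μ} :=
  (finite_domLT μ).fintype

theorem eq_sum_of_mem_lowerSpan {μ : Fin n → ℕ} {p : MvPolynomial (Fin n) ℂ}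
    (hp : p ∈ lowerSpan μ) :
    p = ∑ ν : {ν : Fin n → ℕ // Antitone ν ∧ DomLT ν μ}, cf ν.1 p • monSym ν.1 := by
  induction hp using Submodule.span_induction with
  | mem x hx =>
    obtain ⟨ν, hν, rfl⟩ := hx
    rw [Finset.sum_eq_single ⟨ν, hν⟩]
    · rw [cf_monSym_self, one_smul]
    · intro ρ _ hρ
      rw [cf_monSym_of_antitone ρ.2.1 hν.1, if_neg fun h => hρ (Subtype.ext h), zero_smul]
    · exact fun h => absurd (Finset.mem_univ _) h
  | zero => simp
  | add x y _ _ hx hy =>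
    simp only [map_add, add_smul, Finset.sum_add_distrib]
    rw [← hx, ← hy]
  | smul c x _ hx =>
    simp only [map_smul, smul_assoc]
    rw [← Finset.smul_sum, ← hx]

theorem continuous_rhoShift (i : Fin n) : Continuous fun k : ℂ => rhoShift k i :=
  continuous_id.mul continuous_const

theorem continuous_eigC (μ : Fin n → ℕ) : Continuous fun k : ℂ => eigC k μ :=
  continuous_finsetSum _ fun i _ => continuous_const.mul
    (continuous_const.add (continuous_const.mul (continuous_rhoShift i)))

theorem continuous_calogero (φ : MvPolynomial (Fin n) ℂ →ₗ[ℂ] ℂ) (m : ℕ)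
    (p : MvPolynomial (Fin n) ℂ) : Continuous fun k : ℂ => φ (calogero k m p) := by
  simp only [calogero_apply, map_add, map_smul, smul_eq_mul]
  exact continuous_const.add (continuous_id.mul continuous_const)

theorem eigC_ne {κ : ℝ} {ν μ : Fin n → ℕ} (h : eigD κ ν ≠ eigD κ μ) :
    eigC (κ : ℂ) ν ≠ eigC κ μ := by
  rwa [eigC_ofReal, eigC_ofReal, Ne, Complex.ofReal_inj]

/-- Every linear functional of the Jack polynomial `P_μ` is continuous in `κ`, along irrational
parameters, at each parameter for which `P_μ` is separated from the lower eigenvalues. -/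
theorem tendsto_jack {κ₀ : ℝ} {μ : Fin n → ℕ} (hμ : Antitone μ)
    (hsep : ∀ ν, Antitone ν → DomLT ν μ → eigD κ₀ ν ≠ eigD κ₀ μ)
    (φ : MvPolynomial (Fin n) ℂ →ₗ[ℂ] ℂ) :
    Tendsto (fun κ : ℝ => φ (jack κ μ)) (𝓝[{x | Irrational x}] κ₀) (𝓝 (φ (jack κ₀ μ))) := by
  set l := 𝓝[{x | Irrational x}] κ₀
  set T := {ν : Fin n → ℕ // Antitone ν ∧ DomLT ν μ}
  have hJ₀ := jackPoly_jack hμ hsep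
  have hJ : ∀ᶠ κ : ℝ in l, JackPoly κ μ (jack κ μ) :=
    eventually_nhdsWithin_of_forall fun κ hκ =>
      jackPoly_jack hμ fun ν _ hd => eigD_ne_of_irrational hκ hd
  -- the operator `D₂ - d_μ` in the basis of monomial symmetric polynomials
  set A : ℝ → PolyOp n := fun κ => calogero κ 2 - eigC κ μ • 1 with hA
  have hAc : ∀ (ψ : MvPolynomial (Fin n) ℂ →ₗ[ℂ] ℂ) p, Continuous fun κ : ℝ => ψ (A κ p) := by
    intro ψ p
    simp only [hA, LinearMap.sub_apply, LinearMap.smul_apply, Module.End.one_apply, map_sub,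
      map_smul, smul_eq_mul]
    exact ((continuous_calogero ψ 2 p).comp Complex.continuous_ofReal).sub
      (((continuous_eigC μ).comp Complex.continuous_ofReal).mul continuous_const)
  have hexp : ∀ {κ : ℝ}, JackPoly κ μ (jack κ μ) →
      jack κ μ = monSym μ + ∑ ν : T, cf ν.1 (jack κ μ - monSym μ) • monSym ν.1 := by
    intro κ h
    rw [← eq_sum_of_mem_lowerSpan h.sub_mem, add_sub_cancel]
  have heq : ∀ {κ : ℝ}, JackPoly κ μ (jack κ μ) →
      Matrix.mulVec (Matrix.of fun ρ ν : T => cf ρ.1 (A κ (monSym ν.1)))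
        (fun ν : T => cf ν.1 (jack κ μ - monSym μ)) = fun ρ => - cf ρ.1 (A κ (monSym μ)) := by
    intro κ h
    funext ρ
    have h0 : A κ (jack κ μ) = 0 := by
      rw [hA, LinearMap.sub_apply, LinearMap.smul_apply, Module.End.one_apply, h.eig, sub_self]
    rw [hexp h, map_add, map_sum] at h0
    have h1 := congrArg (cf ρ.1) h0
    simp only [map_add, map_sum, map_smul, smul_eq_mul, map_zero] at h1
    rw [eq_neg_iff_add_eq_zero, ← h1, add_comm]
    congr 1
    exact Finset.sum_congr rfl fun ν _ => mul_comm _ _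
  have hstable : ∀ p ∈ lowerSpan μ, A κ₀ p ∈ lowerSpan μ := fun p hp =>
    _root_.sub_mem ((isTriangular_calogero _).map_lowerSpan hμ hp) (Submodule.smul_mem _ _ hp)
  have hinj : ∀ v : T → ℂ, Matrix.mulVec (Matrix.of fun ρ ν : T => cf ρ.1 (A κ₀ (monSym ν.1))) v
      = 0 → v = 0 := by
    intro v hv
    set p := ∑ ν : T, v ν • monSym ν.1 with hp
    have hmem : p ∈ lowerSpan μ := Submodule.sum_mem _ fun ν _ =>
      Submodule.smul_mem _ _ (Submodule.subset_span ⟨ν.1, ν.2, rfl⟩)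
    have h1 : ∀ ρ : T, cf ρ.1 (A κ₀ p) = 0 := by
      intro ρ
      refine Eq.trans ?_ (congrFun hv ρ)
      rw [hp, map_sum, map_sum]
      simp only [map_smul, smul_eq_mul]
      exact Finset.sum_congr rfl fun ν _ => mul_comm _ _
    have h2 : A κ₀ p = 0 := by
      rw [eq_sum_of_mem_lowerSpan (hstable p hmem)]
      exact Finset.sum_eq_zero fun ρ _ => by rw [h1, zero_smul]
    have h3 : p = 0 := eq_zero_of_mem_lowerSpan hμ (fun ν hν hd => eigC_ne (hsep ν hν hd)) hmem
      (sub_eq_zero.1 h2)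
    funext ρ
    have h4 := congrArg (cf ρ.1) h3
    rw [hp, map_sum, map_zero, Finset.sum_eq_single ρ] at h4
    · rwa [map_smul, cf_monSym_self, smul_eq_mul, mul_one] at h4
    · intro ν _ hν
      rw [map_smul, cf_monSym_of_antitone ρ.2.1 ν.2.1, if_neg fun h => hν (Subtype.ext h.symm),
        smul_zero]
    · exact fun h => absurd (Finset.mem_univ _) h
  obtain ⟨w₀, hw₀, hlim⟩ := exists_tendsto_of_mulVec_eq (l := l)
    (M := fun κ => Matrix.of fun ρ ν : T => cf ρ.1 (A κ (monSym ν.1)))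
    (M₀ := Matrix.of fun ρ ν : T => cf ρ.1 (A κ₀ (monSym ν.1)))
    (w := fun κ ν => cf ν.1 (jack κ μ - monSym μ)) (b := fun κ ρ => - cf ρ.1 (A κ (monSym μ)))
    (b₀ := fun ρ => - cf ρ.1 (A κ₀ (monSym μ)))
    (fun ρ ν => ((hAc (cf ρ.1) (monSym ν.1)).tendsto κ₀).mono_left nhdsWithin_le_nhds)
    (fun ρ => (((hAc _ _).tendsto κ₀).mono_left nhdsWithin_le_nhds).neg)
    (hJ.mono fun κ h => heq h) hinj
  have hw : w₀ = fun ν => cf ν.1 (jack κ₀ μ - monSym μ) := by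
    rw [← sub_eq_zero]
    apply hinj
    rw [Matrix.mulVec_sub, hw₀, heq hJ₀, sub_self]
  have hφ : Tendsto (fun κ : ℝ => φ (monSym μ)
      + ∑ ν : T, cf ν.1 (jack κ μ - monSym μ) * φ (monSym ν.1)) l
      (𝓝 (φ (monSym μ) + ∑ ν : T, w₀ ν * φ (monSym ν.1))) :=
    tendsto_const_nhds.add (tendsto_finsetSum _ fun ν _ => (hlim ν).mul_const _)
  have hval : ∀ {κ : ℝ}, JackPoly κ μ (jack κ μ) → φ (monSym μ)
      + ∑ ν : T, cf ν.1 (jack κ μ - monSym μ) * φ (monSym ν.1) = φ (jack κ μ) := by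
    intro κ h
    conv_rhs => rw [hexp h]
    simp only [map_add, map_sum, map_smul, smul_eq_mul]
  rw [hw, hval hJ₀] at hφ
  exact hφ.congr' (hJ.mono fun κ h => hval h)

/-- The Jack polynomials are linearly independent, and the coefficients of a combination of them
are determined by its coefficients at the leading monomials. -/
theorem eq_zero_of_cf_sum_eq_zero {ι : Type*} [Fintype ι] {e : ι → Fin n → ℕ}
    (he : Function.Injective e) (hanti : ∀ i, Antitone (e i)) {P : ι → MvPolynomial (Fin n) ℂ}
    (hP : ∀ i, P i - monSym (e i) ∈ lowerSpan (e i)) {v : ι → ℂ}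
    (h : ∀ i, cf (e i) (∑ j, v j • P j) = 0) : v = 0 := by
  classical
  by_contra hv
  have hne : (Finset.univ.filter fun i => v i ≠ 0).Nonempty := by
    by_contra hemp
    rw [Finset.not_nonempty_iff_eq_empty, Finset.filter_eq_empty_iff] at hemp
    exact hv (funext fun i => not_not.1 (hemp (Finset.mem_univ i)))
  obtain ⟨i, hi, hmax⟩ := Finset.exists_max_image _ (fun i => partialSum (e i)) hne
  have hvi : v i ≠ 0 := (Finset.mem_filter.1 hi).2
  have h1 := h i
  rw [map_sum, Finset.sum_eq_single i, map_smul, cf_of_sub_mem (hanti i) (hP i), smul_eq_mul,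
    mul_one] at h1
  · exact hvi h1
  · intro j _ hj
    rw [map_smul, smul_eq_mul]
    by_contra hne
    have hvj : v j ≠ 0 := left_ne_zero_of_mul hne
    have hm := mem_monSpan.1 (mem_domSet_of_sub_mem (hanti j) (hP j)) (e i)
      (right_ne_zero_of_mul hne)
    rcases eq_or_domLT_of_mem_domSet (hanti j) hm with h2 | h2
    · exact hj (he h2.symm)
    · exact absurd (hmax j (Finset.mem_filter.2 ⟨Finset.mem_univ j, hvj⟩)) h2.partialSum_lt.not_ge
  · exact fun h => absurd (Finset.mem_univ _) h

theorem le_of_mem_lowerBoxes {ν μ : Fin n → ℕ} (h : ν ∈ lowerBoxes μ) : ν ≤ μ := by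
  obtain ⟨-, j, rfl⟩ := h
  exact fun i => Nat.le_add_right _ _

theorem weight_of_mem_lowerBoxes {ν μ : Fin n → ℕ} (h : ν ∈ lowerBoxes μ) :
    weight ν + 1 = weight μ := by
  obtain ⟨-, j, rfl⟩ := h
  simp [weight, Finset.sum_add_distrib]

noncomputable instance fintypeLowerBoxes (μ : Fin n → ℕ) : Fintype (lowerBoxes μ) :=
  ((Set.finite_Iic μ).subset fun _ h => le_of_mem_lowerBoxes h).fintype

theorem exists_sum_of_mem_span_image {V ι : Type*} [AddCommGroup V] [Module ℂ V] {S : Set ι}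
    [Fintype S] {f : ι → V} {x : V} (h : x ∈ Submodule.span ℂ (f '' S)) :
    ∃ c : S → ℂ, x = ∑ i, c i • f i := by
  rw [Set.image_eq_range, Submodule.mem_span_range_iff_exists_fun] at h
  obtain ⟨c, hc⟩ := h
  exact ⟨c, hc.symm⟩

/-- The operator `E₀` maps `P_μ` to a combination of the `P_ν` with `ν` obtained from `μ` by
removing one box, provided that all these Jack polynomials are separated from the lower
eigenvalues: the coefficients have limits as `κ` is approximated by irrational numbers. -/
theorem sumDeriv_jack_mem {κ₀ : ℝ} {μ : Fin n → ℕ} (hμ : Antitone μ)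
    (hsep : ∀ ν, Antitone ν → ν ≤ μ → ∀ ρ, Antitone ρ → DomLT ρ ν → eigD κ₀ ρ ≠ eigD κ₀ ν) :
    sumDeriv (jack κ₀ μ) ∈ Submodule.span ℂ (jack κ₀ '' lowerBoxes μ) := by
  have hne : (𝓝[{x | Irrational x}] κ₀).NeBot :=
    mem_closure_iff_nhdsWithin_neBot.1 (dense_irrational κ₀)
  have hB : ∀ ν : lowerBoxes μ, ∀ φ : MvPolynomial (Fin n) ℂ →ₗ[ℂ] ℂ,
      Tendsto (fun κ : ℝ => φ (jack κ ν.1)) (𝓝[{x | Irrational x}] κ₀) (𝓝 (φ (jack κ₀ ν.1))) :=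
    fun ν φ => tendsto_jack ν.2.1 (hsep ν.1 ν.2.1 (le_of_mem_lowerBoxes ν.2)) φ
  have hD : ∀ φ : MvPolynomial (Fin n) ℂ →ₗ[ℂ] ℂ,
      Tendsto (fun κ : ℝ => φ (sumDeriv (jack κ μ))) (𝓝[{x | Irrational x}] κ₀)
        (𝓝 (φ (sumDeriv (jack κ₀ μ)))) :=
    fun φ => tendsto_jack hμ (hsep μ hμ le_rfl) (φ ∘ₗ sumDeriv)
  have hex : ∀ κ : ℝ, ∃ b : lowerBoxes μ → ℂ, Irrational κ →
      sumDeriv (jack κ μ) = ∑ ν, b ν • jack κ ν.1 := by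
    intro κ
    by_cases hκ : Irrational κ
    · obtain ⟨b, hb⟩ := exists_sum_of_mem_span_image (sumDeriv_jack_mem_of_irrational hκ hμ)
      exact ⟨b, fun _ => hb⟩
    · exact ⟨0, fun h => absurd h hκ⟩
  choose b hb using hex
  have hmv : ∀ (κ : ℝ) (c : lowerBoxes μ → ℂ) (ρ : lowerBoxes μ),
      Matrix.mulVec (Matrix.of fun ρ ν : lowerBoxes μ => cf ρ.1 (jack κ ν.1)) c ρ
        = cf ρ.1 (∑ ν, c ν • jack κ ν.1) := by
    intro κ c ρ
    rw [map_sum]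
    simp only [map_smul, smul_eq_mul]
    exact Finset.sum_congr rfl fun ν _ => mul_comm _ _
  obtain ⟨b₀, -, hlim⟩ := exists_tendsto_of_mulVec_eq (l := 𝓝[{x | Irrational x}] κ₀)
    (M := fun κ => Matrix.of fun ρ ν : lowerBoxes μ => cf ρ.1 (jack κ ν.1))
    (M₀ := Matrix.of fun ρ ν : lowerBoxes μ => cf ρ.1 (jack κ₀ ν.1)) (w := b)
    (b := fun κ ρ => cf ρ.1 (sumDeriv (jack κ μ)))
    (b₀ := fun ρ => cf ρ.1 (sumDeriv (jack κ₀ μ)))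
    (fun ρ ν => hB ν (cf ρ.1)) (fun ρ => hD (cf ρ.1))
    (eventually_nhdsWithin_of_forall fun κ hκ => funext fun ρ => by rw [hmv, ← hb κ hκ])
    (fun v hv => eq_zero_of_cf_sum_eq_zero (e := fun ν : lowerBoxes μ => ν.1)
      (P := fun ν => jack κ₀ ν.1) Subtype.val_injective (fun ν => ν.2.1)
      (fun ν => (jackPoly_jack ν.2.1 (hsep ν.1 ν.2.1 (le_of_mem_lowerBoxes ν.2))).sub_mem)
      fun ρ => by rw [← hmv, hv]; rfl)
  have hfin : sumDeriv (jack κ₀ μ) = ∑ ν, b₀ ν • jack κ₀ ν.1 := by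
    refine poly_ext fun β => tendsto_nhds_unique (hD (cf β)) ?_
    have h1 : Tendsto (fun κ : ℝ => ∑ ν, b κ ν * cf β (jack κ ν.1)) (𝓝[{x | Irrational x}] κ₀)
        (𝓝 (∑ ν, b₀ ν * cf β (jack κ₀ ν.1))) :=
      tendsto_finsetSum _ fun ν _ => (hlim ν).mul (hB ν (cf β))
    simp only [map_sum, map_smul, smul_eq_mul]
    refine h1.congr' (eventually_nhdsWithin_of_forall fun κ hκ => ?_)
    simp only [hb κ hκ, map_sum, map_smul, smul_eq_mul]
  rw [hfin]
  exact Submodule.sum_mem _ fun ν _ =>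
    Submodule.smul_mem _ _ (Submodule.subset_span ⟨ν.1, ν.2, rfl⟩)

/-! ### The perturbed operators and their triangular systems -/

theorem sumDeriv_mul (p q : MvPolynomial (Fin n) ℂ) :
    sumDeriv (p * q) = p * sumDeriv q + q * sumDeriv p := by
  simp only [sumDeriv_apply, Derivation.leibniz, smul_eq_mul, Finset.sum_add_distrib,
    Finset.mul_sum]

theorem sumDeriv_X (i : Fin n) : sumDeriv (X i) = 1 := by
  rw [sumDeriv_apply, Finset.sum_eq_single i]
  · exact pderiv_X_self i
  · exact fun j _ hj => pderiv_X_of_ne hj.symm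
  · simp

theorem pderiv_pderiv_comm (i j : Fin n) (p : MvPolynomial (Fin n) ℂ) :
    pderiv i (pderiv j p) = pderiv j (pderiv i p) := by
  have h : ⁅pderiv (R := ℂ) i, pderiv (R := ℂ) j⁆ = 0 := by
    refine derivation_ext fun m => ?_
    rw [Derivation.commutator_apply, pderiv_X, pderiv_X, Derivation.zero_apply, Pi.single_apply,
      Pi.single_apply]
    split_ifs <;> simp
  have := congrArg (fun D => D p) h
  rw [Derivation.commutator_apply, Derivation.zero_apply] at this
  exact sub_eq_zero.1 this

theorem sumDeriv_pderiv (i : Fin n) (p : MvPolynomial (Fin n) ℂ) :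
    sumDeriv (pderiv i p) = pderiv i (sumDeriv p) := by
  simp only [sumDeriv_apply, map_sum]
  exact Finset.sum_congr rfl fun j _ => pderiv_pderiv_comm j i p

theorem sumDeriv_divDiff (i j : Fin n) (p : MvPolynomial (Fin n) ℂ) :
    sumDeriv (divDiff i j p) = divDiff i j (sumDeriv p) := by
  rcases eq_or_ne i j with rfl | h
  · simp [divDiff_self]
  symm
  apply divDiff_eq_of_mul_eq h
  have h1 := congrArg sumDeriv (X_sub_X_mul_divDiff i j p)
  rw [sumDeriv_mul, map_sub, sumDeriv_X, sumDeriv_X, sub_self, mul_zero, add_zero, map_sub] at h1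
  rw [h1, ← permOp_apply, ← permOp_apply, ← Module.End.mul_apply, ← Module.End.mul_apply,
    (permOp_commute_sumDeriv _).eq]

theorem sumDeriv_X_sq_mul (i : Fin n) (p : MvPolynomial (Fin n) ℂ) :
    sumDeriv (X i ^ 2 * p) = X i ^ 2 * sumDeriv p + (2 : ℂ) • (X i ^ 1 * p) := by
  rw [sumDeriv_mul, pow_two, sumDeriv_mul, sumDeriv_X, smul_eq_C_mul, map_ofNat]
  ring

/-- The commutator of `E₀` and `D₂` is twice the operator `D₁`. -/
theorem sumDeriv_calogero (k : ℂ) (p : MvPolynomial (Fin n) ℂ) :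
    sumDeriv (calogero k 2 p) = calogero k 2 (sumDeriv p) + (2 : ℂ) • calogero k 1 p := by
  simp only [calogero_apply, map_add, map_smul, map_sum, sumDeriv_divDiff, sumDeriv_X_sq_mul,
    sumDeriv_pderiv, Finset.sum_add_distrib, smul_add]
  simp only [← Finset.smul_sum]
  rw [smul_comm k (2 : ℂ)]
  abel

/-- The Euler operator `E₁ = ∑ Xᵢ ∂ᵢ` as a linear operator. -/
noncomputable def eulerOp : PolyOp n := ∑ i, mulX i * derivOp i

theorem eulerOp_apply (p : MvPolynomial (Fin n) ℂ) : eulerOp p = opE1 p := by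
  rw [eulerOp, LinearMap.sum_apply]
  rfl

/-- The operator `D₂ + a E₁ + p D₁ + q E₀`, which for suitable `p`, `q` is `D^B` or `D^{BC}`. -/
noncomputable def besselOp (a k p q : ℂ) : PolyOp n :=
  calogero k 2 + a • eulerOp + p • calogero k 1 + q • sumDeriv

theorem besselOp_apply (a k p q : ℂ) (f : MvPolynomial (Fin n) ℂ) :
    besselOp a k p q f
      = calogero k 2 f + a • opE1 f + p • calogero k 1 f + q • sumDeriv f := by
  rw [← eulerOp_apply]
  rfl

theorem opDB_eq_eval (a κ : ℝ) {f : MvPolynomial (Fin n) ℂ} (hf : f.IsSymmetric)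
    {x : Fin n → ℂ} (hx : Function.Injective x) :
    opDB a κ f x = eval x (besselOp a κ 0 2 f) := by
  rw [besselOp_apply, zero_smul, add_zero, map_add, map_add, eval_calogero _ _ hf hx, smul_eval,
    smul_eval, opE1, sumDeriv_apply, opDB]
  simp only [map_sum, map_mul, eval_X, add_mul, Finset.sum_add_distrib, Finset.mul_sum, mul_assoc]
  ring

/-- The partitions strictly contained in `l`. -/
abbrev Below (l : Fin n → ℕ) : Type := {μ : Fin n → ℕ // Antitone μ ∧ μ < l}

noncomputable instance fintypeBelow (l : Fin n → ℕ) : Fintype (Below l) :=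
  ((Set.finite_Iic l).subset fun _ h => h.2.le : {μ : Fin n → ℕ | Antitone μ ∧ μ < l}.Finite).fintype

/-- `g μ ν` are the coefficients of `E₀ P_μ` along the Jack polynomials `P_ν`. -/
def IsLowering (κ : ℝ) (l : Fin n → ℕ) (g : (Fin n → ℕ) → Below l → ℂ) : Prop :=
  ∀ μ, Antitone μ → μ ≤ l → sumDeriv (jack κ μ) = ∑ ν, g μ ν • jack κ ν.1 ∧
    ∀ ν, g μ ν ≠ 0 → weight ν.1 + 1 = weight μ

/-- All Jack polynomials `P_μ` with `μ ⊆ l` are separated from the lower eigenvalues. -/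
def Separated (κ : ℝ) (l : Fin n → ℕ) : Prop :=
  ∀ μ, Antitone μ → μ ≤ l → ∀ ν, Antitone ν → DomLT ν μ → eigD κ ν ≠ eigD κ μ

theorem Separated.jackPoly {κ : ℝ} {l : Fin n → ℕ} (h : Separated κ l) {μ : Fin n → ℕ}
    (hμ : Antitone μ) (hle : μ ≤ l) : JackPoly κ μ (jack κ μ) :=
  jackPoly_jack hμ (h μ hμ hle)

theorem Separated.exists_isLowering {κ : ℝ} {l : Fin n → ℕ} (h : Separated κ l) :
    ∃ g, IsLowering κ l g := by
  have key : ∀ μ : Fin n → ℕ, ∃ g : Below l → ℂ, Antitone μ → μ ≤ l →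
      sumDeriv (jack κ μ) = ∑ ν, g ν • jack κ ν.1 ∧ ∀ ν, g ν ≠ 0 → weight ν.1 + 1 = weight μ := by
    intro μ
    by_cases hμ : Antitone μ ∧ μ ≤ l
    · obtain ⟨c, hc⟩ := exists_sum_of_mem_span_image (sumDeriv_jack_mem hμ.1
        fun ν hν hle => h ν hν (hle.trans hμ.2))
      have hbelow : ∀ ν : lowerBoxes μ, Antitone ν.1 ∧ ν.1 < l := fun ν =>
        ⟨ν.2.1, lt_of_le_of_ne ((le_of_mem_lowerBoxes ν.2).trans hμ.2) fun he => by
          have h1 := weight_of_mem_lowerBoxes ν.2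
          have h2 : μ = l := le_antisymm hμ.2 (he ▸ le_of_mem_lowerBoxes ν.2)
          have h3 := congrArg weight h2
          have h4 := congrArg weight he
          omega⟩
      classical
      refine ⟨fun ν => if hν : ν.1 ∈ lowerBoxes μ then c ⟨ν.1, hν⟩ else 0, fun _ _ => ⟨?_, ?_⟩⟩
      · rw [hc]
        refine Finset.sum_of_injOn (fun ν : lowerBoxes μ => (⟨ν.1, hbelow ν⟩ : Below l)) ?_ ?_ ?_ ?_
        · intro ν _ ρ _ he
          exact Subtype.ext (congrArg (fun x : Below l => x.1) he)
        · intro ν _; exact Finset.mem_coe.2 (Finset.mem_univ _)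
        · intro ν _ hν
          beta_reduce
          rw [dif_neg, zero_smul]
          intro hm
          exact hν ⟨⟨ν.1, hm⟩, Finset.mem_coe.2 (Finset.mem_univ _), rfl⟩
        · intro ν _
          beta_reduce
          rw [dif_pos ν.2]
      · intro ν hν
        by_cases hm : ν.1 ∈ lowerBoxes μ
        · exact weight_of_mem_lowerBoxes hm
        · exact absurd (dif_neg hm) hν
    · exact ⟨0, fun h1 h2 => absurd ⟨h1, h2⟩ hμ⟩
  choose g hg using key
  exact ⟨g, hg⟩

/-- The polynomial `P_l + ∑_{μ ⊂ l} u_μ P_μ`. -/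
noncomputable def jackSum (κ : ℝ) (l : Fin n → ℕ) (u : Below l → ℂ) : MvPolynomial (Fin n) ℂ :=
  jack κ l + ∑ μ, u μ • jack κ μ.1

/-- The eigenvalue `e_μ` as a complex number. -/
noncomputable def eigE (a k : ℂ) (μ : Fin n → ℕ) : ℂ := eigC k μ + a * weight μ

/-- The coefficient of `P_ν` in `(p D₁ + q E₀) P_μ`, in terms of that in `E₀ P_μ`. -/
noncomputable def lowerCoeff {l : Fin n → ℕ} (g : (Fin n → ℕ) → Below l → ℂ) (k p q : ℂ)
    (μ : Fin n → ℕ) (ν : Below l) : ℂ :=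
  (p * ((eigC k μ - eigC k ν.1) / 2) + q) * g μ ν

open Classical in
/-- The matrix of the system for the coefficients of an eigenvector with leading term `P_l`. -/
noncomputable def sysMatrix {l : Fin n → ℕ} (g : (Fin n → ℕ) → Below l → ℂ) (a k p q : ℂ) :
    Matrix (Below l) (Below l) ℂ :=
  Matrix.of fun ν μ => (if ν = μ then eigE a k μ.1 - eigE a k l else 0) + lowerCoeff g k p q μ.1 ν

theorem sysMatrix_mulVec {l : Fin n → ℕ} (g : (Fin n → ℕ) → Below l → ℂ) (a k p q : ℂ)
    (u : Below l → ℂ) (ν : Below l) : (sysMatrix g a k p q).mulVec u ν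
      = (eigE a k ν.1 - eigE a k l) * u ν + ∑ μ, lowerCoeff g k p q μ.1 ν * u μ := by
  simp only [sysMatrix, Matrix.mulVec, dotProduct, Matrix.of_apply, add_mul,
    Finset.sum_add_distrib, ite_mul, zero_mul, Finset.sum_ite_eq, Finset.mem_univ, if_true]

theorem besselOp_jack {κ : ℝ} {l : Fin n → ℕ} (hs : Separated κ l)
    {g : (Fin n → ℕ) → Below l → ℂ} (hg : IsLowering κ l g) (a p q : ℂ) {μ : Fin n → ℕ}
    (hμ : Antitone μ) (hle : μ ≤ l) : besselOp a κ p q (jack κ μ)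
      = eigE a κ μ • jack κ μ + ∑ ν, lowerCoeff g κ p q μ ν • jack κ ν.1 := by
  have hJ := hs.jackPoly hμ hle
  have h0 := (hg μ hμ hle).1
  have h1 : calogero (κ : ℂ) 1 (jack κ μ)
      = ∑ ν, ((eigC κ μ - eigC κ ν.1) / 2 * g μ ν) • jack κ ν.1 := by
    have h2 := sumDeriv_calogero (κ : ℂ) (jack κ μ)
    rw [hJ.eig, map_smul, h0, map_sum] at h2
    have h3 : ∀ ν : Below l, calogero (κ : ℂ) 2 (g μ ν • jack κ ν.1)
        = (eigC κ ν.1 * g μ ν) • jack κ ν.1 := fun ν => by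
      rw [map_smul, (hs.jackPoly ν.2.1 ν.2.2.le).eig, smul_smul, mul_comm]
    rw [Finset.sum_congr rfl fun ν _ => h3 ν, ← sub_eq_iff_eq_add', Finset.smul_sum,
      ← Finset.sum_sub_distrib] at h2
    rw [← smul_right_injective _ (two_ne_zero (α := ℂ)) |>.eq_iff, ← h2, Finset.smul_sum]
    refine Finset.sum_congr rfl fun ν _ => ?_
    rw [smul_smul, smul_smul, ← sub_smul]
    congr 1
    ring
  rw [besselOp_apply, hJ.eig, hJ.opE1 hμ, h0, h1, smul_smul, ← add_smul, eigE, add_assoc,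
    Finset.smul_sum, Finset.smul_sum, ← Finset.sum_add_distrib]
  congr 1
  refine Finset.sum_congr rfl fun ν _ => ?_
  rw [smul_smul, smul_smul, ← add_smul, lowerCoeff]
  congr 1
  ring

theorem jack_independent {κ : ℝ} {l : Fin n → ℕ} (hl : Antitone l) (hs : Separated κ l) {c : ℂ}
    {v : Below l → ℂ} (h : c • jack κ l + ∑ ν, v ν • jack κ ν.1 = 0) : c = 0 ∧ v = 0 := by
  have hi : Function.Injective (fun o : Option (Below l) => o.elim l fun ν => ν.1) := by
    rintro (_ | μ) (_ | ν) he
    · rfl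
    · exact absurd he.symm ν.2.2.ne
    · exact absurd he μ.2.2.ne
    · exact congrArg some (Subtype.ext he)
  have h1 := eq_zero_of_cf_sum_eq_zero hi (P := fun o => o.elim (jack κ l) fun ν => jack κ ν.1)
    (v := fun o => o.elim c v) (by rintro (_ | ν); exacts [hl, ν.2.1])
    (by rintro (_ | ν); exacts [(hs.jackPoly hl le_rfl).sub_mem,
      (hs.jackPoly ν.2.1 ν.2.2.le).sub_mem])
    (fun i => by rw [Fintype.sum_option]; simp only [Option.elim]; rw [h, map_zero])
  exact ⟨congrFun h1 none, funext fun ν => congrFun h1 (some ν)⟩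

/-- The eigenvalue equation with leading term `P_l` is a linear system for the coefficients. -/
theorem besselOp_jackSum_eq_iff {κ : ℝ} {l : Fin n → ℕ} (hl : Antitone l) (hs : Separated κ l)
    {g : (Fin n → ℕ) → Below l → ℂ} (hg : IsLowering κ l g) (a p q c : ℂ) (u : Below l → ℂ) :
    besselOp a κ p q (jackSum κ l u) = c • jackSum κ l u ↔ c = eigE a κ l ∧
      (sysMatrix g a κ p q).mulVec u = fun ν => - lowerCoeff g κ p q l ν := by
  have h1 : besselOp a κ p q (jackSum κ l u) - c • jackSum κ l u
      = (eigE a κ l - c) • jack κ l + ∑ ν, ((eigE a κ ν.1 - c) * u ν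
        + ∑ μ, lowerCoeff g κ p q μ.1 ν * u μ + lowerCoeff g κ p q l ν) • jack κ ν.1 := by
    have h2 : ∑ μ : Below l, u μ • besselOp a κ p q (jack κ μ.1)
        = ∑ ν : Below l, (eigE a κ ν.1 * u ν
          + ∑ μ, lowerCoeff g κ p q μ.1 ν * u μ) • jack κ ν.1 := by
      simp only [add_smul, Finset.sum_add_distrib, Finset.sum_smul]
      rw [Finset.sum_comm (f := fun ν μ : Below l => (lowerCoeff g κ p q μ.1 ν * u μ) • jack κ ν.1),
        ← Finset.sum_add_distrib]
      refine Finset.sum_congr rfl fun μ _ => ?_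
      rw [besselOp_jack hs hg a p q μ.2.1 μ.2.2.le, smul_add, smul_smul, Finset.smul_sum, mul_comm]
      congr 1
      refine Finset.sum_congr rfl fun ν _ => ?_
      rw [smul_smul, mul_comm]
    rw [jackSum, map_add, map_sum]
    simp only [map_smul]
    rw [h2, besselOp_jack hs hg a p q hl le_rfl, smul_add, Finset.smul_sum]
    simp only [add_smul, sub_mul, sub_smul, smul_smul, Finset.sum_add_distrib,
      Finset.sum_sub_distrib]
    abel
  rw [← sub_eq_zero, h1]
  constructor
  · intro h
    obtain ⟨h2, h3⟩ := jack_independent hl hs h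
    obtain rfl := sub_eq_zero.1 h2
    refine ⟨rfl, funext fun ν => ?_⟩
    rw [sysMatrix_mulVec]
    exact eq_neg_of_add_eq_zero_left (congrFun h3 ν)
  · rintro ⟨rfl, h⟩
    rw [sub_self, zero_smul, zero_add]
    refine Finset.sum_eq_zero fun ν _ => ?_
    have h2 := congrFun h ν
    rw [sysMatrix_mulVec] at h2
    rw [h2, neg_add_cancel, zero_smul]

/-- The system is triangular for the weight, with diagonal entries `e_μ - e_l`. -/
theorem sysMatrix_injective {κ : ℝ} {l : Fin n → ℕ}
    {g : (Fin n → ℕ) → Below l → ℂ} (hg : IsLowering κ l g) {a : ℂ} (p q : ℂ)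
    (he : ∀ μ : Below l, eigE a κ μ.1 ≠ eigE a κ l) (v : Below l → ℂ)
    (hv : (sysMatrix g a κ p q).mulVec v = 0) : v = 0 := by
  classical
  by_contra hne0
  have hne : (Finset.univ.filter fun i => v i ≠ 0).Nonempty := by
    by_contra hemp
    rw [Finset.not_nonempty_iff_eq_empty, Finset.filter_eq_empty_iff] at hemp
    exact hne0 (funext fun i => not_not.1 (hemp (Finset.mem_univ i)))
  obtain ⟨ν, hν, hmax⟩ := Finset.exists_max_image _ (fun μ : Below l => weight μ.1) hne
  have h1 := congrFun hv ν
  rw [sysMatrix_mulVec, Finset.sum_eq_zero, add_zero, Pi.zero_apply] at h1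
  · exact (mul_ne_zero (sub_ne_zero.2 (he ν)) (Finset.mem_filter.1 hν).2) h1
  · intro μ _
    by_contra h2
    have h3 := (hg μ.1 μ.2.1 μ.2.2.le).2 ν (right_ne_zero_of_mul (left_ne_zero_of_mul h2))
    have h4 := hmax μ (Finset.mem_filter.2 ⟨Finset.mem_univ μ, right_ne_zero_of_mul h2⟩)
    omega

theorem existsUnique_sys {κ : ℝ} {l : Fin n → ℕ}
    {g : (Fin n → ℕ) → Below l → ℂ} (hg : IsLowering κ l g) {a : ℂ} (p q : ℂ)
    (he : ∀ μ : Below l, eigE a κ μ.1 ≠ eigE a κ l) (b : Below l → ℂ) :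
    ∃! u, (sysMatrix g a κ p q).mulVec u = b := by
  have hinj : Function.Injective (sysMatrix g a κ p q).mulVecLin :=
    (injective_iff_map_eq_zero _).2 (sysMatrix_injective hg p q he)
  obtain ⟨u, hu⟩ := LinearMap.injective_iff_surjective.1 hinj b
  exact ⟨u, hu, fun u' hu' => hinj (hu'.trans hu.symm)⟩

/-- Rescaling the variables by `s` multiplies `D₁` and `E₀` by `s`. -/
theorem sys_scale {κ : ℝ} {l : Fin n → ℕ} (hl : Antitone l)
    {g : (Fin n → ℕ) → Below l → ℂ} (hg : IsLowering κ l g) {a p q : ℂ} (s : ℂ) {v : Below l → ℂ}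
    (hv : (sysMatrix g a κ p q).mulVec v = fun ν => - lowerCoeff g κ p q l ν) :
    (sysMatrix g a κ (s * p) (s * q)).mulVec (fun μ => s ^ (weight l - weight μ.1) * v μ)
      = fun ν => - lowerCoeff g κ (s * p) (s * q) l ν := by
  have hw : ∀ μ : Below l, weight μ.1 ≤ weight l := fun μ =>
    Finset.sum_le_sum fun i _ => μ.2.2.le i
  funext ν
  have h1 := congrFun hv ν
  rw [sysMatrix_mulVec] at h1 ⊢
  have h2 : ∀ μ : Below l, lowerCoeff g κ (s * p) (s * q) μ.1 ν
      * (s ^ (weight l - weight μ.1) * v μ)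
      = s ^ (weight l - weight ν.1) * (lowerCoeff g κ p q μ.1 ν * v μ) := by
    intro μ
    by_cases h0 : g μ.1 ν = 0
    · simp [lowerCoeff, h0]
    · have h3 := (hg μ.1 μ.2.1 μ.2.2.le).2 ν h0
      have h4 := hw μ
      rw [show weight l - weight ν.1 = weight l - weight μ.1 + 1 by omega, pow_succ]
      simp only [lowerCoeff]
      ring
  have h5 : lowerCoeff g κ (s * p) (s * q) l ν
      = s ^ (weight l - weight ν.1) * lowerCoeff g κ p q l ν := by
    by_cases h0 : g l ν = 0
    · simp [lowerCoeff, h0]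
    · have h3 := (hg l hl le_rfl).2 ν h0
      rw [show weight l - weight ν.1 = 1 by omega, pow_one]
      simp only [lowerCoeff]
      ring
  rw [Finset.sum_congr rfl fun μ _ => h2 μ, ← Finset.mul_sum, h5]
  linear_combination s ^ (weight l - weight ν.1) * h1

/-! ### The operator `D^{BC}` in the coordinates `t = -sinh²(z/2)` -/

/-- The function `z ↦ G(t(z))` with `tᵢ = -sinh²(zᵢ/2)`. -/
noncomputable def evalT (G : MvPolynomial (Fin n) ℂ) (z : Fin n → ℂ) : ℂ :=
  eval (fun i => -Complex.sinh (z i / 2) ^ 2) G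

theorem neg_sinh_half_sq (w : ℂ) : -Complex.sinh (w / 2) ^ 2 = (1 - Complex.cosh w) / 2 := by
  have h1 := Complex.cosh_two_mul (w / 2)
  have h2 := Complex.cosh_sq (w / 2)
  rw [mul_div_cancel₀ w two_ne_zero] at h1
  rw [h1, h2]
  ring

theorem cosh_sub_cosh (x y : ℂ) : Complex.cosh x - Complex.cosh y
    = 2 * Complex.sinh ((x + y) / 2) * Complex.sinh ((x - y) / 2) := by
  have h1 := Complex.cosh_add ((x + y) / 2) ((x - y) / 2)
  have h2 := Complex.cosh_sub ((x + y) / 2) ((x - y) / 2)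
  rw [show (x + y) / 2 + (x - y) / 2 = x by ring] at h1
  rw [show (x + y) / 2 - (x - y) / 2 = y by ring] at h2
  rw [h1, h2]
  ring

theorem sinh_add_sinh (x y : ℂ) : Complex.sinh x + Complex.sinh y
    = 2 * Complex.sinh ((x + y) / 2) * Complex.cosh ((x - y) / 2) := by
  have h1 := Complex.sinh_add ((x + y) / 2) ((x - y) / 2)
  have h2 := Complex.sinh_sub ((x + y) / 2) ((x - y) / 2)
  rw [show (x + y) / 2 + (x - y) / 2 = x by ring] at h1
  rw [show (x + y) / 2 - (x - y) / 2 = y by ring] at h2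
  rw [h1, h2]
  ring

theorem coth_half_sub {x y : ℂ} (h1 : Complex.sinh ((x - y) / 2) ≠ 0)
    (h2 : Complex.sinh ((x + y) / 2) ≠ 0) : coth ((x - y) / 2)
      = (Complex.sinh x + Complex.sinh y) / (Complex.cosh x - Complex.cosh y) := by
  rw [cosh_sub_cosh, sinh_add_sinh, coth]
  field_simp

theorem coth_half_add {x y : ℂ} (h1 : Complex.sinh ((x - y) / 2) ≠ 0)
    (h2 : Complex.sinh ((x + y) / 2) ≠ 0) : coth ((x + y) / 2)
      = (Complex.sinh x - Complex.sinh y) / (Complex.cosh x - Complex.cosh y) := by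
  have h := coth_half_sub (x := x) (y := -y) (by rwa [sub_neg_eq_add]) (by rwa [← sub_eq_add_neg])
  rwa [sub_neg_eq_add, Complex.sinh_neg, Complex.cosh_neg, ← sub_eq_add_neg] at h

theorem coth_half_mul_sinh {w : ℂ} (h : Complex.sinh w ≠ 0) :
    coth (w / 2) * Complex.sinh w = 1 + Complex.cosh w := by
  have h1 := Complex.cosh_two_mul (w / 2)
  have h2 := Complex.cosh_sq (w / 2)
  have h3 := Complex.sinh_two_mul (w / 2)
  rw [mul_div_cancel₀ w two_ne_zero] at h1 h3
  have h4 : Complex.sinh (w / 2) ≠ 0 := fun h0 => h (by rw [h3, h0]; ring)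
  rw [h3, h1, coth]
  field_simp
  rw [h2]
  ring

theorem hasDerivAt_neg_sinh_half_sq (w : ℂ) :
    HasDerivAt (fun s : ℂ => -Complex.sinh (s / 2) ^ 2) (-Complex.sinh w / 2) w := by
  simp only [neg_sinh_half_sq]
  exact ((Complex.hasDerivAt_cosh w).const_sub 1).div_const 2

theorem hasDerivAt_evalT (G : MvPolynomial (Fin n) ℂ) (i : Fin n) (z : Fin n → ℂ) :
    HasDerivAt (fun s : ℂ => evalT G (Function.update z i s))
      (-Complex.sinh (z i) / 2 * evalT (pderiv i G) z) (z i) := by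
  induction G using MvPolynomial.induction_on with
  | C c => simpa [evalT] using hasDerivAt_const (z i) c
  | add p q hp hq =>
    have h := hp.add hq
    simp only [evalT, map_add, mul_add] at h ⊢
    exact h
  | mul_X p j hp =>
    have hX : HasDerivAt (fun s : ℂ => -Complex.sinh (Function.update z i s j / 2) ^ 2)
        (-Complex.sinh (z i) / 2 * evalT (pderiv i (X j)) z) (z i) := by
      rcases eq_or_ne j i with rfl | h
      · simpa [evalT] using hasDerivAt_neg_sinh_half_sq (z j)
      · simpa [evalT, pderiv_X_of_ne h, Function.update_of_ne h] using
          hasDerivAt_const (z i) (-Complex.sinh (z j / 2) ^ 2)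
    have h := hp.mul hX
    simp only [Function.update_eq_self] at h
    simp only [evalT, map_mul, eval_X, Derivation.leibniz, smul_eq_mul, map_add] at h ⊢
    refine h.congr_deriv ?_
    ring

theorem partialD_evalT (G : MvPolynomial (Fin n) ℂ) (i : Fin n) :
    partialD i (evalT G) = fun z => -Complex.sinh (z i) / 2 * evalT (pderiv i G) z :=
  funext fun z => (hasDerivAt_evalT G i z).deriv

theorem partialD_partialD_evalT (G : MvPolynomial (Fin n) ℂ) (i : Fin n) (z : Fin n → ℂ) :
    partialD i (partialD i (evalT G)) z
      = -Complex.cosh (z i) / 2 * evalT (pderiv i G) z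
        + Complex.sinh (z i) ^ 2 / 4 * evalT (pderiv i (pderiv i G)) z := by
  rw [partialD_evalT, partialD]
  have h1 : HasDerivAt (fun s : ℂ => -Complex.sinh s / 2) (-Complex.cosh (z i) / 2) (z i) :=
    (Complex.hasDerivAt_sinh (z i)).neg.div_const 2
  have h := h1.mul (hasDerivAt_evalT (pderiv i G) i z)
  simp only [Function.update_self]
  rw [Function.update_eq_self] at h
  refine h.deriv.trans ?_
  ring

theorem IsRegular.injective {z : Fin n → ℂ} (hz : IsRegular z) :
    Function.Injective fun i => -Complex.sinh (z i / 2) ^ 2 := by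
  intro i j hij
  by_contra hne
  simp only [neg_sinh_half_sq] at hij
  have h1 : Complex.cosh (z i) - Complex.cosh (z j) = 0 := by linear_combination -2 * hij
  rw [cosh_sub_cosh] at h1
  exact mul_ne_zero (mul_ne_zero two_ne_zero (hz.2 i j hne).2) (hz.2 i j hne).1 h1

theorem exists_isRegular {x : Fin n → ℂ} (hx : Function.Injective x)
    (h01 : ∀ i, x i ≠ 0 ∧ x i ≠ 1) :
    ∃ z, IsRegular z ∧ (fun i => -Complex.sinh (z i / 2) ^ 2) = x := by
  have hex : ∀ i, ∃ w, Complex.cosh w = 1 - 2 * x i := fun i => by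
    obtain ⟨w, hw⟩ := Complex.cos_surjective (1 - 2 * x i)
    exact ⟨w * Complex.I, by rw [Complex.cosh_mul_I, hw]⟩
  choose z hz using hex
  refine ⟨z, ⟨fun i h0 => ?_, fun i j hij => ?_⟩, funext fun i => ?_⟩
  · have h1 := Complex.cosh_sq (z i)
    rw [h0, hz] at h1
    have h2 : x i * (x i - 1) = 0 := by linear_combination h1 / 4
    exact mul_ne_zero (h01 i).1 (sub_ne_zero.2 (h01 i).2) h2
  · have h1 := cosh_sub_cosh (z i) (z j)
    have h2 : Complex.cosh (z i) - Complex.cosh (z j) ≠ 0 := fun h0 =>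
      hij (hx (by rw [hz, hz] at h0; linear_combination -h0 / 2))
    rw [h1] at h2
    exact ⟨right_ne_zero_of_mul h2, right_ne_zero_of_mul (left_ne_zero_of_mul h2)⟩
  · rw [neg_sinh_half_sq, hz]
    ring

/-- In the coordinates `t`, the operator `D^{BC}` is
`D₂ + (1 + k₁ + 2k₂) E₁ - D₁ - (1/2 + k₁ + k₂) E₀`. -/
theorem opDBC_evalT (k₁ k₂ k₃ : ℝ) {G : MvPolynomial (Fin n) ℂ} (hG : G.IsSymmetric)
    {z : Fin n → ℂ} (hz : IsRegular z) : opDBC k₁ k₂ k₃ (evalT G) z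
      = evalT (besselOp (1 + k₁ + 2 * k₂) k₃ (-1) (-(1 / 2 + k₁ + k₂)) G) z := by
  set x : Fin n → ℂ := fun i => -Complex.sinh (z i / 2) ^ 2 with hx
  have hC : ∀ i, Complex.cosh (z i) = 1 - 2 * x i := fun i => by
    rw [hx]; simp only [neg_sinh_half_sq]; ring
  have hS : ∀ i, Complex.sinh (z i) ^ 2 = 4 * (x i ^ 2 - x i) := fun i => by
    have h := Complex.cosh_sq (z i)
    rw [hC] at h
    linear_combination -h
  have hinj : Function.Injective x := hz.injective
  have hdef : ∀ p : MvPolynomial (Fin n) ℂ, evalT p z = eval x p := fun _ => rfl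
  have hpair : ∑ i, ∑ j ∈ Finset.Ioi i,
      (coth ((z i - z j) / 2) * (partialD i (evalT G) z - partialD j (evalT G) z) +
        coth ((z i + z j) / 2) * (partialD i (evalT G) z + partialD j (evalT G) z))
      = ∑ i, ∑ j ∈ Finset.univ.erase i,
        2 * (x i ^ 2 / (x i - x j) - x i ^ 1 / (x i - x j)) * eval x (pderiv i G) := by
    have h := Finset.sum_sum_Ioi_add_eq_sum_sum_off_diag fun j i =>
      2 * (x i ^ 2 / (x i - x j) - x i ^ 1 / (x i - x j)) * eval x (pderiv i G)
    simp only [Finset.compl_singleton] at h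
    rw [← h]
    refine Finset.sum_congr rfl fun i _ => Finset.sum_congr rfl fun j hj => ?_
    have hij : i ≠ j := (Finset.mem_Ioi.1 hj).ne
    rw [coth_half_sub (hz.2 i j hij).1 (hz.2 i j hij).2,
      coth_half_add (hz.2 i j hij).1 (hz.2 i j hij).2]
    simp only [partialD_evalT, hdef, hC]
    have h1 : x i - x j ≠ 0 := sub_ne_zero.2 (hinj.ne hij)
    have h2 : x j - x i ≠ 0 := sub_ne_zero.2 (hinj.ne hij.symm)
    have h3 : 1 - 2 * x i - (1 - 2 * x j) = -2 * (x i - x j) := by ring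
    rw [h3, ← neg_sub (x i) (x j), div_neg, div_neg]
    field_simp
    linear_combination 2 * eval x (pderiv i G) * hS i - 2 * eval x (pderiv j G) * hS j
  rw [opDBC, hpair, hdef, besselOp_apply]
  simp only [map_add, smul_eval]
  rw [eval_calogero _ _ hG hinj, eval_calogero _ _ hG hinj, opE1, sumDeriv_apply]
  have h1 : ∀ i, partialD i (partialD i (evalT G)) z
      + ((k₁ : ℂ) * coth (z i / 2) + 2 * (k₂ : ℂ) * coth (z i)) * partialD i (evalT G) z
      = (x i ^ 2 - x i ^ 1) * eval x (pderiv i (pderiv i G))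
        + ((1 + k₁ + 2 * k₂) * x i - (1 / 2 + k₁ + k₂)) * eval x (pderiv i G) := by
    intro i
    rw [partialD_partialD_evalT]
    simp only [partialD_evalT, hdef]
    have h2 := coth_half_mul_sinh (hz.1 i)
    have h3 : coth (z i) * Complex.sinh (z i) = Complex.cosh (z i) :=
      div_mul_cancel₀ _ (hz.1 i)
    rw [hC] at h2 h3 ⊢
    linear_combination eval x (pderiv i (pderiv i G)) / 4 * hS i
      - k₁ * eval x (pderiv i G) / 2 * h2 - k₂ * eval x (pderiv i G) * h3
  rw [← Finset.sum_add_distrib, Finset.sum_congr rfl fun i _ => h1 i]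
  simp only [map_sum, map_mul, eval_X, add_mul, sub_mul, mul_sub, Finset.sum_add_distrib,
    Finset.sum_sub_distrib, mul_assoc, ← Finset.mul_sum]
  ring

/-! ### Bessel and Jacobi polynomials as solutions of linear systems -/

theorem mem_span_below_iff {V : Type*} [AddCommGroup V] [Module ℂ V] {l : Fin n → ℕ}
    {f : (Fin n → ℕ) → V} {x : V} :
    x ∈ Submodule.span ℂ (f '' {μ | Antitone μ ∧ μ < l}) ↔
      ∃ c : Below l → ℂ, x = ∑ μ, c μ • f μ.1 := by
  refine ⟨fun h => ?_, ?_⟩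
  · have : Fintype {μ : Fin n → ℕ | Antitone μ ∧ μ < l} := fintypeBelow l
    obtain ⟨c, hc⟩ := exists_sum_of_mem_span_image h
    refine ⟨c, hc.trans ?_⟩
    congr!
  · rintro ⟨c, rfl⟩
    exact Submodule.sum_mem _ fun μ _ =>
      Submodule.smul_mem _ _ (Submodule.subset_span ⟨μ.1, μ.2, rfl⟩)

theorem jackSum_isSymmetric {κ : ℝ} {l : Fin n → ℕ} (hl : Antitone l) (hs : Separated κ l)
    (u : Below l → ℂ) : (jackSum κ l u).IsSymmetric :=
  isSymmetric_add (hs.jackPoly hl le_rfl).symm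
    (Finset.sum_induction _ _ (fun _ _ => isSymmetric_add) (fun _ => map_zero _)
      fun μ _ => isSymmetric_smul _ (hs.jackPoly μ.2.1 μ.2.2.le).symm)

theorem isBessel_iff {a κ : ℝ} {l : Fin n → ℕ} (hl : Antitone l) (hs : Separated κ l)
    {g : (Fin n → ℕ) → Below l → ℂ} (hg : IsLowering κ l g) (Y : MvPolynomial (Fin n) ℂ) :
    IsBessel a κ l Y ↔ ∃ u, (sysMatrix g a κ 0 2).mulVec u = (fun ν => - lowerCoeff g κ 0 2 l ν) ∧
      Y = jackSum κ l u := by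
  constructor
  · rintro ⟨-, h1, c, hc⟩
    obtain ⟨u, hu⟩ := mem_span_below_iff.1 h1
    obtain rfl : Y = jackSum κ l u := by rw [jackSum, ← hu, add_sub_cancel]
    refine ⟨u, ((besselOp_jackSum_eq_iff hl hs hg a 0 2 c u).1 ?_).2, rfl⟩
    refine eq_of_eval_eq fun x hx _ => ?_
    rw [← opDB_eq_eval a κ (jackSum_isSymmetric hl hs u) hx, hc x hx, smul_eval]
  · rintro ⟨u, hu, rfl⟩
    refine ⟨jackSum_isSymmetric hl hs u,
      mem_span_below_iff.2 ⟨u, by rw [jackSum, add_sub_cancel_left]⟩, eigE a κ l, fun x hx => ?_⟩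
    rw [opDB_eq_eval a κ (jackSum_isSymmetric hl hs u) hx,
      (besselOp_jackSum_eq_iff hl hs hg a 0 2 _ u).2 ⟨rfl, hu⟩, smul_eval]

theorem smul_evalT_jackSum (κ : ℝ) (l : Fin n → ℕ) (s : ℂ) (u : Below l → ℂ) :
    evalT (s • jackSum κ l u) = s • jackT κ l + ∑ μ, (s * u μ) • jackT κ μ.1 := by
  funext z
  simp only [evalT, jackSum, jackT, smul_eval, map_add, map_sum, Pi.add_apply, Pi.smul_apply,
    Finset.sum_apply, smul_eq_mul, mul_add, Finset.mul_sum, mul_assoc]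

theorem isJacobiBC_iff {k₁ k₂ κ : ℝ} {l : Fin n → ℕ} (hl : Antitone l) (hs : Separated κ l)
    {g : (Fin n → ℕ) → Below l → ℂ} (hg : IsLowering κ l g) (F : (Fin n → ℂ) → ℂ) :
    IsJacobiBC k₁ k₂ κ l F ↔
      ∃ u, (sysMatrix g (1 + k₁ + 2 * k₂) κ (-1) (-(1 / 2 + k₁ + k₂))).mulVec u
          = (fun ν => - lowerCoeff g κ (-1) (-(1 / 2 + k₁ + k₂)) l ν) ∧
        F = evalT ((-4 : ℂ) ^ weight l • jackSum κ l u) := by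
  have h4 : (-4 : ℂ) ^ weight l ≠ 0 := pow_ne_zero _ (by norm_num)
  have hsym : ∀ u, ((-4 : ℂ) ^ weight l • jackSum κ l u).IsSymmetric := fun u =>
    isSymmetric_smul _ (jackSum_isSymmetric hl hs u)
  constructor
  · rintro ⟨h1, c, hc⟩
    obtain ⟨v, hv⟩ := mem_span_below_iff.1 h1
    obtain rfl : F = evalT ((-4 : ℂ) ^ weight l •
        jackSum κ l fun μ => ((-4 : ℂ) ^ weight l)⁻¹ * v μ) := by
      rw [smul_evalT_jackSum]
      simp only [mul_inv_cancel_left₀ h4]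
      rw [← hv, add_sub_cancel]
    refine ⟨_, ((besselOp_jackSum_eq_iff hl hs hg _ _ _ c _).1 ?_).2, rfl⟩
    refine smul_right_injective _ h4 ?_
    beta_reduce
    rw [← map_smul, smul_comm _ c]
    refine eq_of_eval_eq fun x hx h01 => ?_
    obtain ⟨z, hz, rfl⟩ := exists_isRegular hx h01
    have h2 := hc z hz
    rw [opDBC_evalT k₁ k₂ κ (hsym _) hz] at h2
    rw [smul_eval]
    exact h2
  · rintro ⟨u, hu, rfl⟩
    refine ⟨mem_span_below_iff.2 ⟨_, by rw [smul_evalT_jackSum, add_sub_cancel_left]⟩,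
      eigE (1 + k₁ + 2 * k₂) κ l, fun z hz => ?_⟩
    rw [opDBC_evalT k₁ k₂ κ (hsym u) hz, map_smul,
      (besselOp_jackSum_eq_iff hl hs hg _ _ _ _ u).2 ⟨rfl, hu⟩, smul_comm]
    exact smul_eval _ _ _

/-! ### The limit transition -/

/-- Jack polynomials are homogeneous of degree the weight. -/
theorem eval_smul_jack {κ : ℝ} {l : Fin n → ℕ} (hs : Separated κ l) {μ : Fin n → ℕ}
    (hμ : Antitone μ) (hle : μ ≤ l) (s : ℂ) (x : Fin n → ℂ) :
    eval (fun i => s * x i) (jack κ μ) = s ^ weight μ * eval x (jack κ μ) := by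
  have hm : ∀ ν : Fin n → ℕ, eval (fun i => s * x i) (monSym ν) = s ^ weight ν * eval x (monSym ν) := by
    intro ν
    simp only [monSym, map_sum, map_prod, map_pow, eval_X, Finset.mul_sum]
    refine Finset.sum_congr rfl fun α hα => ?_
    obtain ⟨σ, -, rfl⟩ := Finset.mem_image.1 hα
    rw [weight, ← Equiv.sum_comp σ, ← Finset.prod_pow_eq_pow_sum, ← Finset.prod_mul_distrib]
    exact Finset.prod_congr rfl fun i _ => mul_pow _ _ _
  have hspan : ∀ p ∈ Submodule.span ℂ (monSym '' {ν | Antitone ν ∧ DomLT ν μ}),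
      eval (fun i => s * x i) p = s ^ weight μ * eval x p := by
    intro p hp
    induction hp using Submodule.span_induction with
    | mem p hp =>
      obtain ⟨ν, hν, rfl⟩ := hp
      rw [hm, hν.2.2.1]
    | zero => simp
    | add p q _ _ h1 h2 => rw [map_add, map_add, h1, h2, mul_add]
    | smul c p _ h1 => rw [smul_eval, smul_eval, h1, mul_left_comm]
  have h := hspan _ (hs.jackPoly hμ hle).sub_mem
  rw [map_sub, map_sub, hm] at h
  linear_combination h

theorem weight_le_of_below {l : Fin n → ℕ} (μ : Below l) : weight μ.1 ≤ weight l :=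
  Finset.sum_le_sum fun i _ => μ.2.2.le i

/-- Rescaling the variables in `P_l + ∑ v_μ P_μ`. -/
theorem eval_smul_jackSum {κ : ℝ} {l : Fin n → ℕ} (hl : Antitone l) (hs : Separated κ l)
    (s : ℂ) (v : Below l → ℂ) (x : Fin n → ℂ) :
    eval (fun i => s * x i) (jackSum κ l fun μ => s ^ (weight l - weight μ.1) * v μ)
      = s ^ weight l * eval x (jackSum κ l v) := by
  simp only [jackSum, map_add, map_sum, smul_eval, mul_add, Finset.mul_sum]
  rw [eval_smul_jack hs hl le_rfl]
  congr 1
  refine Finset.sum_congr rfl fun μ _ => ?_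
  rw [eval_smul_jack hs μ.2.1 μ.2.2.le, ← Nat.sub_add_cancel (weight_le_of_below μ), pow_add,
    Nat.add_sub_cancel]
  ring

theorem tendsto_exp_neg : Tendsto (fun ε : ℝ => (Real.exp (-ε) : ℂ)) atTop (𝓝 0) := by
  have h := (Complex.continuous_ofReal.tendsto 0).comp Real.tendsto_exp_neg_atTop_nhds_zero
  rwa [Complex.ofReal_zero] at h

/-- The rescaled coordinate `-4 e^{-ε} t(w + ε)`. -/
theorem rescaled_coordinate (w : ℂ) (ε : ℝ) :
    -4 * (Real.exp (-ε) : ℂ) * -Complex.sinh ((w + ε) / 2) ^ 2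
      = Complex.exp w + Complex.exp (-w) * (Real.exp (-ε) : ℂ) ^ 2 - 2 * (Real.exp (-ε) : ℂ) := by
  have h1 : Complex.exp (ε : ℂ) * Complex.exp (-(ε : ℂ)) = 1 := by
    rw [← Complex.exp_add, add_neg_cancel, Complex.exp_zero]
  rw [neg_sinh_half_sq, Complex.cosh, neg_add, Complex.exp_add, Complex.exp_add,
    Complex.ofReal_exp, Complex.ofReal_neg]
  linear_combination Complex.exp w * h1

theorem tendsto_jacobiBC {a κ : ℝ} {l : Fin n → ℕ} (hl : Antitone l) (hs : Separated κ l)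
    {g : (Fin n → ℕ) → Below l → ℂ} (hg : IsLowering κ l g)
    (he : ∀ μ : Below l, eigE (a : ℂ) κ μ.1 ≠ eigE (a : ℂ) κ l)
    {F : ℝ → (Fin n → ℂ) → ℂ} (hF : ∀ ε, IsJacobiBC ((a - 1 + 2 * Real.exp ε) / 2)
      ((a - 1 - 2 * Real.exp ε) / 4) κ l (F ε))
    {Y : MvPolynomial (Fin n) ℂ} (hY : IsBessel a κ l Y) (z : Fin n → ℂ) :
    Tendsto (fun ε : ℝ => Complex.exp (-(ε : ℂ) * (weight l : ℂ)) * F ε fun i => z i + (ε : ℂ))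
      atTop (𝓝 (eval (fun i => Complex.exp (z i)) Y)) := by
  have hr : ∀ ε : ℝ, (Real.exp (-ε) : ℂ) * (Real.exp ε : ℂ) = 1 := fun ε => by
    rw [← Complex.ofReal_mul, ← Real.exp_add, neg_add_cancel, Real.exp_zero, Complex.ofReal_one]
  choose v hv hFv using fun ε => (isJacobiBC_iff hl hs hg (F ε)).1 (hF ε)
  set s : ℝ → ℂ := fun ε => -4 * (Real.exp (-ε) : ℂ) with hsdef
  set q : ℝ → ℂ := fun ε => 2 + (3 * a - 1) * (Real.exp (-ε) : ℂ) with hqdef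
  set u : ℝ → Below l → ℂ := fun ε μ => s ε ^ (weight l - weight μ.1) * v ε μ with hudef
  -- After rescaling by `s = -4 e^{-ε}` the parameters `(-1, -(1/2 + k₁ + k₂))` become
  -- `(4 e^{-ε}, 2 + (3a - 1) e^{-ε})`, which tend to `(0, 2)`.
  have hu : ∀ ε, (sysMatrix g a κ (-s ε) (q ε)).mulVec (u ε)
      = fun ν => - lowerCoeff g κ (-s ε) (q ε) l ν := by
    intro ε
    have h := sys_scale hl hg (s ε) (hv ε)
    have ha : (1 + (((a - 1 + 2 * Real.exp ε) / 2 : ℝ) : ℂ)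
        + 2 * (((a - 1 - 2 * Real.exp ε) / 4 : ℝ) : ℂ)) = a := by
      push_cast
      ring
    have hq : s ε * -(1 / 2 + (((a - 1 + 2 * Real.exp ε) / 2 : ℝ) : ℂ)
        + (((a - 1 - 2 * Real.exp ε) / 4 : ℝ) : ℂ)) = q ε := by
      have h1 := hr ε
      rw [hsdef, hqdef]
      beta_reduce
      simp only [Complex.ofReal_div, Complex.ofReal_add, Complex.ofReal_sub, Complex.ofReal_mul,
        Complex.ofReal_one, Complex.ofReal_ofNat]
      linear_combination 2 * h1
    rw [ha, hq, mul_neg_one] at h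
    exact h
  have hp0 : Tendsto (fun ε => -s ε) atTop (𝓝 0) := by
    simpa [hsdef] using (tendsto_exp_neg.const_mul (-4 : ℂ)).neg
  have hq0 : Tendsto q atTop (𝓝 2) := by
    simpa [hqdef] using (tendsto_exp_neg.const_mul (3 * (a : ℂ) - 1)).const_add 2
  have hlow : ∀ μ ν, Tendsto (fun ε => lowerCoeff g κ (-s ε) (q ε) μ ν) atTop
      (𝓝 (lowerCoeff g κ 0 2 μ ν)) := fun μ ν =>
    ((hp0.mul_const _).add hq0).mul_const _
  obtain ⟨u₀, hu₀, hlim⟩ := exists_tendsto_of_mulVec_eq (l := atTop)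
    (M := fun ε => sysMatrix g a κ (-s ε) (q ε)) (M₀ := sysMatrix g a κ 0 2) (w := u)
    (b := fun ε ν => - lowerCoeff g κ (-s ε) (q ε) l ν) (b₀ := fun ν => - lowerCoeff g κ 0 2 l ν)
    (fun ν μ => (hlow μ.1 ν).const_add _) (fun ν => (hlow l ν).neg)
    (Eventually.of_forall hu) (sysMatrix_injective hg 0 2 he)
  obtain ⟨u₁, hu₁, rfl⟩ := (isBessel_iff hl hs hg Y).1 hY
  obtain rfl : u₁ = u₀ := (existsUnique_sys hg 0 2 he _).unique hu₁ hu₀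
  have hy : Tendsto (fun (ε : ℝ) i => s ε * -Complex.sinh ((z i + ε) / 2) ^ 2) atTop
      (𝓝 fun i => Complex.exp (z i)) := by
    refine tendsto_pi_nhds.2 fun i => ?_
    simp only [hsdef, rescaled_coordinate]
    simpa using (((tendsto_exp_neg.pow 2).const_mul (Complex.exp (-z i))).const_add
      (Complex.exp (z i))).sub (tendsto_exp_neg.const_mul 2)
  have hval : ∀ ε : ℝ, Complex.exp (-(ε : ℂ) * (weight l : ℂ)) * F ε (fun i => z i + (ε : ℂ))
      = eval (fun i => s ε * -Complex.sinh ((z i + ε) / 2) ^ 2) (jackSum κ l (u ε)) := by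
    intro ε
    rw [hFv ε, eval_smul_jackSum hl hs, evalT, smul_eval, ← mul_assoc, hsdef, mul_pow, mul_comm
      (-(ε : ℂ)), Complex.exp_nat_mul, Complex.ofReal_exp, Complex.ofReal_neg]
    ring
  simp only [hval, jackSum, map_add, map_sum, smul_eval]
  have hev : ∀ p : MvPolynomial (Fin n) ℂ,
      Tendsto (fun ε : ℝ => eval (fun i => s ε * -Complex.sinh ((z i + ε) / 2) ^ 2) p) atTop
        (𝓝 (eval (fun i => Complex.exp (z i)) p)) := fun p =>
    ((MvPolynomial.continuous_eval p).tendsto _).comp hy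
  exact (hev _).add (tendsto_finsetSum _ fun μ _ => (hlim μ).mul (hev _))

end MultiBessel

theorem mainTheorem5 (n : ℕ) (a κ : ℝ) (l : Fin n → ℕ) (hl : Antitone l)
    (hJack : ∀ μ : Fin n → ℕ, Antitone μ → μ ≤ l → ∀ ν : Fin n → ℕ, Antitone ν →
      MultiBessel.DomLT ν μ → MultiBessel.eigD κ ν ≠ MultiBessel.eigD κ μ)
    (hBessel : ∀ μ : Fin n → ℕ, Antitone μ → μ < l →
      MultiBessel.eigB a κ μ ≠ MultiBessel.eigB a κ l) :
    (∀ μ : Fin n → ℕ, Antitone μ → μ ≤ l →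
      ∃! P : MvPolynomial (Fin n) ℂ, MultiBessel.IsJack κ μ P) ∧
    (∃! Y : MvPolynomial (Fin n) ℂ, MultiBessel.IsBessel a κ l Y) ∧
    (∀ ε : ℝ, ∃! F : (Fin n → ℂ) → ℂ,
      MultiBessel.IsJacobiBC ((a - 1 + 2 * Real.exp ε) / 2) ((a - 1 - 2 * Real.exp ε) / 4) κ l F) ∧
    ∀ z : Fin n → ℂ,
      Tendsto
        (fun ε : ℝ => Complex.exp (-(ε : ℂ) * (MultiBessel.weight l : ℂ)) *
          MultiBessel.jacobiBC ((a - 1 + 2 * Real.exp ε) / 2) ((a - 1 - 2 * Real.exp ε) / 4) κ l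
            (fun i => z i + (ε : ℂ)))
        atTop
        (𝓝 (MvPolynomial.eval (fun i => Complex.exp (z i)) (MultiBessel.bessel a κ l))) := by
  have hs : MultiBessel.Separated κ l := hJack
  obtain ⟨g, hg⟩ := hs.exists_isLowering
  have hE : ∀ μ : Fin n → ℕ, MultiBessel.eigE (a : ℂ) κ μ = (MultiBessel.eigB a κ μ : ℂ) := by
    intro μ
    rw [MultiBessel.eigE, MultiBessel.eigC_ofReal, MultiBessel.eigB]
    push_cast
    rfl
  have he : ∀ μ : MultiBessel.Below l,
      MultiBessel.eigE (a : ℂ) κ μ.1 ≠ MultiBessel.eigE (a : ℂ) κ l := by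
    intro μ h
    rw [hE, hE] at h
    exact hBessel μ.1 μ.2.1 μ.2.2 (Complex.ofReal_injective h)
  have hB : ∃! Y : MvPolynomial (Fin n) ℂ, MultiBessel.IsBessel a κ l Y := by
    obtain ⟨u, hu, huniq⟩ := MultiBessel.existsUnique_sys hg 0 2 he
      fun ν => - MultiBessel.lowerCoeff g κ 0 2 l ν
    refine ⟨MultiBessel.jackSum κ l u, (MultiBessel.isBessel_iff hl hs hg _).2 ⟨u, hu, rfl⟩, ?_⟩
    intro Y hY
    obtain ⟨v, hv, rfl⟩ := (MultiBessel.isBessel_iff hl hs hg _).1 hY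
    rw [huniq v hv]
  have hJ : ∀ ε : ℝ, ∃! F : (Fin n → ℂ) → ℂ, MultiBessel.IsJacobiBC
      ((a - 1 + 2 * Real.exp ε) / 2) ((a - 1 - 2 * Real.exp ε) / 4) κ l F := by
    intro ε
    have ha : (1 + (((a - 1 + 2 * Real.exp ε) / 2 : ℝ) : ℂ)
        + 2 * (((a - 1 - 2 * Real.exp ε) / 4 : ℝ) : ℂ)) = a := by
      push_cast
      ring
    obtain ⟨u, hu, huniq⟩ := MultiBessel.existsUnique_sys hg (-1)
      (-(1 / 2 + (((a - 1 + 2 * Real.exp ε) / 2 : ℝ) : ℂ)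
        + (((a - 1 - 2 * Real.exp ε) / 4 : ℝ) : ℂ))) he fun ν => - MultiBessel.lowerCoeff g κ _ _ l ν
    rw [← ha] at hu
    refine ⟨_, (MultiBessel.isJacobiBC_iff hl hs hg _).2 ⟨u, hu, rfl⟩, ?_⟩
    intro F hF
    obtain ⟨v, hv, rfl⟩ := (MultiBessel.isJacobiBC_iff hl hs hg _).1 hF
    rw [ha] at hv
    rw [huniq v hv]
  exact ⟨fun μ hμ hle => MultiBessel.existsUnique_isJack hμ (hJack μ hμ hle), hB, hJ,
    MultiBessel.tendsto_jacobiBC hl hs hg he (fun ε => Classical.epsilon_spec (hJ ε).exists)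
      (Classical.epsilon_spec hB.exists)⟩
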